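/- Let $P$ be a probability measure on the space $[0,1]^{\mathbb Z}$ of environments $\omega=(\omega_x)_{x\in\mathbb Z}$ under which the $\omega_x$, $x\in\mathbb Z$, are independent and identically distributed, and assume that $P(\omega_0=1)<1$. For a fixed environment $\omega$ let $P_\omega$ (the quenched law, with expectation $E_\omega$ and variance $\mathrm{Var}_\omega$) be the law of the Markov chain $(X_k)_{k\ge 0}$ on $\mathbb Z$ with $X_0=0$ which steps from $y$ to $y+1$ with probability $\omega_y$ and from $y$ to $y-1$ with probability $1-\omega_y$. Let $T_n=\inf\{k\ge 0: X_k=n\}$, let $\rho_x=\frac{1-\omega_x}{\omega_x}\in[0,\infty]$ (with $\rho_x=\infty$ if $\omega_x=0$), and assume that $$\kappa:=\sup\{p>0: E[\rho_0^p]<1\}\in[0,\infty]\quad\text{satisfies}\quad \kappa>2$$ (with $\sup\emptyset=0$). Let $\Phi$ be the standard normal distribution function, and write $\|f\|_\infty=\sup_{x\in\mathbb R}|f(x)|$. Then for $P$-a.e. $\omega$ one has $P_\omega(T_n<\infty)=1$ and $E_\omega[T_n^2]<\infty$ for all $n\ge 0$, and $\mathrm{Var}_\omega(T_n)>0$ for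 all sufficiently large $n$, so that $$\overline F_{n,\omega}(x)=P_\omega\left(\frac{T_n-E_\omega[T_n]}{\sqrt{\mathrm{Var}_\omega(T_n)}}\le x\right),\qquad x\in\mathbb R,$$ is well defined for all large $n$. Moreover: 1. If $\kappa>3$ (including $\kappa=\infty$), then there exists a constant $C\in(0,\infty)$, depending only on $P$, such that $$\limsup_{n\to\infty}\sqrt n\,\bigl\|\overline F_{n,\omega}-\Phi\bigr\|_\infty\le C\qquad\text{for }P\text{-a.e. }\omega.$$ 2. If $\kappa\in(2,3]$, then for every $\varepsilon>0$ $$\lim_{n\to\infty}n^{\frac32-\frac3\kappa-\varepsilon}\bigl\|\overline F_{n,\omega}-\Phi\bigr\|_\infty=0\qquad\text{for }P\text{-a.e. }\omega.$$ -/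

import Mathlib

open MeasureTheory ProbabilityTheory Filter Topology
open scoped ENNReal

namespace RWRE

noncomputable section

/-- An environment on `ℤ`: `ω x` is the probability of stepping from `x` to `x + 1`. -/
abbrev Env : Type := ℤ → unitInterval

/-- Trajectories `(X_k)_{k ≥ 0}` of a walk on `ℤ`. -/
abbrev Path : Type := ℕ → ℤ

/-- Under `P` the coordinates `ω_x`, `x ∈ ℤ`, are independent and identically distributed. -/
def IsIID (P : Measure Env) : Prop :=
  iIndepFun (fun (x : ℤ) (ω : Env) => ω x) P ∧
    ∀ x : ℤ, IdentDistrib (fun ω : Env => ω x) (fun ω : Env => ω 0) P P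

/-- `ρ_x = (1 - ω_x) / ω_x`, with values in `[0, ∞]` (it equals `∞` exactly if `ω_x = 0`). -/
def rho (ω : Env) (x : ℤ) : ℝ≥0∞ :=
  ENNReal.ofReal (1 - (ω x : ℝ)) / ENNReal.ofReal (ω x : ℝ)

/-- `κ = sup {p > 0 : E[ρ_0 ^ p] < 1}`, with values in `[0, ∞]`. -/
def kappa (P : Measure Env) : ℝ≥0∞ :=
  ⨆ (p : ℝ) (_ : 0 < p) (_ : ∫⁻ ω, rho ω 0 ^ p ∂P < 1), ENNReal.ofReal p

/-- Law of one step of the walk in the environment `ω`, started from `y`. -/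
def stepMeasure (ω : Env) (y : ℤ) : Measure ℤ :=
  ENNReal.ofReal (ω y : ℝ) • Measure.dirac (y + 1) +
    ENNReal.ofReal (1 - (ω y : ℝ)) • Measure.dirac (y - 1)

/-- The transition kernel of the walk in the environment `ω`. -/
def stepKernel (ω : Env) : Kernel ℤ ℤ where
  toFun := stepMeasure ω
  measurable' := measurable_of_countable _

instance (ω : Env) : IsMarkovKernel (stepKernel ω) where
  isProbabilityMeasure y := by
    constructor
    change stepMeasure ω y Set.univ = 1
    have h0 : (0 : ℝ) ≤ (ω y : ℝ) := (ω y).2.1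
    have h1 : (0 : ℝ) ≤ 1 - (ω y : ℝ) := sub_nonneg.2 (ω y).2.2
    simp [stepMeasure, ← ENNReal.ofReal_add h0 h1]

/-- The same kernel as a function of the trajectory up to time `k`: the law of `X_{k+1}` given
`(X_0, …, X_k)` depends on `X_k` only. -/
def historyKernel (ω : Env) (k : ℕ) : Kernel (∀ _ : Finset.Iic k, ℤ) ℤ :=
  (stepKernel ω).comap (fun h => h ⟨k, Finset.mem_Iic.2 le_rfl⟩) (measurable_pi_apply _)

instance (ω : Env) (k : ℕ) : IsMarkovKernel (historyKernel ω k) := by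
  unfold historyKernel; infer_instance

/-- The quenched law `P_ω` on trajectories: the law of the Markov chain with transition kernel
`stepKernel ω` and `X_0 = 0`. -/
def quenched (ω : Env) : Measure Path :=
  Kernel.traj (X := fun _ => ℤ) (historyKernel ω) 0 (fun _ => 0)

/-- `T_n = inf {k ≥ 0 : X_k = n}`, with value `⊤` if `n` is never visited. -/
def hittingTime (n : ℤ) (X : Path) : WithTop ℕ :=
  hittingAfter (fun (k : ℕ) (Y : Path) => Y k) {n} 0 X

/-- `T_n` as a real number (the value `0` on `{T_n = ∞}` plays no role when this event is null). -/
def hittingTimeReal (n : ℤ) (X : Path) : ℝ :=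
  ((hittingTime n X).untopD 0 : ℕ)

/-- Quenched mean `E_ω[T_n]`. -/
def quenchedMean (ω : Env) (n : ℤ) : ℝ := ∫ X, hittingTimeReal n X ∂(quenched ω)

/-- Quenched variance `Var_ω(T_n)`. -/
def quenchedVar (ω : Env) (n : ℤ) : ℝ := Var[hittingTimeReal n; quenched ω]

/-- `x ↦ P_ω((T_n - E_ω[T_n]) / √Var_ω(T_n) ≤ x)`. -/
def normalizedCDF (ω : Env) (n : ℤ) (x : ℝ) : ℝ :=
  (quenched ω).real
    {X | (hittingTimeReal n X - quenchedMean ω n) / √(quenchedVar ω n) ≤ x}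

/-- The standard normal distribution function. -/
def Phi (x : ℝ) : ℝ := cdf (gaussianReal 0 1) x

/-- The uniform distance between the normalized quenched distribution function of `T_n` and the
standard normal one (a supremum of numbers in `[0, 1]`). -/
def supDist (ω : Env) (n : ℤ) : ℝ := ⨆ x : ℝ, |normalizedCDF ω n x - Phi x|

end

end RWRE

/-! To reach `n` the walk must cross every edge from `i` to `i + 1` with `0 ≤ i < n`, so in a fixed
environment `T_n` is a sum of independent, not identically distributed crossing times. The theorem
is a Berry–Esseen bound for this sum, combined with almost sure control of the quenched variances
from below and of the quenched third moments from above.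

Independence enters through laws rather than paths. The first passage probabilities `hit` solve the
backward equation, the Markov property identifies them with the law of `T_n`
(`quenched_hittingTime_eq`), and they convolve (`hit_eq_sum_antidiagonal`). Hence `T_n` has the law
of a sum of coordinates under an infinite product measure (`passageLaw_eq_map_sum`). `berryEsseen`
is proved by Stein's method: the solution of Stein's equation for a half-line has a derivative with
one jump, and the Chen–Shao inequality `concentration` bounds the probability of being near that
jump.

The variance of a crossing time is at least `ω_i (1 - ω_i)`, whose average converges to a positive
limit: `κ > 0` excludes `ω_0 = 0` almost surely and nondegeneracy prevents `ω_0 = 1` almost surely.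
So the variance of `T_n` grows at least linearly.

For the third moments, decompose at the first step from `i`: either it crosses, or the walk must
cross from `i - 1` and then again from `i`. Each quenched moment then satisfies `M_i ≤ ρ_i M_{i-1} +
R_i`, where `R_i` involves lower moments only and `ρ_i` is independent of `M_{i-1}`. By
stationarity, `E[ρ_0 ^ q] < 1` bounds `E[M ^ q]` by a multiple of `E[R ^ q]`
(`lintegral_rpow_le_of_recursion`). Applied to the moments of order 1, 2, 3 with `q = p, p/2, p/3`,
this gives `E[M_3 ^ (p/3)] < ∞` for every `p < κ` with `p ≤ 3`. The argument subtracts a term from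
both sides, so it is run on truncated moments, which are bounded, with constants free of the
truncation level. The same recursion with `R = 0` shows that every crossing time is almost surely
finite.

If `κ > 3`, then `M_3` is integrable and its sums grow at most linearly: the truncated moments have
finite range dependence and obey the strong law along arithmetic progressions, while Garsia's
maximal inequality handles the remainder. If `2 < κ ≤ 3`, the moment of order `p/3 ≤ 1` gives sums
of order `n ^ ((1 + δ) · 3/p)`. Dividing by the cube of the standard deviation, at least of order `n
^ (3/2)`, gives both rates. -/

namespace RWRE

/-! ### The solution of Stein's equation for half-lines -/

/-- The unnormalized Gaussian lower tail. -/
noncomputable def gaussTail (w : ℝ) : ℝ := ∫ x in Set.Iic w, Real.exp (-x ^ 2 / 2)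

lemma integrable_exp_neg_sq_half : Integrable (fun x : ℝ => Real.exp (-x ^ 2 / 2)) := by
  have h := integrable_exp_neg_mul_sq (b := 1 / 2) (by norm_num)
  refine h.congr (ae_of_all _ fun x => ?_)
  simp only
  congr 1
  ring

lemma integral_exp_neg_sq_half : ∫ x : ℝ, Real.exp (-x ^ 2 / 2) = √(2 * Real.pi) := by
  have h := integral_gaussian (1 / 2)
  rw [show Real.pi / (1 / 2) = 2 * Real.pi by ring] at h
  rw [← h]
  congr 1
  ext x
  congr 1
  ring

lemma sqrt_two_pi_pos : 0 < √(2 * Real.pi) := Real.sqrt_pos.2 (by positivity)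

lemma sqrt_two_pi_le_three : √(2 * Real.pi) ≤ 3 := by
  rw [Real.sqrt_le_left (by norm_num)]
  have := Real.pi_lt_d2
  norm_num at this ⊢
  linarith

lemma gaussTail_add_neg (w : ℝ) : gaussTail w + gaussTail (-w) = √(2 * Real.pi) := by
  have h1 : gaussTail (-w) = ∫ x in Set.Ioi w, Real.exp (-x ^ 2 / 2) := by
    have := integral_comp_neg_Iic (-w) (fun x : ℝ => Real.exp (-x ^ 2 / 2))
    simpa [gaussTail] using this
  rw [h1, gaussTail, ← integral_exp_neg_sq_half,
    ← setIntegral_union (Set.Iic_disjoint_Ioi le_rfl) measurableSet_Ioi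
      integrable_exp_neg_sq_half.integrableOn integrable_exp_neg_sq_half.integrableOn,
    Set.Iic_union_Ioi, setIntegral_univ]

lemma gaussTail_nonneg (w : ℝ) : 0 ≤ gaussTail w :=
  setIntegral_nonneg measurableSet_Iic fun _ _ => (Real.exp_pos _).le

lemma gaussTail_mono : Monotone gaussTail := fun _ _ h =>
  setIntegral_mono_set integrable_exp_neg_sq_half.integrableOn
    (ae_of_all _ fun _ => (Real.exp_pos _).le) (Set.Iic_subset_Iic.2 h).eventuallyLE

lemma gaussTail_le (w : ℝ) : gaussTail w ≤ √(2 * Real.pi) := by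
  linarith [gaussTail_add_neg w, gaussTail_nonneg (-w)]

lemma Phi_eq (z : ℝ) : Phi z = gaussTail z / √(2 * Real.pi) := by
  rw [Phi, cdf_eq_real, Measure.real, gaussianReal_apply_eq_integral _ one_ne_zero,
    ENNReal.toReal_ofReal (setIntegral_nonneg measurableSet_Iic fun x _ =>
      gaussianPDFReal_nonneg 0 1 x), gaussTail, div_eq_inv_mul, ← integral_const_mul]
  congr 1
  ext x
  simp [gaussianPDFReal_def]

lemma hasDerivAt_gaussTail (w : ℝ) : HasDerivAt gaussTail (Real.exp (-w ^ 2 / 2)) w := by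
  have hc : Continuous fun x : ℝ => Real.exp (-x ^ 2 / 2) := by fun_prop
  have h : gaussTail = fun u => gaussTail 0 + ∫ x in (0 : ℝ)..u, Real.exp (-x ^ 2 / 2) := by
    ext u
    rw [← intervalIntegral.integral_Iic_sub_Iic integrable_exp_neg_sq_half.integrableOn
      integrable_exp_neg_sq_half.integrableOn]
    simp [gaussTail]
  rw [h]
  exact (intervalIntegral.integral_hasDerivAt_right (hc.intervalIntegrable _ _)
    (hc.stronglyMeasurableAtFilter _ _) hc.continuousAt).const_add _

/-- The Mills ratio. -/
noncomputable def mills (w : ℝ) : ℝ := Real.exp (w ^ 2 / 2) * gaussTail w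

lemma mills_nonneg (w : ℝ) : 0 ≤ mills w := mul_nonneg (Real.exp_pos _).le (gaussTail_nonneg w)

lemma hasDerivAt_mills (w : ℝ) : HasDerivAt mills (w * mills w + 1) w := by
  have h1 : HasDerivAt (fun w : ℝ => Real.exp (w ^ 2 / 2)) (Real.exp (w ^ 2 / 2) * w) w := by
    have : HasDerivAt (fun w : ℝ => w ^ 2 / 2) w w :=
      ((hasDerivAt_pow 2 w).div_const 2).congr_deriv (by simp)
    exact this.exp
  refine (h1.mul (hasDerivAt_gaussTail w)).congr_deriv ?_
  have : Real.exp (w ^ 2 / 2) * Real.exp (-w ^ 2 / 2) = 1 := by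
    rw [← Real.exp_add]
    simp [neg_div]
  rw [this, mills]
  ring

/-- For `x ≤ w ≤ 0` one has `w² - x² ≤ -(x - w)²`, so the integrand is dominated by a Gaussian
centred at `w`, of total mass `√(2π)`. -/
lemma mills_le_three {w : ℝ} (hw : w ≤ 0) : mills w ≤ 3 := by
  refine le_trans ?_ sqrt_two_pi_le_three
  have hi := integrable_exp_neg_sq_half.comp_sub_right w
  rw [mills, gaussTail, ← integral_const_mul, ← integral_exp_neg_sq_half,
    ← integral_sub_right_eq_self (fun x : ℝ => Real.exp (-x ^ 2 / 2)) w]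
  refine le_trans (setIntegral_mono_on (integrable_exp_neg_sq_half.integrableOn.const_mul _)
    hi.integrableOn measurableSet_Iic fun x hx => ?_)
    (setIntegral_le_integral hi (ae_of_all _ fun _ => (Real.exp_pos _).le))
  rw [← Real.exp_add, Real.exp_le_exp]
  have hx' : x ≤ w := hx
  nlinarith [mul_nonneg (sub_nonneg.2 hx') (neg_nonneg.2 hw)]

/-- On `x ≤ w` the factor `-w` is at most `-x`, and `-x e^{-x²/2}` has the explicit primitive
`e^{-x²/2}`. -/
lemma abs_mul_mills_le_one {w : ℝ} (hw : w ≤ 0) : |w * mills w| ≤ 1 := by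
  have hd : ∀ x : ℝ, HasDerivAt (fun x : ℝ => Real.exp (-x ^ 2 / 2))
      (-x * Real.exp (-x ^ 2 / 2)) x := by
    intro x
    have : HasDerivAt (fun w : ℝ => -w ^ 2 / 2) (-x) x :=
      ((hasDerivAt_pow 2 x).neg.div_const 2).congr_deriv (by simp; ring)
    exact this.exp.congr_deriv (by ring)
  have hlim : Tendsto (fun x : ℝ => Real.exp (-x ^ 2 / 2)) atBot (𝓝 0) := by
    refine Real.tendsto_exp_atBot.comp ?_
    have h2 : Tendsto (fun x : ℝ => x ^ 2) atBot atTop :=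
      ((tendsto_pow_atTop two_ne_zero).comp tendsto_neg_atBot_atTop).congr fun x => neg_sq x
    have := tendsto_neg_atTop_atBot.comp (h2.atTop_div_const (by norm_num : (0 : ℝ) < 2))
    refine this.congr fun x => ?_
    simp [neg_div]
  have hint : IntegrableOn (fun x : ℝ => -x * Real.exp (-x ^ 2 / 2)) (Set.Iic w) := by
    have := (integrable_mul_exp_neg_mul_sq (b := 1 / 2) (by norm_num)).neg
    refine (this.congr (ae_of_all _ fun x => ?_)).integrableOn
    simp only [Pi.neg_apply, neg_mul]
    congr 3
    ring
  have hI := integral_Iic_of_hasDerivAt_of_tendsto (hd w).continuousAt.continuousWithinAt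
    (fun x _ => hd x) hint hlim
  have hle : -w * gaussTail w ≤ Real.exp (-w ^ 2 / 2) := by
    rw [sub_zero] at hI
    rw [← hI, gaussTail, ← integral_const_mul]
    refine setIntegral_mono_on (integrable_exp_neg_sq_half.integrableOn.const_mul _) hint
      measurableSet_Iic fun x hx => ?_
    have hx' : x ≤ w := hx
    exact mul_le_mul_of_nonneg_right (neg_le_neg hx') (Real.exp_pos _).le
  rw [abs_mul, abs_of_nonpos hw, abs_of_nonneg (mills_nonneg w), mills]
  calc -w * (Real.exp (w ^ 2 / 2) * gaussTail w)
      = Real.exp (w ^ 2 / 2) * (-w * gaussTail w) := by ring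
    _ ≤ Real.exp (w ^ 2 / 2) * Real.exp (-w ^ 2 / 2) := by gcongr
    _ = 1 := by rw [← Real.exp_add]; simp [neg_div]

/-- The bounded solution of Stein's equation `f' w - w f w = 1_{w ≤ z} - Φ z`. -/
noncomputable def steinSol (z w : ℝ) : ℝ :=
  if w ≤ z then mills w * (gaussTail (-z) / √(2 * Real.pi))
  else mills (-w) * (gaussTail z / √(2 * Real.pi))

/-- The derivative of `steinSol z` (off `z`), read off from Stein's equation. -/
noncomputable def steinDeriv (z w : ℝ) : ℝ :=
  w * steinSol z w + (Set.Iic z).indicator 1 w - Phi z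

/-- The quantity is `steinSol w w`, the worst case over `z`. It is even in `w`, so the Mills ratio
bounds on the negative half-line suffice. -/
lemma exp_mul_gaussTail_mul_le (w : ℝ) :
    0 ≤ mills w * (gaussTail (-w) / √(2 * Real.pi)) ∧
    mills w * (gaussTail (-w) / √(2 * Real.pi)) ≤ 3 ∧
    |w * (mills w * (gaussTail (-w) / √(2 * Real.pi)))| ≤ 1 := by
  have hc := sqrt_two_pi_pos
  have key : ∀ v : ℝ, 0 ≤ gaussTail v / √(2 * Real.pi) ∧ gaussTail v / √(2 * Real.pi) ≤ 1 :=
    fun v => ⟨div_nonneg (gaussTail_nonneg v) hc.le, (div_le_one hc).2 (gaussTail_le v)⟩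
  have hsymm : mills w * (gaussTail (-w) / √(2 * Real.pi)) =
      mills (-w) * (gaussTail w / √(2 * Real.pi)) := by
    simp only [mills, neg_sq]
    ring
  refine ⟨mul_nonneg (mills_nonneg w) (key _).1, ?_, ?_⟩
  · rcases le_total w 0 with h | h
    · exact (mul_le_of_le_one_right (mills_nonneg w) (key _).2).trans (mills_le_three h)
    · rw [hsymm]
      exact (mul_le_of_le_one_right (mills_nonneg _) (key _).2).trans
        (mills_le_three (neg_nonpos.2 h))
  · rcases le_total w 0 with h | h
    · rw [← mul_assoc, abs_mul, abs_of_nonneg (key _).1]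
      exact (mul_le_of_le_one_right (abs_nonneg _) (key _).2).trans (abs_mul_mills_le_one h)
    · rw [hsymm, ← mul_assoc, abs_mul, abs_of_nonneg (key _).1]
      refine (mul_le_of_le_one_right (abs_nonneg _) (key _).2).trans ?_
      have := abs_mul_mills_le_one (neg_nonpos.2 h)
      rwa [neg_mul, abs_neg] at this

/-- For fixed `w`, monotonicity of the Gaussian tail makes `z = w` the maximizer on either branch.
-/
lemma steinSol_le (z w : ℝ) :
    0 ≤ steinSol z w ∧ steinSol z w ≤ mills w * (gaussTail (-w) / √(2 * Real.pi)) := by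
  have hc := sqrt_two_pi_pos
  unfold steinSol
  split_ifs with h
  · refine ⟨mul_nonneg (mills_nonneg w) (div_nonneg (gaussTail_nonneg _) hc.le), ?_⟩
    gcongr
    · exact mills_nonneg w
    · exact gaussTail_mono (neg_le_neg h)
  · refine ⟨mul_nonneg (mills_nonneg _) (div_nonneg (gaussTail_nonneg _) hc.le), ?_⟩
    have hsymm : mills w * (gaussTail (-w) / √(2 * Real.pi)) =
        mills (-w) * (gaussTail w / √(2 * Real.pi)) := by
      simp only [mills, neg_sq]
      ring
    rw [hsymm]
    gcongr
    · exact mills_nonneg _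
    · exact gaussTail_mono (not_le.1 h).le

lemma abs_steinSol_le (z w : ℝ) : |steinSol z w| ≤ 3 := by
  rw [abs_of_nonneg (steinSol_le z w).1]
  exact (steinSol_le z w).2.trans (exp_mul_gaussTail_mul_le w).2.1

lemma abs_mul_steinSol_le (z w : ℝ) : |w * steinSol z w| ≤ 1 := by
  have h := (exp_mul_gaussTail_mul_le w).2.2
  rw [abs_mul, abs_of_nonneg (exp_mul_gaussTail_mul_le w).1] at h
  rw [abs_mul, abs_of_nonneg (steinSol_le z w).1]
  exact (mul_le_mul_of_nonneg_left (steinSol_le z w).2 (abs_nonneg _)).trans h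

lemma Phi_nonneg (z : ℝ) : 0 ≤ Phi z := cdf_nonneg _ _

lemma Phi_le_one (z : ℝ) : Phi z ≤ 1 := cdf_le_one _ _

lemma gaussTail_neg_div (z : ℝ) : gaussTail (-z) / √(2 * Real.pi) = 1 - Phi z := by
  rw [Phi_eq, eq_sub_iff_add_eq, ← add_div, add_comm, gaussTail_add_neg,
    div_self sqrt_two_pi_pos.ne']

lemma steinDeriv_of_le {z w : ℝ} (h : w ≤ z) :
    steinDeriv z w = w * steinSol z w + (1 - Phi z) := by
  rw [steinDeriv, Set.indicator_of_mem (Set.mem_Iic.2 h)]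
  simp [add_sub_assoc]

lemma steinDeriv_of_lt {z w : ℝ} (h : z < w) : steinDeriv z w = w * steinSol z w - Phi z := by
  rw [steinDeriv, Set.indicator_of_notMem (by simpa using h), add_zero]

lemma abs_steinDeriv_le (z w : ℝ) : |steinDeriv z w| ≤ 2 := by
  have h1 := abs_le.1 (abs_mul_steinSol_le z w)
  have h2 := Phi_nonneg z
  have h3 := Phi_le_one z
  rcases le_or_gt w z with h | h
  · rw [steinDeriv_of_le h, abs_le]
    constructor <;> linarith
  · rw [steinDeriv_of_lt h, abs_le]
    constructor <;> linarith

lemma steinSol_eq_of_le {z w : ℝ} (h : w ≤ z) : steinSol z w = mills w * (1 - Phi z) := by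
  rw [steinSol, if_pos h, gaussTail_neg_div]

lemma steinSol_eq_of_ge {z w : ℝ} (h : z ≤ w) : steinSol z w = mills (-w) * Phi z := by
  rcases h.eq_or_lt with rfl | h
  · rw [steinSol, if_pos le_rfl, Phi_eq]
    simp only [mills, neg_sq]
    ring
  · rw [steinSol, if_neg (not_le.2 h), Phi_eq]

lemma hasDerivAt_left (z w : ℝ) : HasDerivAt (fun w => mills w * (1 - Phi z))
    (w * (mills w * (1 - Phi z)) + (1 - Phi z)) w :=
  ((hasDerivAt_mills w).mul_const (1 - Phi z)).congr_deriv (by ring)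

lemma hasDerivAt_right (z w : ℝ) : HasDerivAt (fun w => mills (-w) * Phi z)
    (w * (mills (-w) * Phi z) - Phi z) w := by
  exact (((hasDerivAt_mills (-w)).comp w (hasDerivAt_neg w)).mul_const (Phi z)).congr_deriv (by ring)

lemma hasDerivAt_steinSol {z w : ℝ} (h : w ≠ z) :
    HasDerivAt (steinSol z) (steinDeriv z w) w := by
  rcases lt_or_gt_of_ne h with h | h
  · rw [steinDeriv_of_le h.le, steinSol_eq_of_le h.le]
    refine (hasDerivAt_left z w).congr_of_eventuallyEq ?_
    filter_upwards [Iio_mem_nhds h] with x hx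
    exact steinSol_eq_of_le (le_of_lt hx)
  · rw [steinDeriv_of_lt h, steinSol_eq_of_ge h.le]
    refine (hasDerivAt_right z w).congr_of_eventuallyEq ?_
    filter_upwards [Ioi_mem_nhds h] with x hx
    exact steinSol_eq_of_ge (le_of_lt hx)

/-- Each branch is differentiable up to and including `z` with derivative at most 2 in absolute
value. The two Lipschitz estimates are chained at `z`, where the derivative jumps. -/
lemma abs_steinSol_sub_le (z x y : ℝ) : |steinSol z y - steinSol z x| ≤ 2 * |y - x| := by
  have hL : ∀ x ≤ z, ∀ y ≤ z, |steinSol z y - steinSol z x| ≤ 2 * |y - x| := by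
    intro x hx y hy
    refine Convex.norm_image_sub_le_of_norm_hasDerivWithin_le (f := steinSol z)
      (f' := steinDeriv z) (s := Set.Iic z) (fun w hw => ?_) (fun w _ => abs_steinDeriv_le z w)
      (convex_Iic z) hx hy
    have hw' : w ≤ z := hw
    rw [steinDeriv_of_le hw', steinSol_eq_of_le hw']
    exact (hasDerivAt_left z w).hasDerivWithinAt.congr (fun v hv => steinSol_eq_of_le hv)
      (steinSol_eq_of_le hw')
  have hbd : ∀ w, z ≤ w → |w * (mills (-w) * Phi z) - Phi z| ≤ 2 := by
    intro w hw
    rw [← steinSol_eq_of_ge hw]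
    have h1 := abs_le.1 (abs_mul_steinSol_le z w)
    rw [abs_le]
    constructor <;> linarith [Phi_nonneg z, Phi_le_one z]
  have hR : ∀ x, z ≤ x → ∀ y, z ≤ y → |steinSol z y - steinSol z x| ≤ 2 * |y - x| := by
    intro x hx y hy
    refine Convex.norm_image_sub_le_of_norm_hasDerivWithin_le (f := steinSol z)
      (f' := fun w => w * (mills (-w) * Phi z) - Phi z) (s := Set.Ici z) (fun w hw => ?_)
      (fun w hw => hbd w hw) (convex_Ici z) hx hy
    exact (hasDerivAt_right z w).hasDerivWithinAt.congr (fun v hv => steinSol_eq_of_ge hv)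
      (steinSol_eq_of_ge hw)
  have hmid : ∀ x ≤ z, ∀ y, z ≤ y → |steinSol z y - steinSol z x| ≤ 2 * |y - x| := by
    intro x hx y hy
    have h1 := hL x hx z le_rfl
    have h2 := hR z le_rfl y hy
    rw [abs_of_nonneg (sub_nonneg.2 hx)] at h1
    rw [abs_of_nonneg (sub_nonneg.2 hy)] at h2
    rw [abs_of_nonneg (sub_nonneg.2 (hx.trans hy))]
    have := abs_sub_le (steinSol z y) (steinSol z z) (steinSol z x)
    linarith
  rcases le_total x z with hx | hx <;> rcases le_total y z with hy | hy
  · exact hL x hx y hy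
  · exact hmid x hx y hy
  · rw [abs_sub_comm, abs_sub_comm y]
    exact hmid y hy x hx
  · exact hR x hx y hy

lemma continuous_steinSol (z : ℝ) : Continuous (steinSol z) := by
  refine (LipschitzWith.of_dist_le_mul (K := 2) fun x y => ?_).continuous
  rw [Real.dist_eq, Real.dist_eq]
  exact abs_steinSol_sub_le z y x

lemma measurable_steinDeriv (z : ℝ) : Measurable (steinDeriv z) :=
  ((measurable_id.mul (continuous_steinSol z).measurable).add
    (measurable_one.indicator measurableSet_Iic)).sub_const _

lemma abs_mul_steinSol_sub_le (z w x : ℝ) :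
    |(w + x) * steinSol z (w + x) - w * steinSol z w| ≤ (2 * |w| + 3) * |x| := by
  have h : (w + x) * steinSol z (w + x) - w * steinSol z w =
      w * (steinSol z (w + x) - steinSol z w) + x * steinSol z (w + x) := by ring
  rw [h]
  have h1 := abs_steinSol_sub_le z w (w + x)
  rw [add_sub_cancel_left] at h1
  calc _ ≤ |w| * |steinSol z (w + x) - steinSol z w| + |x| * |steinSol z (w + x)| := by
        rw [← abs_mul, ← abs_mul]
        exact abs_add_le _ _
    _ ≤ |w| * (2 * |x|) + |x| * 3 := by
        gcongr
        exact abs_steinSol_le _ _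
    _ = _ := by ring

/-- The indicator in Stein's equation changes only if `z` separates `w` from `w + x`, which forces
`|w - z| ≤ |x|`. This event is what the concentration inequality controls later. -/
lemma abs_steinDeriv_sub_le (z w x : ℝ) : |steinDeriv z (w + x) - steinDeriv z w| ≤
    (2 * |w| + 3) * |x| + if |w - z| ≤ |x| then 1 else 0 := by
  have h1 := abs_mul_steinSol_sub_le z w x
  have h : steinDeriv z (w + x) - steinDeriv z w =
      ((w + x) * steinSol z (w + x) - w * steinSol z w) +
        ((Set.Iic z).indicator (1 : ℝ → ℝ) (w + x) - (Set.Iic z).indicator 1 w) := by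
    simp only [steinDeriv]
    ring
  rw [h]
  refine (abs_add_le _ _).trans (add_le_add h1 ?_)
  simp only [Set.indicator_apply, Set.mem_Iic, Pi.one_apply]
  have h2 := neg_abs_le x
  have h3 := le_abs_self x
  split_ifs with ha hb hc hc hb hc <;> simp only [sub_self, abs_zero, sub_zero, zero_sub, abs_neg,
    abs_one, le_refl, zero_le_one] <;> exfalso
  · exact hc (abs_le.2 ⟨by linarith, by linarith⟩)
  · exact hc (abs_le.2 ⟨by linarith, by linarith⟩)

/-- When the segment may meet the jump, both terms are bounded by `2 |x|`, hence the 4. Otherwise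
the mean value theorem reduces the claim to `abs_steinDeriv_sub_le` without its jump term. -/
lemma abs_steinSol_taylor_le (z w x : ℝ) :
    |steinSol z (w + x) - steinSol z w - x * steinDeriv z w| ≤
      |x| * ((2 * |w| + 3) * |x| + if |w - z| ≤ |x| then 4 else 0) := by
  have hnn : 0 ≤ (2 * |w| + 3) * |x| := by positivity
  split_ifs with h
  · have h1 := abs_steinSol_sub_le z w (w + x)
    rw [add_sub_cancel_left] at h1
    have h2 : |x * steinDeriv z w| ≤ |x| * 2 := by
      rw [abs_mul]
      gcongr
      exact abs_steinDeriv_le _ _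
    refine (abs_sub _ _).trans ?_
    nlinarith [mul_nonneg (abs_nonneg x) hnn]
  · have hz : ∀ t : ℝ, 0 ≤ t → t ≤ 1 → w + t * x ≠ z := by
      intro t h0 h1 heq
      apply h
      rw [show w - z = -(t * x) by linarith, abs_neg, abs_mul, abs_of_nonneg h0]
      exact mul_le_of_le_one_left (abs_nonneg _) h1
    have hd : ∀ t : ℝ, 0 ≤ t → t ≤ 1 → HasDerivAt (fun t : ℝ => steinSol z (w + t * x))
        (steinDeriv z (w + t * x) * x) t := by
      intro t h0 h1
      have hin : HasDerivAt (fun t : ℝ => w + t * x) x t := by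
        simpa using ((hasDerivAt_id t).mul_const x).const_add w
      exact (hasDerivAt_steinSol (hz t h0 h1)).comp t hin
    obtain ⟨t, ⟨h0, h1⟩, ht⟩ := exists_hasDerivAt_eq_slope (fun t : ℝ => steinSol z (w + t * x))
      (fun t => steinDeriv z (w + t * x) * x) zero_lt_one
      (fun t ht => (hd t ht.1 ht.2).continuousAt.continuousWithinAt)
      (fun t ht => hd t ht.1.le ht.2.le)
    simp only [one_mul, zero_mul, add_zero, sub_zero, div_one] at ht
    rw [← ht, mul_comm x, ← sub_mul, abs_mul, mul_comm, add_zero]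
    have hle : |t * x| ≤ |x| := by
      rw [abs_mul, abs_of_pos h0]
      exact mul_le_of_le_one_left (abs_nonneg _) h1.le
    have := abs_steinDeriv_sub_le z w (t * x)
    rw [if_neg (fun hh => h (hh.trans hle)), add_zero] at this
    gcongr
    exact this.trans (by gcongr)

/-! ### The Berry–Esseen theorem for independent, not identically distributed summands -/

section BerryEsseen

variable {Ω : Type*} {mΩ : MeasurableSpace Ω} {μ : Measure Ω} [IsProbabilityMeasure μ]

lemma integrable_abs_pow {X : Ω → ℝ} {k : ℕ} (h : MemLp X 3 μ) (hk : k ≤ 3) :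
    Integrable (fun ω => |X ω| ^ k) μ := by
  have h' : MemLp X (k : ℝ≥0∞) μ := h.mono_exponent (by exact_mod_cast hk)
  rcases Nat.eq_zero_or_pos k with rfl | hk0
  · simp
  · simpa using h'.integrable_norm_pow hk0.ne'

/-- Integrate `(|X| - c)² (|X| + c) ≥ 0` with `c = E|X|`. -/
lemma integral_abs_mul_integral_sq_le {X : Ω → ℝ} (h : MemLp X 3 μ) :
    (∫ ω, |X ω| ∂μ) * ∫ ω, X ω ^ 2 ∂μ ≤ ∫ ω, |X ω| ^ 3 ∂μ := by
  set c := ∫ ω, |X ω| ∂μ with hc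
  have i1 : Integrable (fun ω => |X ω|) μ := by simpa using integrable_abs_pow h (k := 1) (by simp)
  have i2 : Integrable (fun ω => X ω ^ 2) μ := by
    simpa using integrable_abs_pow h (k := 2) (by simp)
  have i3 := integrable_abs_pow h (k := 3) le_rfl
  have hc0 : 0 ≤ c := integral_nonneg fun _ => abs_nonneg _
  have h0 : 0 ≤ ∫ ω, (|X ω| ^ 3 - c * X ω ^ 2 - (c ^ 2 * |X ω| - c ^ 3)) ∂μ := by
    refine integral_nonneg fun ω => ?_
    have : |X ω| ^ 3 - c * X ω ^ 2 - (c ^ 2 * |X ω| - c ^ 3) = (|X ω| - c) ^ 2 * (|X ω| + c) := by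
      rw [← sq_abs]
      ring
    simp only [Pi.zero_apply, this]
    positivity
  have e1 : ∫ ω, (|X ω| ^ 3 - c * X ω ^ 2 - (c ^ 2 * |X ω| - c ^ 3)) ∂μ =
      ∫ ω, (|X ω| ^ 3 - c * X ω ^ 2) ∂μ - ∫ ω, (c ^ 2 * |X ω| - c ^ 3) ∂μ :=
    integral_sub (i3.sub (i2.const_mul c)) ((i1.const_mul (c ^ 2)).sub (integrable_const _))
  have e2 : ∫ ω, (|X ω| ^ 3 - c * X ω ^ 2) ∂μ = ∫ ω, |X ω| ^ 3 ∂μ - c * ∫ ω, X ω ^ 2 ∂μ := by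
    rw [integral_sub i3 (i2.const_mul c), integral_const_mul]
  have e3 : ∫ ω, (c ^ 2 * |X ω| - c ^ 3) ∂μ = 0 := by
    rw [integral_sub (i1.const_mul _) (integrable_const _), integral_const_mul, ← hc]
    simp
    ring
  rw [e1, e2, e3] at h0
  linarith

/-- By independence and Fubini, freeze `X` and apply the concentration of `Y` at the radius `t =
|X|`. -/
lemma integral_mul_indicator_le {X Y : Ω → ℝ} (hX : Measurable X) (hY : Measurable Y)
    (hXY : IndepFun X Y μ) {a b z : ℝ} 
    (hconc : ∀ t : ℝ, 0 ≤ t → μ.real {ω | |Y ω - z| ≤ t} ≤ a * t + b)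
    {g : ℝ → ℝ} (hg : Measurable g) (hg0 : ∀ x, 0 ≤ g x) (hgi : Integrable (fun ω => g (X ω)) μ)
    (hgi' : Integrable (fun ω => g (X ω) * |X ω|) μ) :
    Integrable (fun ω => g (X ω) * if |Y ω - z| ≤ |X ω| then 1 else 0) μ ∧
    ∫ ω, g (X ω) * (if |Y ω - z| ≤ |X ω| then 1 else 0) ∂μ ≤
      a * ∫ ω, g (X ω) * |X ω| ∂μ + b * ∫ ω, g (X ω) ∂μ := by
  set G : ℝ × ℝ → ℝ := fun p => g p.1 * if |p.2 - z| ≤ |p.1| then 1 else 0 with hG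
  have hset : MeasurableSet {p : ℝ × ℝ | |p.2 - z| ≤ |p.1|} :=
    measurableSet_le (measurable_snd.sub_const z).abs measurable_fst.abs
  have hGm : Measurable G :=
    (hg.comp measurable_fst).mul (Measurable.ite hset measurable_const measurable_const)
  have hGle : ∀ p, ‖G p‖ ≤ g p.1 := by
    intro p
    simp only [hG]
    split_ifs
    · simp [abs_of_nonneg (hg0 _)]
    · simpa using hg0 _
  have hi : Integrable (fun ω => G (X ω, Y ω)) μ :=
    hgi.mono' (hGm.comp (hX.prodMk hY)).aestronglyMeasurable (ae_of_all _ fun ω => hGle _)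
  refine ⟨hi, ?_⟩
  have hmap := (indepFun_iff_map_prod_eq_prod_map_map hX.aemeasurable hY.aemeasurable).1 hXY
  have hprob : IsProbabilityMeasure (μ.map Y) := Measure.isProbabilityMeasure_map hY.aemeasurable
  have hprobX : IsProbabilityMeasure (μ.map X) := Measure.isProbabilityMeasure_map hX.aemeasurable
  have hiG : Integrable G (μ.map fun ω => (X ω, Y ω)) :=
    (integrable_map_measure hGm.aestronglyMeasurable (hX.prodMk hY).aemeasurable).2 hi
  have e1 : ∫ ω, G (X ω, Y ω) ∂μ = ∫ ω, ∫ y, G (X ω, y) ∂(μ.map Y) ∂μ := by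
    rw [← integral_map (hX.prodMk hY).aemeasurable hGm.aestronglyMeasurable, hmap]
    rw [hmap] at hiG
    rw [integral_prod _ hiG, integral_map hX.aemeasurable]
    exact hiG.integral_prod_left.aestronglyMeasurable
  have e2 : ∀ x, ∫ y, G (x, y) ∂(μ.map Y) ≤ g x * (a * |x| + b) := by
    intro x
    have hs : MeasurableSet {y : ℝ | |y - z| ≤ |x|} :=
      measurableSet_le (measurable_id.sub_const z).abs measurable_const
    have : ∀ y, G (x, y) = g x * Set.indicator {y : ℝ | |y - z| ≤ |x|} 1 y := by
      intro y
      simp [hG, Set.indicator_apply]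
    simp_rw [this]
    rw [integral_const_mul, integral_indicator_one hs, map_measureReal_apply hY hs]
    exact mul_le_mul_of_nonneg_left (hconc _ (abs_nonneg x)) (hg0 x)
  calc ∫ ω, G (X ω, Y ω) ∂μ = ∫ ω, ∫ y, G (X ω, y) ∂(μ.map Y) ∂μ := e1
    _ ≤ ∫ ω, (a * (g (X ω) * |X ω|) + b * g (X ω)) ∂μ := by
        refine integral_mono_of_nonneg (ae_of_all _ fun ω => integral_nonneg fun y => ?_)
          ((hgi'.const_mul a).add (hgi.const_mul b)) (ae_of_all _ fun ω => ?_)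
        · simp only [hG, Pi.zero_apply]
          split_ifs
          · simpa using hg0 _
          · simp
        · exact (e2 (X ω)).trans (by linarith)
    _ = _ := by
        rw [integral_add (hgi'.const_mul a) (hgi.const_mul b), integral_const_mul,
          integral_const_mul]

variable {ι : Type*} {ξ : ι → Ω → ℝ}

lemma integral_sq_sum_eq (hind : iIndepFun ξ μ) (h2 : ∀ i, MemLp (ξ i) 2 μ)
    (h0 : ∀ i, ∫ ω, ξ i ω ∂μ = 0) (t : Finset ι) :
    ∫ ω, (∑ j ∈ t, ξ j ω) ^ 2 ∂μ = ∑ j ∈ t, ∫ ω, ξ j ω ^ 2 ∂μ := by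
  have hv : ∀ f : Ω → ℝ, MemLp f 2 μ → ∫ ω, f ω ∂μ = 0 → Var[f; μ] = ∫ ω, f ω ^ 2 ∂μ := by
    intro f hf hf0
    rw [variance_eq_sub hf, hf0]
    simp
  have hvar := IndepFun.variance_sum (μ := μ) (X := ξ) (s := t) (fun i _ => h2 i)
    (fun i _ j _ hij => hind.indepFun hij)
  rw [hv _ (memLp_finsetSum' t fun i _ => h2 i)] at hvar
  · simp only [Finset.sum_apply] at hvar
    rw [hvar]
    exact Finset.sum_congr rfl fun i _ => hv _ (h2 i) (h0 i)
  · simp only [Finset.sum_apply]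
    rw [integral_finsetSum _ fun i _ => (h2 i).integrable (by norm_num)]
    simp [h0]

lemma integral_abs_le_one_of_sq {f : Ω → ℝ} (hf : MemLp f 2 μ) {d : ℝ} (hd : 0 ≤ d)
    (h : ∫ ω, f ω ^ 2 ∂μ ≤ d ^ 2) : ∫ ω, |f ω| ∂μ ≤ d := by
  have hv := variance_nonneg |f| μ
  rw [variance_eq_sub hf.abs] at hv
  simp only [Pi.pow_apply, Pi.abs_apply, sq_abs] at hv
  exact abs_le_of_sq_le_sq' (by linarith) hd |>.2

lemma clamp_sub_nonneg (lo hi w x : ℝ) :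
    0 ≤ x * (max lo (min w hi) - max lo (min (w - x) hi)) := by
  rcases le_total 0 x with hx | hx
  · refine mul_nonneg hx (sub_nonneg.2 ?_)
    gcongr
    linarith
  · refine mul_nonneg_of_nonpos_of_nonpos hx (sub_nonpos.2 ?_)
    gcongr
    linarith

/-- The clamp has slope one on `[a - d, b + d]`, and from a point of `[a, b]` there is room `d` on
both sides, so a displacement `x` changes it by at least `min |x| d`. -/
lemma le_clamp_sub {a b d w x : ℝ} (hd : 0 ≤ d) (ha : a ≤ w) (hb : w ≤ b) :
    |x| * min |x| d ≤ x * (max (a - d) (min w (b + d)) - max (a - d) (min (w - x) (b + d))) := by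
  rw [min_eq_left (by linarith : w ≤ b + d), max_eq_right (by linarith : a - d ≤ w)]
  rcases le_total 0 x with hx | hx
  · rw [abs_of_nonneg hx, min_eq_left (by linarith : w - x ≤ b + d)]
    refine mul_le_mul_of_nonneg_left ?_ hx
    rcases le_total (a - d) (w - x) with h | h
    · rw [max_eq_right h]
      linarith [min_le_left x d]
    · rw [max_eq_left h]
      linarith [min_le_right x d]
  · rw [abs_of_nonpos hx, ← neg_sub, mul_neg, ← neg_mul]
    refine mul_le_mul_of_nonneg_left ?_ (neg_nonneg.2 hx)
    have : min (w - x) (b + d) ≤ max (a - d) (min (w - x) (b + d)) := le_max_right _ _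
    rcases le_total (w - x) (b + d) with h | h
    · rw [min_eq_left h] at this
      rw [min_eq_left h]
      linarith [min_le_left (-x) d]
    · rw [min_eq_right h] at this
      rw [min_eq_right h]
      linarith [min_le_right (-x) d]

lemma abs_clamp_sub_le {a b d : ℝ} (hd : 0 ≤ d) (hab : a ≤ b) (w : ℝ) :
    |max (a - d) (min w (b + d)) - (a + b) / 2| ≤ (b - a) / 2 + d := by
  have h1 : a - d ≤ max (a - d) (min w (b + d)) := le_max_left _ _
  have h2 : max (a - d) (min w (b + d)) ≤ b + d := max_le (by linarith) (min_le_right _ _)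
  rw [abs_le]
  constructor <;> linarith

/-- Chen–Shao concentration inequality. -/
lemma concentration [DecidableEq ι] (hm : ∀ i, Measurable (ξ i)) (hind : iIndepFun ξ μ)
    (h2 : ∀ i, MemLp (ξ i) 2 μ) (h0 : ∀ i, ∫ ω, ξ i ω ∂μ = 0) (t : Finset ι)
    (ht : ∑ j ∈ t, ∫ ω, ξ j ω ^ 2 ∂μ ≤ 1) {a b d : ℝ} (hab : a ≤ b) (hd : 0 ≤ d) :
    μ.real {ω | a ≤ ∑ j ∈ t, ξ j ω ∧ ∑ j ∈ t, ξ j ω ≤ b} *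
      ∑ j ∈ t, ∫ ω, |ξ j ω| * min |ξ j ω| d ∂μ ≤ (b - a) / 2 + 2 * d := by
  set W : Ω → ℝ := fun ω => ∑ j ∈ t, ξ j ω with hW
  set A : Set Ω := {ω | a ≤ W ω ∧ W ω ≤ b} with hA
  -- Centring at the midpoint makes `|f| ≤ (b - a)/2 + d`. The inequality comes from estimating `E[W
  -- f(W)]` from both sides.
  set f : ℝ → ℝ := fun w => max (a - d) (min w (b + d)) - (a + b) / 2 with hf
  set η : ι → Ω → ℝ := fun j ω => |ξ j ω| * min |ξ j ω| d with hη
  have hfm : Measurable f := by fun_prop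
  have hfb : ∀ w, |f w| ≤ (b - a) / 2 + d := abs_clamp_sub_le hd hab
  have hWm : Measurable W := Finset.measurable_sum t fun i _ => hm i
  have hAm : MeasurableSet A :=
    (measurableSet_le measurable_const hWm).inter (measurableSet_le hWm measurable_const)
  have hi : ∀ i, Integrable (ξ i) μ := fun i => (h2 i).integrable (by norm_num)
  have hmul : ∀ {X Y : Ω → ℝ}, Integrable X μ → Measurable Y →
      Integrable (fun ω => X ω * f (Y ω)) μ := fun hX hY =>
    hX.mul_bdd (c := (b - a) / 2 + d) (hfm.comp hY).aestronglyMeasurable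
      (ae_of_all _ fun ω => hfb _)
  -- the functions `η j`
  have hηm : ∀ j, Measurable (η j) := fun j => by
    have := hm j
    fun_prop
  have hη0 : ∀ j ω, 0 ≤ η j ω := fun j ω =>
    mul_nonneg (abs_nonneg _) (le_min (abs_nonneg _) hd)
  have hηle : ∀ j ω, η j ω ≤ d * |ξ j ω| := fun j ω => by
    rw [mul_comm d]
    exact mul_le_mul_of_nonneg_left (min_le_right _ _) (abs_nonneg _)
  have hη2 : ∀ j, MemLp (η j) 2 μ := fun j =>
    ((h2 j).abs.const_mul d).mono' (hηm j).aestronglyMeasurable (ae_of_all _ fun ω => by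
      rw [Real.norm_of_nonneg (hη0 j ω)]
      exact hηle j ω)
  have hηi : ∀ j, Integrable (η j) μ := fun j => (hη2 j).integrable (by norm_num)
  -- The fluctuation of `∑ η j` about its mean. Since `η j ≤ d |ξ j|`, its second moment is at most
  -- `d²`.
  set S : Ω → ℝ := fun ω => ∑ j ∈ t, (η j ω - ∫ ω, η j ω ∂μ) with hS
  have hη' : ∀ j, MemLp (fun ω => η j ω - ∫ ω, η j ω ∂μ) 2 μ := fun j =>
    (hη2 j).sub (memLp_const _)
  have hS2 : MemLp S 2 μ := by
    have := memLp_finsetSum' (μ := μ) (p := 2) t fun i _ => hη' i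
    refine this.ae_eq (ae_of_all _ fun ω => by simp [hS])
  have hSd : ∫ ω, |S ω| ∂μ ≤ d := by
    refine integral_abs_le_one_of_sq hS2 hd ?_
    have hind' : iIndepFun (fun j ω => η j ω - ∫ ω, η j ω ∂μ) μ :=
      hind.comp (fun j x => |x| * min |x| d - ∫ ω, η j ω ∂μ) fun j => by fun_prop
    rw [integral_sq_sum_eq hind' hη' (fun i => by simp [integral_sub (hηi i)]) t]
    calc ∑ j ∈ t, ∫ ω, (η j ω - ∫ ω, η j ω ∂μ) ^ 2 ∂μ
        ≤ ∑ j ∈ t, d ^ 2 * ∫ ω, ξ j ω ^ 2 ∂μ := by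
          refine Finset.sum_le_sum fun j _ => ?_
          rw [← variance_eq_integral (hηm j).aemeasurable, variance_eq_sub (hη2 j),
            ← integral_const_mul]
          refine (sub_le_self _ (sq_nonneg _)).trans ?_
          refine integral_mono (hη2 j).integrable_sq ((h2 j).integrable_sq.const_mul _) fun ω => ?_
          simp only [Pi.pow_apply]
          rw [← sq_abs (ξ j ω), ← mul_pow]
          exact pow_le_pow_left₀ (hη0 j ω) (hηle j ω) 2
      _ = d ^ 2 * ∑ j ∈ t, ∫ ω, ξ j ω ^ 2 ∂μ := by rw [Finset.mul_sum]
      _ ≤ d ^ 2 := mul_le_of_le_one_right (sq_nonneg d) ht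
  -- upper bound
  have hW2 : MemLp W 2 μ := by
    have := memLp_finsetSum' (μ := μ) (p := 2) t fun i _ => h2 i
    exact this.ae_eq (ae_of_all _ fun ω => by simp [hW])
  have hWi : Integrable W μ := hW2.integrable (by norm_num)
  have hW1 : ∫ ω, |W ω| ∂μ ≤ 1 := integral_abs_le_one_of_sq hW2 zero_le_one
    (by rw [integral_sq_sum_eq hind h2 h0 t]; simpa using ht)
  have hup : ∫ ω, W ω * f (W ω) ∂μ ≤ (b - a) / 2 + d := by
    calc ∫ ω, W ω * f (W ω) ∂μ ≤ ∫ ω, ((b - a) / 2 + d) * |W ω| ∂μ := by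
          refine integral_mono (hmul hWi hWm) (hWi.abs.const_mul _) fun ω => ?_
          refine (le_abs_self _).trans ?_
          simp only [abs_mul]
          rw [mul_comm]
          exact mul_le_mul_of_nonneg_right (hfb _) (abs_nonneg _)
      _ ≤ (b - a) / 2 + d := by
          rw [integral_const_mul]
          exact mul_le_of_le_one_right (by linarith) hW1
  -- lower bound
  have hterm : ∀ j ∈ t, ∫ ω, A.indicator (η j) ω ∂μ ≤ ∫ ω, ξ j ω * f (W ω) ∂μ := by
    intro j hj
    have hWj : ∀ ω, W ω - ξ j ω = ∑ i ∈ t.erase j, ξ i ω := fun ω => by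
      rw [sub_eq_iff_eq_add, Finset.sum_erase_add _ _ hj]
    have hm' : Measurable fun ω => W ω - ξ j ω := hWm.sub (hm j)
    have hindj : IndepFun (ξ j) (fun ω => W ω - ξ j ω) μ := by
      have h := (hind.indepFun_finsetSum_of_notMem hm (Finset.notMem_erase j t)).symm
      refine h.congr (ae_eq_refl _) (ae_of_all _ fun ω => ?_)
      simp [hWj]
    -- Leave one out: `ξ j` is centred and independent of the rest, so this term can be subtracted
    -- for free, leaving an increment of the clamp.
    have hz : ∫ ω, ξ j ω * f (W ω - ξ j ω) ∂μ = 0 := by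
      have := (hindj.comp measurable_id hfm).integral_mul_eq_mul_integral
        (hm j).aestronglyMeasurable (hfm.comp hm').aestronglyMeasurable
      simp only [Function.comp_def, id] at this
      rw [show (∫ ω, ξ j ω * f (W ω - ξ j ω) ∂μ) =
        (∫ ω, ((fun x => ξ j x) * fun x => f (W x - ξ j x)) ω ∂μ) from rfl, this, h0, zero_mul]
    rw [← sub_zero (∫ ω, ξ j ω * f (W ω) ∂μ), ← hz,
      ← integral_sub (hmul (hi j) hWm) (hmul (hi j) hm')]
    refine integral_mono ((hηi j).indicator hAm)
      ((hmul (hi j) hWm).sub (hmul (hi j) hm')) fun ω => ?_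
    have e : ξ j ω * f (W ω) - ξ j ω * f (W ω - ξ j ω) =
        ξ j ω * (max (a - d) (min (W ω) (b + d)) - max (a - d) (min (W ω - ξ j ω) (b + d))) := by
      simp only [hf]
      ring
    simp only [e, Set.indicator_apply]
    split_ifs with hω
    · exact le_clamp_sub hd hω.1 hω.2
    · exact clamp_sub_nonneg _ _ _ _
  have hsum : ∫ ω, W ω * f (W ω) ∂μ = ∑ j ∈ t, ∫ ω, ξ j ω * f (W ω) ∂μ := by
    rw [← integral_finsetSum _ fun i _ => hmul (hi i) hWm]
    refine integral_congr_ae (ae_of_all _ fun ω => ?_)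
    simp only [hW, Finset.sum_mul]
  have hlow : μ.real A * ∑ j ∈ t, ∫ ω, η j ω ∂μ - d ≤ ∑ j ∈ t, ∫ ω, A.indicator (η j) ω ∂μ := by
    rw [← integral_finsetSum _ fun i _ => (hηi i).indicator hAm]
    have e : ∀ ω, ∑ j ∈ t, A.indicator (η j) ω =
        A.indicator (fun _ => ∑ j ∈ t, ∫ ω, η j ω ∂μ) ω + A.indicator S ω := by
      intro ω
      by_cases hω : ω ∈ A
      · simp [hω, hS]
      · simp [hω]
    have hSi := hS2.integrable (μ := μ) (by norm_num)
    simp_rw [e]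
    rw [integral_add ((integrable_const _).indicator hAm) (hSi.indicator hAm),
      integral_indicator_const _ hAm, smul_eq_mul]
    -- Replacing the random sum on `A` by its mean costs at most `E|S| ≤ d`.
    have : -∫ ω, |S ω| ∂μ ≤ ∫ ω, A.indicator S ω ∂μ := by
      rw [← integral_neg]
      refine integral_mono hSi.abs.neg (hSi.indicator hAm) fun ω => ?_
      simp only [Set.indicator_apply]
      split_ifs
      · exact neg_abs_le _
      · simp
    linarith
  have := Finset.sum_le_sum hterm
  linarith

lemma sq_sub_le_mul_min {y d : ℝ} (hy : 0 ≤ y) (hd : 0 < d) :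
    y ^ 2 - y ^ 3 / (4 * d) ≤ y * min y d := by
  have h : y - y ^ 2 / (4 * d) ≤ min y d := by
    refine le_min (sub_le_self _ (by positivity)) ?_
    rw [sub_le_iff_le_add, ← sub_le_iff_le_add', le_div_iff₀ (by positivity)]
    nlinarith [sq_nonneg (y - 2 * d)]
  calc y ^ 2 - y ^ 3 / (4 * d) = y * (y - y ^ 2 / (4 * d)) := by ring
    _ ≤ _ := mul_le_mul_of_nonneg_left h hy

/-- Take `d = γ` in `concentration`. By `sq_sub_le_mul_min` the truncated second moments of all
summands add up to at least `1 - 1/4`. The deleted one contributes at most `γ ≤ 1/4`, so a factor of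
at least `1/2` remains and can be divided out. -/
lemma concentration_erase [DecidableEq ι] (hm : ∀ i, Measurable (ξ i)) (hind : iIndepFun ξ μ)
    (h3 : ∀ i, MemLp (ξ i) 3 μ) (h0 : ∀ i, ∫ ω, ξ i ω ∂μ = 0) (s : Finset ι)
    (hs : ∑ j ∈ s, ∫ ω, ξ j ω ^ 2 ∂μ = 1) {γ : ℝ} (hγ : γ = ∑ j ∈ s, ∫ ω, |ξ j ω| ^ 3 ∂μ)
    (hγ0 : 0 < γ) (hγ1 : γ ≤ 1 / 4) {i : ι} (his : i ∈ s) (z r : ℝ) (hr : 0 ≤ r) :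
    μ.real {ω | |∑ j ∈ s.erase i, ξ j ω - z| ≤ r} ≤ 2 * r + 4 * γ := by
  have h2 : ∀ i, MemLp (ξ i) 2 μ := fun i => (h3 i).mono_exponent (by norm_num)
  have hle : ∑ j ∈ s.erase i, ∫ ω, ξ j ω ^ 2 ∂μ ≤ 1 := by
    rw [← hs]
    exact Finset.sum_le_sum_of_subset_of_nonneg (Finset.erase_subset _ _)
      fun _ _ _ => integral_nonneg fun _ => sq_nonneg _
  have hc := concentration hm hind h2 h0 (s.erase i) hle (a := z - r) (b := z + r) (d := γ)
    (by linarith) hγ0.le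
  have hset : {ω | z - r ≤ ∑ j ∈ s.erase i, ξ j ω ∧ ∑ j ∈ s.erase i, ξ j ω ≤ z + r} =
      {ω | |∑ j ∈ s.erase i, ξ j ω - z| ≤ r} := by
    ext ω
    simp only [Set.mem_ofPred_eq, abs_le]
    constructor <;> rintro ⟨h, h'⟩ <;> constructor <;> linarith
  rw [hset] at hc
  have hηi : ∀ j, Integrable (fun ω => |ξ j ω| * min |ξ j ω| γ) μ := fun j => by
    have hmj := hm j
    refine (((h2 j).integrable (by norm_num)).abs.mul_const γ).mono'
      (by fun_prop) (ae_of_all _ fun ω => ?_)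
    rw [Real.norm_of_nonneg (mul_nonneg (abs_nonneg _) (le_min (abs_nonneg _) hγ0.le))]
    exact mul_le_mul_of_nonneg_left (min_le_right _ _) (abs_nonneg _)
  have hall : 3 / 4 ≤ ∑ j ∈ s, ∫ ω, |ξ j ω| * min |ξ j ω| γ ∂μ := by
    calc (3 / 4 : ℝ) = ∑ j ∈ s, (∫ ω, ξ j ω ^ 2 ∂μ - (∫ ω, |ξ j ω| ^ 3 ∂μ) / (4 * γ)) := by
          rw [Finset.sum_sub_distrib, hs, ← Finset.sum_div, ← hγ]
          field_simp
          norm_num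
      _ ≤ _ := by
          refine Finset.sum_le_sum fun j _ => ?_
          rw [← integral_div, ← integral_sub (h2 j).integrable_sq
            ((integrable_abs_pow (h3 j) le_rfl).div_const _)]
          refine integral_mono ((h2 j).integrable_sq.sub
            ((integrable_abs_pow (h3 j) le_rfl).div_const _)) (hηi j) fun ω => ?_
          have := sq_sub_le_mul_min (abs_nonneg (ξ j ω)) hγ0
          simpa using this
  have hsingle : ∫ ω, ξ i ω ^ 2 ∂μ ≤ 1 := by
    rw [← hs]
    exact Finset.single_le_sum (f := fun j => ∫ ω, ξ j ω ^ 2 ∂μ)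
      (fun _ _ => integral_nonneg fun _ => sq_nonneg _) his
  have hi : ∫ ω, |ξ i ω| * min |ξ i ω| γ ∂μ ≤ 1 / 4 := by
    calc ∫ ω, |ξ i ω| * min |ξ i ω| γ ∂μ ≤ ∫ ω, |ξ i ω| * γ ∂μ :=
          integral_mono (hηi i) (((h2 i).integrable (by norm_num)).abs.mul_const γ) fun ω =>
            mul_le_mul_of_nonneg_left (min_le_right _ _) (abs_nonneg _)
      _ ≤ 1 * γ := by
          rw [integral_mul_const]
          exact mul_le_mul_of_nonneg_right
            (integral_abs_le_one_of_sq (h2 i) zero_le_one (by simpa using hsingle)) hγ0.le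
      _ ≤ 1 / 4 := by linarith
  have hhalf : 1 / 2 ≤ ∑ j ∈ s.erase i, ∫ ω, |ξ j ω| * min |ξ j ω| γ ∂μ := by
    rw [← Finset.add_sum_erase _ _ his] at hall
    linarith
  have := mul_le_mul_of_nonneg_left hhalf
    (measureReal_nonneg (μ := μ) (s := {ω | |∑ j ∈ s.erase i, ξ j ω - z| ≤ r}))
  linarith

/-- The contribution of one summand in the proof of the Berry–Esseen theorem. -/
lemma stein_term_le [DecidableEq ι] (hm : ∀ i, Measurable (ξ i)) (hind : iIndepFun ξ μ)
    (h3 : ∀ i, MemLp (ξ i) 3 μ) (h0 : ∀ i, ∫ ω, ξ i ω ∂μ = 0) (s : Finset ι)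
    (hs : ∑ j ∈ s, ∫ ω, ξ j ω ^ 2 ∂μ = 1) {γ : ℝ} (hγ : γ = ∑ j ∈ s, ∫ ω, |ξ j ω| ^ 3 ∂μ)
    (hγ0 : 0 < γ) (hγ1 : γ ≤ 1 / 4) {i : ι} (his : i ∈ s) (z : ℝ) :
    |∫ ω, ξ i ω * steinSol z (∑ j ∈ s, ξ j ω) ∂μ -
      (∫ ω, ξ i ω ^ 2 ∂μ) * ∫ ω, steinDeriv z (∑ j ∈ s, ξ j ω) ∂μ| ≤
      20 * ∫ ω, |ξ i ω| ^ 3 ∂μ + 20 * γ * ∫ ω, ξ i ω ^ 2 ∂μ := by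
  have h2 : ∀ i, MemLp (ξ i) 2 μ := fun i => (h3 i).mono_exponent (by norm_num)
  set X : Ω → ℝ := ξ i with hX
  set Y : Ω → ℝ := fun ω => ∑ j ∈ s.erase i, ξ j ω with hY
  have hXm : Measurable X := hm i
  have hYm : Measurable Y := Finset.measurable_sum _ fun i _ => hm i
  have hW : ∀ ω, ∑ j ∈ s, ξ j ω = Y ω + X ω := fun ω => (Finset.sum_erase_add _ _ his).symm
  simp_rw [hW]
  have hXY : IndepFun X Y μ := by
    have h := (hind.indepFun_finsetSum_of_notMem hm (Finset.notMem_erase i s)).symm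
    refine h.congr (ae_eq_refl _) (ae_of_all _ fun ω => ?_)
    simp [hY]
  have hconc : ∀ t : ℝ, 0 ≤ t → μ.real {ω | |Y ω - z| ≤ t} ≤ 2 * t + 4 * γ := fun t ht =>
    concentration_erase hm hind h3 h0 s hs hγ hγ0 hγ1 his z t ht
  have i1 : Integrable (fun ω => |X ω|) μ := by
    simpa using integrable_abs_pow (h3 i) (k := 1) (by simp)
  have i2 : Integrable (fun ω => X ω ^ 2) μ := (h2 i).integrable_sq
  have i3 : Integrable (fun ω => |X ω| ^ 3) μ := integrable_abs_pow (h3 i) le_rfl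
  have iX : Integrable X μ := (h2 i).integrable (by norm_num)
  have hY2 : MemLp Y 2 μ :=
    (memLp_finsetSum' (μ := μ) (p := 2) (s.erase i) fun i _ => h2 i).ae_eq
      (ae_of_all _ fun ω => by simp [hY])
  have hY1 : ∫ ω, |Y ω| ∂μ ≤ 1 := integral_abs_le_one_of_sq hY2 zero_le_one (by
    rw [integral_sq_sum_eq hind h2 h0, one_pow, ← hs]
    exact Finset.sum_le_sum_of_subset_of_nonneg (Finset.erase_subset _ _)
      fun _ _ _ => integral_nonneg fun _ => sq_nonneg _)
  have iY : Integrable (fun ω => 2 * |Y ω| + 3) μ :=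
    ((hY2.integrable (by norm_num)).abs.const_mul 2).add (integrable_const 3)
  have hY3 : ∫ ω, (2 * |Y ω| + 3) ∂μ ≤ 5 := by
    rw [integral_add ((hY2.integrable (by norm_num)).abs.const_mul 2) (integrable_const 3),
      integral_const_mul]
    simp
    linarith
  -- products of a function of `X` and a function of `Y`
  have hprod : ∀ {g : ℝ → ℝ}, Measurable g → (∀ x, 0 ≤ g x) → Integrable (fun ω => g (X ω)) μ →
      Integrable (fun ω => g (X ω) * (2 * |Y ω| + 3)) μ ∧
      ∫ ω, g (X ω) * (2 * |Y ω| + 3) ∂μ ≤ 5 * ∫ ω, g (X ω) ∂μ := by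
    intro g hg hg0 hgi
    have hindg : IndepFun (fun ω => g (X ω)) (fun ω => 2 * |Y ω| + 3) μ :=
      hXY.comp hg (by fun_prop : Measurable fun y : ℝ => 2 * |y| + 3)
    refine ⟨hindg.integrable_mul hgi iY, ?_⟩
    have := hindg.integral_mul_eq_mul_integral hgi.aestronglyMeasurable iY.aestronglyMeasurable
    calc ∫ ω, g (X ω) * (2 * |Y ω| + 3) ∂μ = (∫ ω, g (X ω) ∂μ) * ∫ ω, (2 * |Y ω| + 3) ∂μ := this
      _ ≤ (∫ ω, g (X ω) ∂μ) * 5 :=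
          mul_le_mul_of_nonneg_left hY3 (integral_nonneg fun _ => hg0 _)
      _ = _ := mul_comm _ _
  have bddS : ∀ {V Z : Ω → ℝ}, Integrable V μ → Measurable Z →
      Integrable (fun ω => V ω * steinSol z (Z ω)) μ := fun hV hZ =>
    hV.mul_bdd (c := 3) ((continuous_steinSol z).measurable.comp hZ).aestronglyMeasurable
      (ae_of_all _ fun _ => abs_steinSol_le _ _)
  have bddD : ∀ {V Z : Ω → ℝ}, Integrable V μ → Measurable Z →
      Integrable (fun ω => V ω * steinDeriv z (Z ω)) μ := fun hV hZ =>
    hV.mul_bdd (c := 2) ((measurable_steinDeriv z).comp hZ).aestronglyMeasurable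
      (ae_of_all _ fun _ => abs_steinDeriv_le _ _)
  have hYX : Measurable fun ω => Y ω + X ω := hYm.add hXm
  have iD : ∀ {Z : Ω → ℝ}, Measurable Z → Integrable (fun ω => steinDeriv z (Z ω)) μ := fun hZ => by
    simpa using bddD (integrable_const (1 : ℝ)) hZ
  -- first comparison
  have hz : ∫ ω, X ω * steinSol z (Y ω) ∂μ = 0 := by
    have := (hXY.comp measurable_id (continuous_steinSol z).measurable).integral_mul_eq_mul_integral
      hXm.aestronglyMeasurable ((continuous_steinSol z).measurable.comp hYm).aestronglyMeasurable
    calc ∫ ω, X ω * steinSol z (Y ω) ∂μ = (∫ ω, X ω ∂μ) * ∫ ω, steinSol z (Y ω) ∂μ := this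
      _ = 0 := by rw [hX, h0, zero_mul]
  have hsq : ∫ ω, X ω ^ 2 * steinDeriv z (Y ω) ∂μ =
      (∫ ω, X ω ^ 2 ∂μ) * ∫ ω, steinDeriv z (Y ω) ∂μ :=
    (hXY.comp (φ := fun x : ℝ => x ^ 2) (by fun_prop)
      (measurable_steinDeriv z)).integral_mul_eq_mul_integral
      i2.aestronglyMeasurable (iD hYm).aestronglyMeasurable
  obtain ⟨p3i, p3⟩ := hprod (g := fun x => |x| ^ 3) (by fun_prop) (fun x => by positivity) i3
  obtain ⟨p1i, p1⟩ := hprod (g := fun x => |x|) (by fun_prop) (fun x => abs_nonneg x) i1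
  obtain ⟨c2i, c2⟩ := integral_mul_indicator_le hXm hYm hXY hconc (g := fun x => x ^ 2)
    (by fun_prop) (fun x => sq_nonneg x) i2 (i3.congr (ae_of_all _ fun ω => by
      simp only [pow_succ, pow_zero, one_mul, abs_mul_abs_self]))
  obtain ⟨c0i, c0⟩ := integral_mul_indicator_le hXm hYm hXY hconc (g := fun _ => 1)
    measurable_const (fun _ => zero_le_one) (integrable_const _) (by simpa using i1)
  have e3 : ∫ ω, X ω ^ 2 * |X ω| ∂μ = ∫ ω, |X ω| ^ 3 ∂μ := by
    congr 1
    ext ω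
    simp only [pow_succ, pow_zero, one_mul, abs_mul_abs_self]
  simp only [one_mul, integral_const, probReal_univ, smul_eq_mul] at c0 c0i
  rw [e3] at c2
  -- Taylor expansion around `Y`. The smooth part contributes 5 and the jump part `4 · (2, 4γ)`,
  -- which gives 13 and `16γ`.
  have first : |∫ ω, X ω * steinSol z (Y ω + X ω) ∂μ -
      (∫ ω, X ω ^ 2 ∂μ) * ∫ ω, steinDeriv z (Y ω) ∂μ| ≤
      13 * ∫ ω, |X ω| ^ 3 ∂μ + 16 * γ * ∫ ω, X ω ^ 2 ∂μ := by
    have hXX : Integrable (fun ω => X ω * steinSol z (Y ω + X ω) - X ω * steinSol z (Y ω)) μ :=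
      (bddS iX hYX).sub (bddS iX hYm)
    rw [← hsq, ← sub_zero (∫ ω, X ω * steinSol z (Y ω + X ω) ∂μ), ← hz,
      ← integral_sub (bddS iX hYX) (bddS iX hYm), ← integral_sub hXX (bddD i2 hYm)]
    refine (abs_integral_le_integral_abs).trans ?_
    calc ∫ ω, |X ω * steinSol z (Y ω + X ω) - X ω * steinSol z (Y ω) -
          X ω ^ 2 * steinDeriv z (Y ω)| ∂μ
        ≤ ∫ ω, (|X ω| ^ 3 * (2 * |Y ω| + 3) +
            4 * (X ω ^ 2 * if |Y ω - z| ≤ |X ω| then 1 else 0)) ∂μ := by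
          refine integral_mono (hXX.sub (bddD i2 hYm)).abs
            (p3i.add (c2i.const_mul 4)) fun ω => ?_
          have h := abs_steinSol_taylor_le z (Y ω) (X ω)
          have e : X ω * steinSol z (Y ω + X ω) - X ω * steinSol z (Y ω) -
              X ω ^ 2 * steinDeriv z (Y ω) = X ω * (steinSol z (Y ω + X ω) - steinSol z (Y ω) -
                X ω * steinDeriv z (Y ω)) := by ring
          simp only [e, abs_mul]
          refine (mul_le_mul_of_nonneg_left h (abs_nonneg _)).trans (le_of_eq ?_)
          rw [← sq_abs (X ω)]
          split_ifs <;> ring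
      _ = ∫ ω, |X ω| ^ 3 * (2 * |Y ω| + 3) ∂μ +
            4 * ∫ ω, X ω ^ 2 * (if |Y ω - z| ≤ |X ω| then 1 else 0) ∂μ := by
          rw [integral_add p3i (c2i.const_mul 4), integral_const_mul]
      _ ≤ _ := by linarith
  have second : |(∫ ω, X ω ^ 2 ∂μ) * ∫ ω, steinDeriv z (Y ω) ∂μ -
      (∫ ω, X ω ^ 2 ∂μ) * ∫ ω, steinDeriv z (Y ω + X ω) ∂μ| ≤
      7 * ∫ ω, |X ω| ^ 3 ∂μ + 4 * γ * ∫ ω, X ω ^ 2 ∂μ := by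
    have hv : 0 ≤ ∫ ω, X ω ^ 2 ∂μ := integral_nonneg fun _ => sq_nonneg _
    rw [← mul_sub, abs_mul, abs_of_nonneg hv, abs_sub_comm, ← integral_sub (iD hYX) (iD hYm)]
    have h : |∫ ω, (steinDeriv z (Y ω + X ω) - steinDeriv z (Y ω)) ∂μ| ≤
        7 * ∫ ω, |X ω| ∂μ + 4 * γ := by
      refine (abs_integral_le_integral_abs).trans ?_
      calc ∫ ω, |steinDeriv z (Y ω + X ω) - steinDeriv z (Y ω)| ∂μ
          ≤ ∫ ω, (|X ω| * (2 * |Y ω| + 3) + if |Y ω - z| ≤ |X ω| then 1 else 0) ∂μ := by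
            refine integral_mono ((iD hYX).sub (iD hYm)).abs (p1i.add c0i) fun ω => ?_
            have h := abs_steinDeriv_sub_le z (Y ω) (X ω)
            simp only
            linarith
        _ ≤ _ := by
            rw [integral_add p1i c0i]
            linarith
    -- Turns the product `E|X| · E[X²]` into a third moment.
    have hl := integral_abs_mul_integral_sq_le (h3 i)
    have := mul_le_mul_of_nonneg_left h hv
    rw [← hX] at hl
    linarith
  have := abs_sub_le (∫ ω, X ω * steinSol z (Y ω + X ω) ∂μ)
    ((∫ ω, X ω ^ 2 ∂μ) * ∫ ω, steinDeriv z (Y ω) ∂μ)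
    ((∫ ω, X ω ^ 2 ∂μ) * ∫ ω, steinDeriv z (Y ω + X ω) ∂μ)
  linarith

/-- The Berry–Esseen theorem for centered summands with total variance one. -/
theorem berryEsseen_normalized [DecidableEq ι] (hm : ∀ i, Measurable (ξ i))
    (hind : iIndepFun ξ μ) (h3 : ∀ i, MemLp (ξ i) 3 μ) (h0 : ∀ i, ∫ ω, ξ i ω ∂μ = 0)
    (s : Finset ι) (hs : ∑ j ∈ s, ∫ ω, ξ j ω ^ 2 ∂μ = 1) (z : ℝ) :
    |μ.real {ω | ∑ j ∈ s, ξ j ω ≤ z} - Phi z| ≤ 40 * ∑ j ∈ s, ∫ ω, |ξ j ω| ^ 3 ∂μ := by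
  have h2 : ∀ i, MemLp (ξ i) 2 μ := fun i => (h3 i).mono_exponent (by norm_num)
  obtain ⟨γ, hγ⟩ : ∃ γ, γ = ∑ j ∈ s, ∫ ω, |ξ j ω| ^ 3 ∂μ := ⟨_, rfl⟩
  rw [← hγ]
  have hnn : ∀ j, 0 ≤ ∫ ω, |ξ j ω| ^ 3 ∂μ := fun j =>
    integral_nonneg fun ω => pow_nonneg (abs_nonneg _) 3
  have hγ0 : 0 < γ := by
    have hγnn : 0 ≤ γ := hγ ▸ Finset.sum_nonneg fun j _ => hnn j
    refine hγnn.lt_of_ne fun h => ?_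
    rw [← h, eq_comm, Finset.sum_eq_zero_iff_of_nonneg fun j _ => hnn j] at hγ
    have : ∑ j ∈ s, ∫ ω, ξ j ω ^ 2 ∂μ = 0 := by
      refine Finset.sum_eq_zero fun j hj => ?_
      have hz := (integral_eq_zero_iff_of_nonneg (fun ω => pow_nonneg (abs_nonneg _) 3)
        (integrable_abs_pow (h3 j) le_rfl)).1 (hγ j hj)
      refine integral_eq_zero_of_ae ?_
      filter_upwards [hz] with ω hω
      have : ξ j ω = 0 := by simpa using hω
      simp [this]
    rw [hs] at this
    exact one_ne_zero this
  -- For larger `γ` the bound `40 γ` exceeds 1 and is trivial.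
  by_cases hγ1 : γ ≤ 1 / 4
  swap
  · have h1 : μ.real {ω | ∑ j ∈ s, ξ j ω ≤ z} ≤ 1 := measureReal_le_one
    have h2 : 0 ≤ μ.real {ω | ∑ j ∈ s, ξ j ω ≤ z} := measureReal_nonneg
    rw [abs_le]
    constructor <;> linarith [Phi_nonneg z, Phi_le_one z]
  set W : Ω → ℝ := fun ω => ∑ j ∈ s, ξ j ω with hW
  have hWm : Measurable W := Finset.measurable_sum _ fun i _ => hm i
  have hi : ∀ j, Integrable (fun ω => ξ j ω * steinSol z (W ω)) μ := fun j =>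
    ((h2 j).integrable (by norm_num)).mul_bdd (c := 3)
      ((continuous_steinSol z).measurable.comp hWm).aestronglyMeasurable
      (ae_of_all _ fun _ => abs_steinSol_le _ _)
  have hiW : Integrable (fun ω => W ω * steinSol z (W ω)) μ := by
    refine (integrable_finsetSum s fun j _ => hi j).congr (ae_of_all _ fun ω => ?_)
    simp only [hW, Finset.sum_mul]
  have hiD : Integrable (fun ω => steinDeriv z (W ω)) μ :=
    Integrable.of_bound ((measurable_steinDeriv z).comp hWm).aestronglyMeasurable 2
      (ae_of_all _ fun _ => abs_steinDeriv_le _ _)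
  have hset : MeasurableSet {ω | W ω ≤ z} := measurableSet_le hWm measurable_const
  -- Stein's equation evaluated at `W` and integrated.
  have e1 : μ.real {ω | W ω ≤ z} - Phi z =
      ∫ ω, steinDeriv z (W ω) ∂μ - ∫ ω, W ω * steinSol z (W ω) ∂μ := by
    rw [← integral_sub hiD hiW]
    have : ∀ ω, steinDeriv z (W ω) - W ω * steinSol z (W ω) =
        {ω | W ω ≤ z}.indicator 1 ω - Phi z := by
      intro ω
      simp only [steinDeriv, Set.indicator_apply, Set.mem_Iic, Set.mem_ofPred_eq, Pi.one_apply]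
      ring
    simp_rw [this]
    have h1 : Integrable ({ω | W ω ≤ z}.indicator (1 : Ω → ℝ)) μ :=
      (integrable_const (1 : ℝ)).indicator hset
    rw [integral_sub h1 (integrable_const _), integral_indicator_one hset]
    simp
  have e2 : ∫ ω, steinDeriv z (W ω) ∂μ - ∫ ω, W ω * steinSol z (W ω) ∂μ =
      -∑ j ∈ s, (∫ ω, ξ j ω * steinSol z (W ω) ∂μ -
        (∫ ω, ξ j ω ^ 2 ∂μ) * ∫ ω, steinDeriv z (W ω) ∂μ) := by
    rw [Finset.sum_sub_distrib, ← Finset.sum_mul, hs, ← integral_finsetSum s fun j _ => hi j]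
    simp only [hW, Finset.sum_mul]
    ring
  rw [e1, e2, abs_neg]
  calc _ ≤ ∑ j ∈ s, |∫ ω, ξ j ω * steinSol z (W ω) ∂μ -
        (∫ ω, ξ j ω ^ 2 ∂μ) * ∫ ω, steinDeriv z (W ω) ∂μ| := Finset.abs_sum_le_sum_abs _ _
    _ ≤ ∑ j ∈ s, (20 * ∫ ω, |ξ j ω| ^ 3 ∂μ + 20 * γ * ∫ ω, ξ j ω ^ 2 ∂μ) :=
        Finset.sum_le_sum fun j hj => stein_term_le hm hind h3 h0 s hs hγ hγ0 hγ1 hj z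
    _ = 40 * γ := by
        rw [Finset.sum_add_distrib, ← Finset.mul_sum, ← Finset.mul_sum, hs, ← hγ]
        ring

/-- The Berry–Esseen theorem for independent summands with third moments. -/
theorem berryEsseen [DecidableEq ι] {X : ι → Ω → ℝ} (hm : ∀ i, Measurable (X i))
    (hind : iIndepFun X μ) (h3 : ∀ i, MemLp (X i) 3 μ) (s : Finset ι) {σ : ℝ} (hσ : 0 < σ)
    (hs : ∑ j ∈ s, Var[X j; μ] = σ ^ 2) (z : ℝ) :
    |μ.real {ω | (∑ j ∈ s, X j ω - ∑ j ∈ s, μ[X j]) / σ ≤ z} - Phi z| ≤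
      40 * (∑ j ∈ s, ∫ ω, |X j ω - μ[X j]| ^ 3 ∂μ) / σ ^ 3 := by
  have hi : ∀ j, Integrable (X j) μ := fun j => (h3 j).integrable (by norm_num)
  have h2 : ∀ i, MemLp (X i) 2 μ := fun i => (h3 i).mono_exponent (by norm_num)
  have key := berryEsseen_normalized (μ := μ) (ξ := fun j ω => (X j ω - μ[X j]) / σ)
    (fun j => ((hm j).sub_const _).div_const _)
    (hind.comp (fun j (x : ℝ) => (x - ∫ ω, X j ω ∂μ) / σ) fun j => by fun_prop)
    (fun j => by
      have := ((h3 j).sub (memLp_const (μ[X j]))).const_mul σ⁻¹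
      refine this.ae_eq (ae_of_all _ fun ω => ?_)
      simp only [Pi.sub_apply, div_eq_inv_mul])
    (fun j => by
      rw [integral_div, integral_sub (hi j) (integrable_const _)]
      simp) s
    (by
      simp_rw [div_pow, integral_div]
      rw [← Finset.sum_div, div_eq_one_iff_eq (by positivity), ← hs]
      exact Finset.sum_congr rfl fun j _ => (variance_eq_integral (hm j).aemeasurable).symm) z
  simp_rw [← Finset.sum_div, Finset.sum_sub_distrib, abs_div, div_pow, integral_div,
    ← Finset.sum_div, abs_of_pos hσ] at key
  rwa [mul_div_assoc]

end BerryEsseen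

/-! ### First passage probabilities -/

/-- `hit ω n k y` is the probability that the walk in `ω` started at `y` first visits `n` at
time `k`. -/
noncomputable def hit (ω : Env) (n : ℤ) : ℕ → ℤ → ℝ
  | 0, y => if y = n then 1 else 0
  | k + 1, y => if y = n then 0 else
      (ω y : ℝ) * hit ω n k (y + 1) + (1 - (ω y : ℝ)) * hit ω n k (y - 1)

lemma hit_zero (ω : Env) (n y : ℤ) : hit ω n 0 y = if y = n then 1 else 0 := rfl

lemma hit_succ_self (ω : Env) (n : ℤ) (k : ℕ) : hit ω n (k + 1) n = 0 := by
  rw [hit, if_pos rfl]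

lemma hit_succ (ω : Env) {n y : ℤ} (h : y ≠ n) (k : ℕ) : hit ω n (k + 1) y =
    (ω y : ℝ) * hit ω n k (y + 1) + (1 - (ω y : ℝ)) * hit ω n k (y - 1) := by
  rw [hit, if_neg h]

lemma hit_nonneg (ω : Env) (n : ℤ) (k : ℕ) (y : ℤ) : 0 ≤ hit ω n k y := by
  induction k generalizing y with
  | zero => rw [hit_zero]; split_ifs <;> norm_num
  | succ k ih =>
    rw [hit]
    split_ifs
    · exact le_rfl
    · exact add_nonneg (mul_nonneg (ω y).2.1 (ih _)) (mul_nonneg (sub_nonneg.2 (ω y).2.2) (ih _))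

lemma sum_hit_le_one (ω : Env) (n : ℤ) (K : ℕ) (y : ℤ) :
    ∑ k ∈ Finset.range K, hit ω n k y ≤ 1 := by
  induction K generalizing y with
  | zero => simp
  | succ K ih =>
    rw [Finset.sum_range_succ', hit_zero]
    split_ifs with h
    · subst h
      simp [hit_succ_self]
    · simp_rw [hit_succ ω h, Finset.sum_add_distrib, ← Finset.mul_sum, add_zero]
      have h0 := (ω y).2.1
      have h1 := (ω y).2.2
      nlinarith [ih (y + 1), ih (y - 1)]

/-- The passage to `m` goes through `n`. -/
lemma hit_eq_sum_antidiagonal (ω : Env) {n m : ℤ} (hnm : n ≤ m) (k : ℕ) {y : ℤ} (hy : y ≤ n) :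
    hit ω m k y = ∑ p ∈ Finset.HasAntidiagonal.antidiagonal k, hit ω n p.1 y * hit ω m p.2 n := by
  induction k generalizing y with
  | zero =>
    simp only [Finset.HasAntidiagonal.antidiagonal_zero, Finset.sum_singleton, hit_zero]
    rcases eq_or_ne y n with rfl | h
    · simp
    · rw [if_neg (by omega), if_neg h, zero_mul]
  | succ k ih =>
    rw [Finset.Nat.sum_antidiagonal_succ]
    rcases eq_or_ne y n with rfl | h
    · simp [hit_succ_self, hit_zero]
    · rw [hit_zero, if_neg h, zero_mul, zero_add, hit_succ ω (by omega), ih (by omega),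
        ih (by omega), Finset.mul_sum, Finset.mul_sum, ← Finset.sum_add_distrib]
      refine Finset.sum_congr rfl fun p _ => ?_
      rw [hit_succ ω h]
      ring

lemma quenched_isProbabilityMeasure (ω : Env) : IsProbabilityMeasure (quenched ω) := by
  unfold quenched
  infer_instance

/-- The Markov property of the quenched walk. -/
lemma lintegral_quenched_step (ω : Env) (j : ℕ) {F : (∀ _ : Finset.Iic j, ℤ) → ℝ≥0∞}
    (hF : Measurable F) (φ : ℤ → ℝ≥0∞) :
    ∫⁻ X, F (Preorder.frestrictLe j X) * φ (X (j + 1)) ∂(quenched ω) =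
      ∫⁻ X, F (Preorder.frestrictLe j X) * (ENNReal.ofReal (ω (X j)) * φ (X j + 1) +
        ENNReal.ofReal (1 - ω (X j)) * φ (X j - 1)) ∂(quenched ω) := by
  have hφ : Measurable φ := measurable_of_countable _
  have hmap := Kernel.partialTraj_compProd_eq_map_traj (X := fun _ => ℤ)
    (κ := historyKernel ω) (Nat.zero_le j) (x₀ := fun _ => 0)
  have hpart := Kernel.traj_map_frestrictLe_apply (X := fun _ => ℤ) (κ := historyKernel ω) 0 j
    (fun _ => 0)
  have hG : Measurable fun p : (∀ _ : Finset.Iic j, ℤ) × ℤ => F p.1 * φ p.2 :=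
    (hF.comp measurable_fst).mul (hφ.comp measurable_snd)
  have hpair : Measurable fun X : Path => (Preorder.frestrictLe (π := fun _ => ℤ) j X, X (j + 1)) :=
    (Preorder.measurable_frestrictLe j).prodMk (measurable_pi_apply _)
  have e1 : ∫⁻ X, F (Preorder.frestrictLe j X) * φ (X (j + 1)) ∂(quenched ω) =
      ∫⁻ p, F p.1 * φ p.2 ∂((quenched ω).map
        fun X => (Preorder.frestrictLe (π := fun _ => ℤ) j X, X (j + 1))) := by
    rw [lintegral_map hG hpair]
  rw [e1, quenched, ← hmap, Measure.lintegral_compProd hG, ← hpart,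
    lintegral_map _ (Preorder.measurable_frestrictLe j)]
  · refine lintegral_congr fun X => ?_
    simp only
    rw [lintegral_const_mul _ hφ]
    congr 1
    change ∫⁻ y, φ y ∂(stepMeasure ω (X j)) = _
    rw [stepMeasure, lintegral_add_measure, lintegral_smul_measure, lintegral_smul_measure,
      lintegral_dirac, lintegral_dirac, smul_eq_mul, smul_eq_mul]
  · exact Measurable.lintegral_kernel_prod_right' hG

lemma hittingTime_eq_coe_iff (n : ℤ) (k : ℕ) (X : Path) :
    hittingTime n X = (k : WithTop ℕ) ↔ (∀ i < k, X i ≠ n) ∧ X k = n := by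
  constructor
  · intro h
    refine ⟨fun i hi hn => ?_, ?_⟩
    · refine notMem_of_lt_hittingAfter (u := fun (k : ℕ) (Y : Path) => Y k) (s := {n}) (n := 0)
        (ω := X) (k := i) ?_ (Nat.zero_le i) hn
      change (i : WithTop ℕ) < hittingTime n X
      rw [h]
      exact_mod_cast hi
    · have := hittingAfter_mem_set_of_ne_top (u := fun (k : ℕ) (Y : Path) => Y k) (s := {n})
        (n := 0) (ω := X) (by change hittingTime n X ≠ ⊤; rw [h]; exact WithTop.coe_ne_top)
      change X (hittingTime n X).untopA ∈ ({n} : Set ℤ) at this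
      rw [h] at this
      exact this
  · rintro ⟨h1, h2⟩
    have hle : hittingTime n X ≤ (k : WithTop ℕ) :=
      hittingAfter_le_of_mem (u := fun (k : ℕ) (Y : Path) => Y k) (s := {n}) (Nat.zero_le k) h2
    obtain ⟨j, hj⟩ := WithTop.ne_top_iff_exists.1 (ne_top_of_le_ne_top WithTop.coe_ne_top hle)
    have hjk : j ≤ k := by
      rw [← hj] at hle
      exact WithTop.coe_le_coe.1 hle
    have hmem := hittingAfter_mem_set_of_ne_top (u := fun (k : ℕ) (Y : Path) => Y k) (s := {n})
      (n := 0) (ω := X) (by change hittingTime n X ≠ ⊤; rw [← hj]; exact WithTop.coe_ne_top)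
    change X (hittingTime n X).untopA ∈ ({n} : Set ℤ) at hmem
    rw [← hj] at hmem
    have hXj : X j = n := hmem
    rcases hjk.eq_or_lt with rfl | hlt
    · exact hj.symm
    · exact absurd hXj (h1 j hlt)

lemma measurableSet_forall_lt_ne (n : ℤ) (k : ℕ) : MeasurableSet {X : Path | ∀ i < k, X i ≠ n} := by
  have : {X : Path | ∀ i < k, X i ≠ n} = ⋂ i, ⋂ (_ : i < k), {X : Path | X i = n}ᶜ := by
    ext X
    simp
  rw [this]
  exact MeasurableSet.iInter fun i => MeasurableSet.iInter fun _ =>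
    (measurableSet_eq_fun (measurable_pi_apply i) measurable_const).compl

lemma measurableSet_hittingTime_eq (n : ℤ) (k : ℕ) :
    MeasurableSet {X : Path | hittingTime n X = (k : WithTop ℕ)} := by
  simp_rw [hittingTime_eq_coe_iff]
  exact (measurableSet_forall_lt_ne n k).inter
    (measurableSet_eq_fun (measurable_pi_apply k) measurable_const)

/-- The first passage probabilities of the quenched law. -/
lemma quenched_hittingTime_eq (ω : Env) (n : ℤ) (k : ℕ) :
    quenched ω {X | hittingTime n X = (k : WithTop ℕ)} = ENNReal.ofReal (hit ω n k 0) := by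
  have hprob := quenched_isProbabilityMeasure ω
  -- `A j r` is the probability of avoiding `n` before time `j` and then first visiting it exactly
  -- `r` steps later. The Markov property makes it depend on `j + r` only; `A 0 k` is the backward
  -- solution and `A k 0` the path probability.
  set A : ℕ → ℕ → ℝ≥0∞ := fun j r =>
    ∫⁻ X, {X : Path | ∀ i < j, X i ≠ n}.indicator 1 X * ENNReal.ofReal (hit ω n r (X j))
      ∂(quenched ω) with hA
  have hstep : ∀ j r, A j (r + 1) = A (j + 1) r := by
    intro j r
    set S : Set (∀ _ : Finset.Iic j, ℤ) := {h | ∀ i, h i ≠ n} with hS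
    have hSm : MeasurableSet S := by
      have : S = ⋂ i, {h : ∀ _ : Finset.Iic j, ℤ | h i = n}ᶜ := by
        ext h
        simp [hS]
      rw [this]
      exact MeasurableSet.iInter fun i =>
        (measurableSet_eq_fun (measurable_pi_apply i) measurable_const).compl
    have hmem : ∀ X : Path, Preorder.frestrictLe (π := fun _ => ℤ) j X ∈ S ↔
        ∀ i < j + 1, X i ≠ n := by
      intro X
      simp only [hS, Set.mem_ofPred_eq, Subtype.forall, Finset.mem_Iic, Nat.lt_succ_iff]
      rfl
    have h := lintegral_quenched_step ω j (F := S.indicator 1)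
      (measurable_one.indicator hSm) (fun y => ENNReal.ofReal (hit ω n r y))
    have e2 : A (j + 1) r = ∫⁻ X, S.indicator 1 (Preorder.frestrictLe (π := fun _ => ℤ) j X) *
        ENNReal.ofReal (hit ω n r (X (j + 1))) ∂(quenched ω) := by
      refine lintegral_congr fun X => ?_
      congr 1
      simp only [Set.indicator_apply, hmem, Set.mem_ofPred_eq, Pi.one_apply]
    rw [e2, h]
    refine lintegral_congr fun X => ?_
    by_cases hX : ∀ i < j + 1, X i ≠ n
    · rw [Set.indicator_of_mem (show X ∈ {X : Path | ∀ i < j, X i ≠ n} from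
          fun i hi => hX i (by omega)), Set.indicator_of_mem ((hmem X).2 hX), hit_succ ω (hX j (by omega)),
        ENNReal.ofReal_add (mul_nonneg (ω _).2.1 (hit_nonneg ..))
          (mul_nonneg (sub_nonneg.2 (ω _).2.2) (hit_nonneg ..)),
        ENNReal.ofReal_mul (ω _).2.1, ENNReal.ofReal_mul (sub_nonneg.2 (ω _).2.2)]
      rfl
    · rw [Set.indicator_of_notMem (fun h => hX ((hmem X).1 h)), zero_mul]
      -- If the first visit is at time `j` itself, the left side vanishes because `hit` is zero at
      -- its target for positive times; after an earlier visit the indicator vanishes.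
      by_cases hj : ∀ i < j, X i ≠ n
      · have : X j = n := by
          by_contra hne
          exact hX fun i hi => (Nat.lt_succ_iff_lt_or_eq.1 hi).elim (hj i) fun h => h ▸ hne
        rw [this, hit_succ_self, ENNReal.ofReal_zero, mul_zero]
      · rw [Set.indicator_of_notMem (show X ∉ {X : Path | ∀ i < j, X i ≠ n} from hj), zero_mul]
  have hiter : ∀ j r, A j r = A (j + r) 0 := by
    intro j r
    induction r generalizing j with
    | zero => rfl
    | succ r ih => rw [hstep, ih, Nat.succ_add, Nat.add_succ]
  have h0 : A 0 k = ENNReal.ofReal (hit ω n k 0) := by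
    have hX0 : ∀ᵐ X ∂(quenched ω), X 0 = 0 := by
      have hpart := Kernel.traj_map_frestrictLe_apply (X := fun _ => ℤ) (κ := historyKernel ω) 0 0
        (fun _ => 0)
      rw [Kernel.partialTraj_self, Kernel.id_apply] at hpart
      have hs : MeasurableSet {h : ∀ _ : Finset.Iic 0, ℤ | h ⟨0, by simp⟩ = 0} :=
        measurableSet_eq_fun (measurable_pi_apply _) measurable_const
      have hd : ∀ᵐ h ∂(Measure.dirac (fun _ => 0) : Measure (∀ _ : Finset.Iic 0, ℤ)),
          h ⟨0, by simp⟩ = 0 := (ae_dirac_iff hs).2 rfl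
      rw [← hpart] at hd
      exact ae_of_ae_map (Preorder.measurable_frestrictLe 0).aemeasurable hd
    have : A 0 k = ∫⁻ _, ENNReal.ofReal (hit ω n k 0) ∂(quenched ω) := by
      refine lintegral_congr_ae ?_
      filter_upwards [hX0] with X hX
      rw [hX, Set.indicator_of_mem (show X ∈ {X : Path | ∀ i < 0, X i ≠ n} from
        fun i hi => absurd hi (Nat.not_lt_zero i)), Pi.one_apply, one_mul]
    rw [this, lintegral_const, measure_univ, mul_one]
  have hk : A k 0 = quenched ω {X | hittingTime n X = (k : WithTop ℕ)} := by
    rw [← lintegral_indicator_one (measurableSet_hittingTime_eq n k)]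
    refine lintegral_congr fun X => ?_
    have hmem : X ∈ {X : Path | hittingTime n X = (k : WithTop ℕ)} ↔
        (∀ i < k, X i ≠ n) ∧ X k = n := hittingTime_eq_coe_iff n k X
    rw [hit_zero]
    by_cases h1 : ∀ i < k, X i ≠ n
    · rw [Set.indicator_of_mem (show X ∈ {X : Path | ∀ i < k, X i ≠ n} from h1), Pi.one_apply,
        one_mul]
      by_cases h2 : X k = n
      · rw [if_pos h2, Set.indicator_of_mem (hmem.2 ⟨h1, h2⟩), ENNReal.ofReal_one, Pi.one_apply]
      · rw [if_neg h2, Set.indicator_of_notMem (fun h => h2 (hmem.1 h).2), ENNReal.ofReal_zero]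
    · rw [Set.indicator_of_notMem (show X ∉ {X : Path | ∀ i < k, X i ≠ n} from h1), zero_mul,
        Set.indicator_of_notMem (fun h => h1 (hmem.1 h).1)]
  rw [← hk, ← h0, hiter 0 k, zero_add]

/-! ### Laws on the natural numbers -/

/-- The measure on `ℝ` with weights `f k` at the natural numbers `k`. -/
noncomputable def natLaw (f : ℕ → ℝ) : Measure ℝ :=
  Measure.sum fun k => ENNReal.ofReal (f k) • Measure.dirac (k : ℝ)

lemma lintegral_natLaw (f : ℕ → ℝ) (φ : ℝ → ℝ≥0∞) :
    ∫⁻ x, φ x ∂(natLaw f) = ∑' k, ENNReal.ofReal (f k) * φ k := by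
  rw [natLaw, lintegral_sum_measure]
  simp [lintegral_smul_measure]

lemma natLaw_univ (f : ℕ → ℝ) : natLaw f Set.univ = ∑' k, ENNReal.ofReal (f k) := by
  have := lintegral_natLaw f 1
  simpa using this

instance (f : ℕ → ℝ) : SFinite (natLaw f) := by
  unfold natLaw
  have : ∀ k, SFinite (ENNReal.ofReal (f k) • Measure.dirac (k : ℝ)) := fun k => inferInstance
  infer_instance

lemma natLaw_conv {f g : ℕ → ℝ} (hf : ∀ k, 0 ≤ f k) (hg : ∀ k, 0 ≤ g k) :
    natLaw f ∗ natLaw g = natLaw fun k => ∑ p ∈ Finset.HasAntidiagonal.antidiagonal k, f p.1 * g p.2 := by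
  refine Measure.ext_of_lintegral _ fun φ hφ => ?_
  rw [Measure.lintegral_conv hφ, lintegral_natLaw, lintegral_natLaw]
  simp_rw [lintegral_natLaw, ← ENNReal.tsum_mul_left]
  rw [← ENNReal.tsum_prod (f := fun i j => ENNReal.ofReal (f i) *
      (ENNReal.ofReal (g j) * φ ((i : ℝ) + j))),
    ← Finset.HasAntidiagonal.sigmaAntidiagonalEquivProd.tsum_eq, ENNReal.tsum_sigma']
  refine tsum_congr fun k => ?_
  rw [tsum_fintype, ENNReal.ofReal_sum_of_nonneg fun p _ => mul_nonneg (hf _) (hg _),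
    Finset.sum_mul, ← Finset.sum_coe_sort (Finset.HasAntidiagonal.antidiagonal k)]
  refine Finset.sum_congr rfl fun p _ => ?_
  rw [ENNReal.ofReal_mul (hf _), mul_assoc, Finset.HasAntidiagonal.sigmaAntidiagonalEquivProd_apply]
  have h := Finset.HasAntidiagonal.mem_antidiagonal.1 p.2
  congr 3
  simp only
  exact_mod_cast congrArg (fun n : ℕ => (n : ℝ)) h

/-- The law of the passage time from `i` to `i + 1`. -/
noncomputable def crossLaw (ω : Env) (i : ℤ) : Measure ℝ := natLaw fun k => hit ω (i + 1) k i

/-- The law of the passage time from `0` to `n`. -/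
noncomputable def passageLaw (ω : Env) (n : ℤ) : Measure ℝ := natLaw fun k => hit ω n k 0

lemma passageLaw_zero (ω : Env) : passageLaw ω 0 = Measure.dirac 0 := by
  refine Measure.ext_of_lintegral _ fun φ hφ => ?_
  rw [passageLaw, lintegral_natLaw, tsum_eq_single 0, lintegral_dirac]
  · simp [hit_zero]
  · intro k hk
    obtain ⟨k, rfl⟩ := Nat.exists_eq_succ_of_ne_zero hk
    simp [hit_succ_self]

lemma passageLaw_succ (ω : Env) (n : ℕ) :
    passageLaw ω (n + 1 : ℕ) = passageLaw ω n ∗ crossLaw ω n := by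
  rw [passageLaw, passageLaw, crossLaw, natLaw_conv (fun k => hit_nonneg ..)
    (fun k => hit_nonneg ..)]
  congr 1
  ext k
  push_cast
  exact hit_eq_sum_antidiagonal ω (by omega) k (by omega)

lemma hittingTimeReal_of_eq {n : ℤ} {X : Path} {k : ℕ} (h : hittingTime n X = (k : WithTop ℕ)) :
    hittingTimeReal n X = k := by
  rw [hittingTimeReal, h]
  rfl

lemma iUnion_hittingTime_eq (n : ℤ) :
    {X : Path | hittingTime n X ≠ ⊤} = ⋃ k : ℕ, {X | hittingTime n X = (k : WithTop ℕ)} := by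
  ext X
  simp only [Set.mem_ofPred_eq, Set.mem_iUnion, WithTop.ne_top_iff_exists]
  exact ⟨fun ⟨k, hk⟩ => ⟨k, hk.symm⟩, fun ⟨k, hk⟩ => ⟨k, hk.symm⟩⟩

lemma pairwise_disjoint_hittingTime_eq (n : ℤ) :
    Pairwise (Function.onFun Disjoint fun k : ℕ => {X : Path | hittingTime n X = (k : WithTop ℕ)}) := by
  intro i j hij
  refine Set.disjoint_left.2 fun X hi hj => hij ?_
  have : ((i : ℕ) : WithTop ℕ) = j := hi.symm.trans hj
  exact_mod_cast this

lemma ae_hittingTime_ne_top (ω : Env) (n : ℤ) [IsProbabilityMeasure (passageLaw ω n)] :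
    ∀ᵐ X ∂(quenched ω), hittingTime n X ≠ ⊤ := by
  have hprob := quenched_isProbabilityMeasure ω
  have hm : MeasurableSet {X : Path | hittingTime n X ≠ ⊤} := by
    rw [iUnion_hittingTime_eq]
    exact MeasurableSet.iUnion fun k => measurableSet_hittingTime_eq n k
  refine (prob_compl_eq_zero_iff hm).2 ?_
  rw [iUnion_hittingTime_eq, measure_iUnion (pairwise_disjoint_hittingTime_eq n)
    fun k => measurableSet_hittingTime_eq n k]
  simp_rw [quenched_hittingTime_eq]
  rw [← natLaw_univ]
  exact measure_univ (μ := passageLaw ω n)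

/-! ### Passage times as sums of independent crossing times -/

lemma measurable_hittingTimeReal (n : ℤ) : Measurable (hittingTimeReal n) := by
  have htop : MeasurableSet {X : Path | hittingTime n X = ⊤} := by
    have : {X : Path | hittingTime n X = ⊤} = {X : Path | hittingTime n X ≠ ⊤}ᶜ := by
      ext X
      simp
    rw [this, iUnion_hittingTime_eq]
    exact (MeasurableSet.iUnion fun k => measurableSet_hittingTime_eq n k).compl
  have hN : Measurable fun X : Path => (hittingTime n X).untopD 0 := by
    refine measurable_to_countable' fun k => ?_
    have : (fun X : Path => (hittingTime n X).untopD 0) ⁻¹' {k} =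
        {X | hittingTime n X = (k : WithTop ℕ)} ∪ ({X | hittingTime n X = ⊤} ∩ {_X | k = 0}) := by
      ext X
      simp only [Set.mem_preimage, Set.mem_singleton_iff, Set.mem_union, Set.mem_ofPred_eq,
        Set.mem_inter_iff]
      rcases h : hittingTime n X with _ | j
      · simp only [WithTop.none_eq_top, WithTop.untopD_top, true_and]
        constructor
        · exact fun h => Or.inr h.symm
        · rintro (h | h)
          · exact absurd h WithTop.top_ne_coe
          · exact h.symm
      · constructor
        · intro h
          exact Or.inl (congrArg _ h)
        · rintro (h | h)
          · exact WithTop.coe_injective h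
          · exact absurd h.1 WithTop.coe_ne_top
    rw [this]
    exact (measurableSet_hittingTime_eq n k).union (htop.inter (MeasurableSet.const _))
  exact (measurable_from_top (f := fun k : ℕ => (k : ℝ))).comp hN

lemma map_hittingTimeReal (ω : Env) (n : ℤ) [IsProbabilityMeasure (passageLaw ω n)] :
    (quenched ω).map (hittingTimeReal n) = passageLaw ω n := by
  refine Measure.ext_of_lintegral _ fun φ hφ => ?_
  rw [lintegral_map hφ (measurable_hittingTimeReal n), passageLaw, lintegral_natLaw,
    ← setLIntegral_univ]
  -- The event of never reaching `n` is null, so the default value 0 of `hittingTimeReal` leaves no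
  -- trace in the law.
  have hae : (Set.univ : Set Path) =ᵐ[quenched ω]
      ⋃ k : ℕ, {X | hittingTime n X = (k : WithTop ℕ)} := by
    rw [← iUnion_hittingTime_eq]
    exact (eventuallyEq_univ.2 (ae_hittingTime_ne_top ω n)).symm
  rw [setLIntegral_congr hae, lintegral_iUnion (fun k => measurableSet_hittingTime_eq n k)
    (pairwise_disjoint_hittingTime_eq n)]
  refine tsum_congr fun k => ?_
  rw [setLIntegral_congr_fun (g := fun _ => φ k) (measurableSet_hittingTime_eq n k)
    fun X hX => by simp only [hittingTimeReal_of_eq hX], setLIntegral_const,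
    quenched_hittingTime_eq, mul_comm]

/-- Both sides convolve with the next crossing law when `n` grows by one. This plays the role of the
strong Markov property and provides genuinely independent summands for `berryEsseen`. -/
lemma passageLaw_eq_map_sum (ω : Env) [hp : ∀ i : ℕ, IsProbabilityMeasure (crossLaw ω i)] (n : ℕ) :
    passageLaw ω n = (Measure.infinitePi fun i : ℕ => crossLaw ω i).map
      fun x => ∑ i ∈ Finset.range n, x i := by
  induction n with
  | zero => simp [passageLaw_zero, Measure.map_const]
  | succ n ih =>
    have hm : ∀ n : ℕ, Measurable fun x : ℕ → ℝ => ∑ i ∈ Finset.range n, x i := fun n =>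
      Finset.measurable_sum _ fun i _ => measurable_pi_apply i
    have hind : iIndepFun (fun (i : ℕ) (x : ℕ → ℝ) => x i)
        (Measure.infinitePi fun i : ℕ => crossLaw ω i) :=
      iIndepFun_infinitePi (P := fun i : ℕ => crossLaw ω i) (X := fun _ x => x)
        fun _ => measurable_id
    have h := hind.indepFun_finsetSum_of_notMem (fun i => measurable_pi_apply i)
      (Finset.notMem_range_self (n := n))
    have e : (∑ i ∈ Finset.range n, fun x : ℕ → ℝ => x i) =
        fun x => ∑ i ∈ Finset.range n, x i := by
      ext x
      simp
    rw [e] at h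
    have hconv := h.map_add_eq_map_conv_map (hm n) (measurable_pi_apply n)
    rw [passageLaw_succ, ih]
    have hev : (Measure.infinitePi fun i : ℕ => crossLaw ω i).map (fun x => x n) =
        crossLaw ω n := (measurePreserving_eval_infinitePi (fun i : ℕ => crossLaw ω i) n).map_eq
    rw [hev] at hconv
    rw [← hconv]
    congr 1
    ext x
    rw [Finset.sum_range_succ]
    rfl

/-- Quenched consequences of finite third moments of the crossing times. -/
theorem quenched_berryEsseen (ω : Env) (hp : ∀ i : ℕ, IsProbabilityMeasure (crossLaw ω i))
    (h3 : ∀ i : ℕ, MemLp id 3 (crossLaw ω i)) (n : ℕ) :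
    (∀ᵐ X ∂(quenched ω), hittingTime n X ≠ ⊤) ∧
    MemLp (hittingTimeReal n) 2 (quenched ω) ∧
    quenchedVar ω n = ∑ i ∈ Finset.range n, Var[id; crossLaw ω i] ∧
    (0 < quenchedVar ω n → supDist ω n ≤
      40 * (∑ i ∈ Finset.range n, ∫ x, |x - ∫ y, y ∂(crossLaw ω i)| ^ 3 ∂(crossLaw ω i)) /
        √(quenchedVar ω n) ^ 3) := by
  set Q : Measure (ℕ → ℝ) := Measure.infinitePi fun i : ℕ => crossLaw ω i with hQ
  set X : ℕ → (ℕ → ℝ) → ℝ := fun i x => x i with hX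
  have hm : ∀ i, Measurable (X i) := fun i => measurable_pi_apply i
  have hS : Measurable fun x : ℕ → ℝ => ∑ i ∈ Finset.range n, x i :=
    Finset.measurable_sum _ fun i _ => measurable_pi_apply i
  have hlaw := passageLaw_eq_map_sum ω n
  have hprob : IsProbabilityMeasure (passageLaw ω n) := by
    rw [hlaw]
    exact Measure.isProbabilityMeasure_map hS.aemeasurable
  have hind : iIndepFun X Q :=
    iIndepFun_infinitePi (P := fun i : ℕ => crossLaw ω i) (X := fun _ x => x) fun _ => measurable_id
  have hev : ∀ i : ℕ, MeasurePreserving (X i) Q (crossLaw ω i) := fun i =>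
    measurePreserving_eval_infinitePi (fun i : ℕ => crossLaw ω i) i
  have h3' : ∀ i, MemLp (X i) 3 Q := fun i => (h3 i).comp_measurePreserving (hev i)
  have h2' : ∀ i, MemLp (X i) 2 Q := fun i => (h3' i).mono_exponent (by norm_num)
  have hid : IdentDistrib (hittingTimeReal n) (fun x : ℕ → ℝ => ∑ i ∈ Finset.range n, x i)
      (quenched ω) Q :=
    ⟨(measurable_hittingTimeReal n).aemeasurable, hS.aemeasurable,
      (map_hittingTimeReal ω n).trans hlaw⟩
  have hsum2 : MemLp (fun x : ℕ → ℝ => ∑ i ∈ Finset.range n, x i) 2 Q :=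
    (memLp_finsetSum' (Finset.range n) fun i _ => h2' i).ae_eq
      (ae_of_all _ fun x => by simp [hX])
  have hvarX : ∀ i : ℕ, Var[X i; Q] = Var[id; crossLaw ω i] := fun i =>
    (hev i).variance_fun_comp aemeasurable_id
  have hmeanX : ∀ i : ℕ, ∫ x, X i x ∂Q = ∫ y, y ∂(crossLaw ω i) := fun i => by
    rw [← (hev i).map_eq]
    exact (integral_map (hm i).aemeasurable aestronglyMeasurable_id).symm
  have hmean : quenchedMean ω n = ∑ i ∈ Finset.range n, ∫ x, X i x ∂Q := by
    rw [quenchedMean, hid.integral_eq,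
      integral_finsetSum _ fun i _ => (h2' i).integrable (by norm_num)]
  have hvar : quenchedVar ω n = ∑ i ∈ Finset.range n, Var[X i; Q] := by
    rw [quenchedVar, hid.variance_eq,
      ← IndepFun.variance_sum (fun i _ => h2' i) fun i _ j _ hij => hind.indepFun hij]
    congr 1
    ext x
    simp [hX]
  refine ⟨ae_hittingTime_ne_top ω n, hid.symm.memLp_snd hsum2, ?_, fun hpos => ?_⟩
  · rw [hvar]
    exact Finset.sum_congr rfl fun i _ => hvarX i
  · have hσ : 0 < √(quenchedVar ω n) := Real.sqrt_pos.2 hpos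
    have hthird : ∀ i : ℕ, ∫ x, |X i x - ∫ x, X i x ∂Q| ^ 3 ∂Q =
        ∫ x, |x - ∫ y, y ∂(crossLaw ω i)| ^ 3 ∂(crossLaw ω i) := fun i => by
      conv_rhs => rw [← (hev i).map_eq, integral_map (hm i).aemeasurable
        (Measurable.aestronglyMeasurable (by fun_prop)), (hev i).map_eq, ← hmeanX]
    refine ciSup_le fun z => ?_
    have hbe := berryEsseen hm hind h3' (Finset.range n) hσ
      (by rw [Real.sq_sqrt hpos.le, hvar]) z
    simp_rw [hthird] at hbe
    refine le_of_eq_of_le ?_ hbe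
    congr 2
    rw [normalizedCDF, hmean]
    have hset : MeasurableSet {t : ℝ | (t - ∑ i ∈ Finset.range n, ∫ x, X i x ∂Q) /
        √(quenchedVar ω n) ≤ z} := measurableSet_le (by fun_prop) measurable_const
    exact congrArg ENNReal.toReal (hid.measure_mem_eq hset)

/-! ### Recursive inequalities for the moments of the crossing times -/

/-- The real odds ratio `(1 - ω_i) / ω_i`. -/
noncomputable def odds (ω : Env) (i : ℤ) : ℝ := (1 - (ω i : ℝ)) / (ω i : ℝ)

lemma odds_nonneg (ω : Env) (i : ℤ) : 0 ≤ odds ω i :=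
  div_nonneg (sub_nonneg.2 (ω i).2.2) (ω i).2.1

lemma rho_eq_ofReal_odds {ω : Env} {i : ℤ} (h : 0 < (ω i : ℝ)) :
    rho ω i = ENNReal.ofReal (odds ω i) := by
  rw [rho, odds, ENNReal.ofReal_div_of_pos h]

/-- Truncated moments of the crossing time from `i` to `i + 1`. -/
noncomputable def truncMoment (ω : Env) (K r : ℕ) (i : ℤ) : ℝ :=
  ∑ k ∈ Finset.range K, (k : ℝ) ^ r * hit ω (i + 1) k i

lemma truncMoment_nonneg (ω : Env) (K r : ℕ) (i : ℤ) : 0 ≤ truncMoment ω K r i :=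
  Finset.sum_nonneg fun _ _ => mul_nonneg (by positivity) (hit_nonneg ..)

lemma truncMoment_zero_le_one (ω : Env) (K : ℕ) (i : ℤ) : truncMoment ω K 0 i ≤ 1 := by
  simpa [truncMoment] using sum_hit_le_one ω (i + 1) K i

lemma hit_cross_succ (ω : Env) (i : ℤ) (k : ℕ) : hit ω (i + 1) (k + 1) i =
    (ω i : ℝ) * hit ω (i + 1) k (i + 1) + (1 - (ω i : ℝ)) *
      ∑ p ∈ Finset.HasAntidiagonal.antidiagonal k,
        hit ω (i - 1 + 1) p.1 (i - 1) * hit ω (i + 1) p.2 i := by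
  rw [hit_succ ω (by omega), hit_eq_sum_antidiagonal ω (n := i) (m := i + 1) (by omega) k
    (y := i - 1) (by omega), sub_add_cancel]

/-- The triangle `a + b < K` lies in the square `a, b < K`. Enlarging it makes truncated moments of
a convolution factorize. -/
lemma sum_antidiagonal_le_sum_sum {F : ℕ → ℕ → ℝ} (hF : ∀ a b, 0 ≤ F a b) (K : ℕ) :
    ∑ k ∈ Finset.range K, ∑ p ∈ Finset.HasAntidiagonal.antidiagonal k, F p.1 p.2 ≤
      ∑ a ∈ Finset.range K, ∑ b ∈ Finset.range K, F a b := by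
  rw [← Finset.sum_product' (Finset.range K) (Finset.range K) F]
  have h := Finset.sum_fiberwise_of_maps_to (s := (Finset.range K ×ˢ Finset.range K).filter
    fun p : ℕ × ℕ => p.1 + p.2 < K) (t := Finset.range K) (g := fun p => p.1 + p.2)
    (fun p hp => Finset.mem_range.2 (Finset.mem_filter.1 hp).2) fun p => F p.1 p.2
  refine le_trans (le_of_eq ?_) (Finset.sum_le_sum_of_subset_of_nonneg (Finset.filter_subset
    (fun p : ℕ × ℕ => p.1 + p.2 < K) _) fun p _ _ => hF p.1 p.2)
  rw [← h]
  refine Finset.sum_congr rfl fun k hk => Finset.sum_congr ?_ fun _ _ => rfl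
  ext p
  simp only [Finset.HasAntidiagonal.mem_antidiagonal, Finset.mem_filter, Finset.mem_product,
    Finset.mem_range] at hk ⊢
  omega

lemma sum_mul_hit_le (ω : Env) (K : ℕ) (i : ℤ) {g : ℕ → ℝ} (hg : ∀ k, 0 ≤ g k) :
    ∑ k ∈ Finset.range K, g k * hit ω (i + 1) k i ≤ (ω i : ℝ) * g 1 + (1 - (ω i : ℝ)) *
      ∑ a ∈ Finset.range K, ∑ b ∈ Finset.range K,
        g (a + b + 1) * (hit ω (i - 1 + 1) a (i - 1) * hit ω (i + 1) b i) := by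
  have h0 := (ω i).2.1
  have h1 : 0 ≤ 1 - (ω i : ℝ) := sub_nonneg.2 (ω i).2.2
  have hF : ∀ a b, 0 ≤ g (a + b + 1) * (hit ω (i - 1 + 1) a (i - 1) * hit ω (i + 1) b i) :=
    fun a b => mul_nonneg (hg _) (mul_nonneg (hit_nonneg ..) (hit_nonneg ..))
  have hstep : ∑ k ∈ Finset.range K, g (k + 1) * hit ω (i + 1) (k + 1) i ≤
      (ω i : ℝ) * g 1 + (1 - (ω i : ℝ)) * ∑ a ∈ Finset.range K, ∑ b ∈ Finset.range K,
        g (a + b + 1) * (hit ω (i - 1 + 1) a (i - 1) * hit ω (i + 1) b i) := by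
    have e : ∀ k, g (k + 1) * hit ω (i + 1) (k + 1) i =
        (ω i : ℝ) * (g (k + 1) * hit ω (i + 1) k (i + 1)) + (1 - (ω i : ℝ)) *
          ∑ p ∈ Finset.HasAntidiagonal.antidiagonal k, g (p.1 + p.2 + 1) *
            (hit ω (i - 1 + 1) p.1 (i - 1) * hit ω (i + 1) p.2 i) := by
      intro k
      rw [hit_cross_succ, mul_add, mul_left_comm, mul_left_comm (g _) (1 - (ω i : ℝ)), Finset.mul_sum]
      congr 2
      refine Finset.sum_congr rfl fun p hp => ?_
      rw [Finset.HasAntidiagonal.mem_antidiagonal.1 hp]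
    simp_rw [e, Finset.sum_add_distrib, ← Finset.mul_sum]
    refine add_le_add (mul_le_mul_of_nonneg_left ?_ h0) (mul_le_mul_of_nonneg_left
      (sum_antidiagonal_le_sum_sum hF K) h1)
    rcases K with _ | K
    · simpa using hg 1
    · rw [Finset.sum_range_succ']
      simp [hit_succ_self, hit_zero]
  refine le_trans ?_ hstep
  rcases K with _ | K
  · simp
  · rw [Finset.sum_range_succ', hit_zero, if_neg (by omega), mul_zero, add_zero]
    exact Finset.sum_le_sum_of_subset_of_nonneg (Finset.range_mono (Nat.le_succ K))
      fun k _ _ => mul_nonneg (hg _) (hit_nonneg ..)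

/-- Expand `(a + b + 1) ^ s` in the first-step decomposition. The coefficient of the moment of the
same order at `i - 1` must be exactly the odds ratio, since contraction rests on it; the lower-order
terms are bounded crudely by powers of `1 + odds`, `1 + a1` and `1 + a2`. -/
lemma truncMoment_recursion {ω : Env} {i : ℤ} (hω : 0 < (ω i : ℝ)) (K : ℕ) :
    truncMoment ω K 1 i ≤ odds ω i * truncMoment ω K 1 (i - 1) + (1 + odds ω i) ∧
    truncMoment ω K 2 i ≤ odds ω i * truncMoment ω K 2 (i - 1) +
      5 * (1 + odds ω i) ^ 2 * (1 + truncMoment ω K 1 (i - 1)) ^ 2 ∧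
    truncMoment ω K 3 i ≤ odds ω i * truncMoment ω K 3 (i - 1) +
      (1 + odds ω i) ^ 3 * (25 * (1 + truncMoment ω K 1 (i - 1)) ^ 3 +
        9 * ((1 + truncMoment ω K 1 (i - 1)) * (1 + truncMoment ω K 2 (i - 1)))) := by
  set a0 := truncMoment ω K 0 (i - 1) with ha0
  set a1 := truncMoment ω K 1 (i - 1) with ha1
  set a2 := truncMoment ω K 2 (i - 1) with ha2
  set a3 := truncMoment ω K 3 (i - 1) with ha3
  set b0 := truncMoment ω K 0 i with hb0
  set b1 := truncMoment ω K 1 i with hb1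
  set b2 := truncMoment ω K 2 i with hb2
  set b3 := truncMoment ω K 3 i with hb3
  set r := odds ω i with hr
  have hr0 : 0 ≤ r := odds_nonneg ω i
  have hw1 : 0 ≤ 1 - (ω i : ℝ) := sub_nonneg.2 (ω i).2.2
  have hwr : (ω i : ℝ) * r = 1 - ω i := by
    rw [hr, odds]
    field_simp
  -- The unknown `b` also occurs on the right with weight `1 - ω i`. Moving it to the left and
  -- dividing by `ω i` turns that weight into the odds ratio.
  have hsolve : ∀ {b S : ℝ}, b ≤ ω i + (1 - (ω i : ℝ)) * (1 + (S + b)) → b ≤ (1 + r) + r * S := by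
    intro b S h
    have h' : (ω i : ℝ) * b ≤ ω i * ((1 + r) + r * S) := by
      have : (ω i : ℝ) * ((1 + r) + r * S) = ω i + (1 - ω i) + (1 - (ω i : ℝ)) * S := by
        rw [← hwr]
        ring
      rw [this]
      linarith
    exact le_of_mul_le_mul_left h' hω
  have na0 : 0 ≤ a0 := truncMoment_nonneg ..
  have na1 : 0 ≤ a1 := truncMoment_nonneg ..
  have na2 : 0 ≤ a2 := truncMoment_nonneg ..
  have na3 : 0 ≤ a3 := truncMoment_nonneg ..
  have nb0 : 0 ≤ b0 := truncMoment_nonneg ..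
  have nb1 : 0 ≤ b1 := truncMoment_nonneg ..
  have nb2 : 0 ≤ b2 := truncMoment_nonneg ..
  have nb3 : 0 ≤ b3 := truncMoment_nonneg ..
  have la0 : a0 ≤ 1 := truncMoment_zero_le_one ..
  have lb0 : b0 ≤ 1 := truncMoment_zero_le_one ..
  have m00 : a0 * b0 ≤ 1 := mul_le_one₀ la0 nb0 lb0
  have key : ∀ s : ℕ, truncMoment ω K s i ≤ (ω i : ℝ) + (1 - (ω i : ℝ)) *
      ∑ a ∈ Finset.range K, ∑ b ∈ Finset.range K, ((a : ℝ) + b + 1) ^ s *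
        (hit ω (i - 1 + 1) a (i - 1) * hit ω (i + 1) b i) := by
    intro s
    have := sum_mul_hit_le ω K i (g := fun k => (k : ℝ) ^ s) fun k => by positivity
    simpa [truncMoment] using this
  have e1 : ∑ a ∈ Finset.range K, ∑ b ∈ Finset.range K, ((a : ℝ) + b + 1) ^ 1 *
      (hit ω (i - 1 + 1) a (i - 1) * hit ω (i + 1) b i) = a1 * b0 + a0 * b1 + a0 * b0 := by
    simp only [ha0, ha1, hb0, hb1, truncMoment, Finset.sum_mul_sum, ← Finset.sum_add_distrib]
    exact Finset.sum_congr rfl fun a _ => Finset.sum_congr rfl fun b _ => by ring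
  have e2 : ∑ a ∈ Finset.range K, ∑ b ∈ Finset.range K, ((a : ℝ) + b + 1) ^ 2 *
      (hit ω (i - 1 + 1) a (i - 1) * hit ω (i + 1) b i) =
      a2 * b0 + 2 * (a1 * b1) + a0 * b2 + 2 * (a1 * b0) + 2 * (a0 * b1) + a0 * b0 := by
    simp only [ha0, ha1, ha2, hb0, hb1, hb2, truncMoment, Finset.sum_mul_sum]
    simp only [Finset.mul_sum, ← Finset.sum_add_distrib]
    exact Finset.sum_congr rfl fun a _ => Finset.sum_congr rfl fun b _ => by ring
  have e3 : ∑ a ∈ Finset.range K, ∑ b ∈ Finset.range K, ((a : ℝ) + b + 1) ^ 3 *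
      (hit ω (i - 1 + 1) a (i - 1) * hit ω (i + 1) b i) =
      a3 * b0 + 3 * (a2 * b1) + 3 * (a1 * b2) + a0 * b3 + 3 * (a2 * b0) + 6 * (a1 * b1) +
        3 * (a0 * b2) + 3 * (a1 * b0) + 3 * (a0 * b1) + a0 * b0 := by
    simp only [ha0, ha1, ha2, ha3, hb0, hb1, hb2, hb3, truncMoment, Finset.sum_mul_sum]
    simp only [Finset.mul_sum, ← Finset.sum_add_distrib]
    exact Finset.sum_congr rfl fun a _ => Finset.sum_congr rfl fun b _ => by ring
  have l1 : a1 * b0 ≤ a1 := mul_le_of_le_one_right na1 lb0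
  have l2 : a2 * b0 ≤ a2 := mul_le_of_le_one_right na2 lb0
  have l3 : a3 * b0 ≤ a3 := mul_le_of_le_one_right na3 lb0
  have l4 : a0 * b1 ≤ b1 := mul_le_of_le_one_left nb1 la0
  have l5 : a0 * b2 ≤ b2 := mul_le_of_le_one_left nb2 la0
  have l6 : a0 * b3 ≤ b3 := mul_le_of_le_one_left nb3 la0
  have k1 := key 1
  have k2 := key 2
  have k3 := key 3
  rw [e1] at k1
  rw [e2] at k2
  rw [e3] at k3
  have s1 : b1 ≤ (1 + r) + r * a1 :=
    hsolve (k1.trans (add_le_add le_rfl (mul_le_mul_of_nonneg_left (by linarith) hw1)))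
  have s2 : b2 ≤ (1 + r) + r * (a2 + 2 * (a1 * b1) + 2 * a1 + 2 * b1) :=
    
    hsolve (k2.trans (add_le_add le_rfl (mul_le_mul_of_nonneg_left (by linarith) hw1)))
  have s3 : b3 ≤ (1 + r) + r * (a3 + 3 * (a2 * b1) + 3 * (a1 * b2) + 3 * a2 + 6 * (a1 * b1) +
      3 * b2 + 3 * a1 + 3 * b1) :=
    hsolve (k3.trans (add_le_add le_rfl (mul_le_mul_of_nonneg_left (by linarith) hw1)))
  -- products of powers of `v = 1 + r`, `u = 1 + a1`, `w = 1 + a2`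
  obtain ⟨v, hv⟩ : ∃ v, v = 1 + r := ⟨_, rfl⟩
  obtain ⟨u, hu⟩ : ∃ u, u = 1 + a1 := ⟨_, rfl⟩
  obtain ⟨w, hw⟩ : ∃ w, w = 1 + a2 := ⟨_, rfl⟩
  have hv1 : 1 ≤ v := by linarith
  have hu1 : 1 ≤ u := by linarith
  have hw1' : 1 ≤ w := by linarith
  have hrv : r ≤ v := by linarith
  have hau : a1 ≤ u := by linarith
  have haw : a2 ≤ w := by linarith
  rw [← hv, ← hu, ← hw]
  rw [← hv] at s1 s2 s3
  have hb1' : b1 ≤ v * u := by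
    have := mul_le_mul_of_nonneg_right hrv na1
    rw [hu]
    linarith
  have hvle : v ≤ v ^ 2 := le_self_pow₀ hv1 two_ne_zero
  have hvle3 : v ≤ v ^ 3 := le_self_pow₀ hv1 three_ne_zero
  have hv23 : v ^ 2 ≤ v ^ 3 := pow_le_pow_right₀ hv1 (by norm_num)
  have hu12 : u ≤ u ^ 2 := le_self_pow₀ hu1 two_ne_zero
  have hu23 : u ^ 2 ≤ u ^ 3 := pow_le_pow_right₀ hu1 (by norm_num)
  have hu13 : u ≤ u ^ 3 := hu12.trans hu23
  have hb2' : b2 ≤ r * a2 + 5 * v ^ 2 * u ^ 2 := by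
    have t1 : v ≤ v ^ 2 * u ^ 2 := by
      calc v = v * 1 := (mul_one v).symm
        _ ≤ v ^ 2 * u ^ 2 := by
          gcongr
          exact one_le_pow₀ hu1
    have t2 : r * (a1 * b1) + r * b1 ≤ v ^ 2 * u ^ 2 := by
      calc r * (a1 * b1) + r * b1 = r * u * b1 := by rw [hu]; ring
        _ ≤ v * u * (v * u) := by gcongr
        _ = _ := by ring
    have t3 : r * a1 ≤ v ^ 2 * u ^ 2 := by
      calc r * a1 ≤ v * u := by gcongr
        _ ≤ _ := by gcongr
    linarith
  refine ⟨by linarith, hb2', ?_⟩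
  have hb2'' : b2 ≤ v * w + 5 * v ^ 2 * u ^ 2 := hb2'.trans (by gcongr)
  have hvw : v * w + 5 * v ^ 2 * u ^ 2 ≤ v ^ 2 * (w + 5 * u ^ 2) := by
    have := mul_le_mul_of_nonneg_right hvle (zero_le_one.trans hw1')
    linarith
  have t1 : v ≤ v ^ 3 * u ^ 3 := by
    calc v = v * 1 := (mul_one v).symm
      _ ≤ v ^ 3 * u ^ 3 := by
        gcongr
        exact one_le_pow₀ hu1
  have t2 : r * (a2 * b1) ≤ v ^ 3 * (u * w) := by
    calc r * (a2 * b1) ≤ v * (w * (v * u)) := by gcongr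
      _ = v ^ 2 * (u * w) := by ring
      _ ≤ _ := by gcongr
  have t3 : r * (a1 * b2) + r * b2 ≤ v ^ 3 * (u * w + 5 * u ^ 3) := by
    calc r * (a1 * b2) + r * b2 = r * u * b2 := by rw [hu]; ring
      _ ≤ v * u * (v ^ 2 * (w + 5 * u ^ 2)) := by
        gcongr
        exact hb2''.trans hvw
      _ = _ := by ring
  have t4 : r * (a1 * b1) + r * b1 ≤ v ^ 3 * u ^ 3 := by
    calc r * (a1 * b1) + r * b1 = r * u * b1 := by rw [hu]; ring
      _ ≤ v * u * (v * u) := by gcongr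
      _ = v ^ 2 * u ^ 2 := by ring
      _ ≤ _ := by gcongr
  have t5 : r * a2 ≤ v ^ 3 * (u * w) := by
    calc r * a2 ≤ v * (1 * w) := by rw [one_mul]; gcongr
      _ ≤ _ := by gcongr
  have t6 : r * a1 ≤ v ^ 3 * u ^ 3 := by
    calc r * a1 ≤ v * u := by gcongr
      _ ≤ _ := by gcongr
  have t7 : 0 ≤ r * b1 := mul_nonneg hr0 nb1
  linarith

/-! ### Measurability, locality and stationarity of the first passage probabilities -/

lemma measurable_env (x : ℤ) : Measurable fun ω : Env => (ω x : ℝ) :=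
  measurable_subtype_coe.comp (measurable_pi_apply x)

lemma measurable_hit (n : ℤ) (k : ℕ) (y : ℤ) : Measurable fun ω : Env => hit ω n k y := by
  induction k generalizing y with
  | zero => simp only [hit_zero]; exact measurable_const
  | succ k ih =>
    by_cases h : y = n
    · subst h
      simp only [hit_succ_self]
      exact measurable_const
    · simp only [hit_succ _ h]
      exact ((measurable_env y).mul (ih _)).add (((measurable_env y).const_sub 1).mul (ih _))

/-- In `k` steps without passing `n`, a path uses only the transition probabilities at sites
strictly between `y - k` and `n`. This is the source of every independence statement below. -/
lemma hit_congr {ω ω' : Env} {n : ℤ} (k : ℕ) {y : ℤ} (hy : y ≤ n)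
    (h : ∀ j, y - k < j → j < n → ω j = ω' j) : hit ω n k y = hit ω' n k y := by
  induction k generalizing y with
  | zero => rfl
  | succ k ih =>
    rcases eq_or_ne y n with rfl | hne
    · simp only [hit_succ_self]
    · push_cast at h
      rw [hit_succ ω hne, hit_succ ω' hne, h y (by omega) (by omega),
        ih (by omega) fun j h1 h2 => h j (by omega) h2,
        ih (by omega) fun j h1 h2 => h j (by omega) h2]

/-- The shift of the environment. -/
def shift (ω : Env) : Env := fun x => ω (x + 1)

lemma measurable_shift : Measurable shift :=
  measurable_pi_iff.2 fun x => measurable_pi_apply (x + 1)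

lemma hit_shift (ω : Env) (n : ℤ) (k : ℕ) (y : ℤ) :
    hit (shift ω) n k y = hit ω (n + 1) k (y + 1) := by
  induction k generalizing y with
  | zero => simp [hit_zero]
  | succ k ih =>
    by_cases h : y = n
    · subst h
      simp only [hit_succ_self]
    · rw [hit_succ _ h, hit_succ _ (by omega), ih, ih, sub_add_cancel, add_sub_cancel_right]
      rfl

lemma measurable_truncMoment (K r : ℕ) (i : ℤ) : Measurable fun ω => truncMoment ω K r i :=
  Finset.measurable_sum _ fun k _ => (measurable_hit (i + 1) k i).const_mul _

lemma truncMoment_congr {ω ω' : Env} (K r : ℕ) (i : ℤ)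
    (h : ∀ j, i - K < j → j ≤ i → ω j = ω' j) : truncMoment ω K r i = truncMoment ω' K r i := by
  refine Finset.sum_congr rfl fun k hk => ?_
  rw [hit_congr k (by omega) fun j h1 h2 => h j ?_ (by omega)]
  have := Finset.mem_range.1 hk
  omega

lemma truncMoment_shift (ω : Env) (K r : ℕ) (i : ℤ) :
    truncMoment (shift ω) K r i = truncMoment ω K r (i + 1) := by
  simp only [truncMoment, hit_shift]

lemma truncMoment_le (ω : Env) (K r : ℕ) (i : ℤ) : truncMoment ω K r i ≤ (K : ℝ) ^ r := by
  calc truncMoment ω K r i ≤ ∑ k ∈ Finset.range K, (K : ℝ) ^ r * hit ω (i + 1) k i := by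
        refine Finset.sum_le_sum fun k hk => mul_le_mul_of_nonneg_right ?_ (hit_nonneg ..)
        have : (k : ℝ) ≤ K := by exact_mod_cast (Finset.mem_range.1 hk).le
        gcongr
    _ ≤ (K : ℝ) ^ r := by
        rw [← Finset.mul_sum]
        exact mul_le_of_le_one_right (by positivity) (sum_hit_le_one ..)

section IID

variable {P : Measure Env}

lemma IsIID.measurePreserving_shift (h : IsIID P) : MeasurePreserving shift P P := by
  refine ⟨measurable_shift, ?_⟩
  have h1 := h.1.map_fun_eq_infinitePi_map fun x => measurable_pi_apply x
  have h2 := (h.1.precomp (g := fun x : ℤ => x + 1) (add_left_injective 1)).map_fun_eq_infinitePi_map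
    fun x => measurable_pi_apply (x + 1)
  have h3 : (fun x : ℤ => P.map fun ω : Env => ω (x + 1)) = fun x : ℤ => P.map fun ω => ω x := by
    ext1 x
    rw [(h.2 (x + 1)).map_eq, (h.2 x).map_eq]
  have h4 : P.map (fun (ω : Env) (x : ℤ) => ω x) = P := Measure.map_id
  rw [h4] at h1
  calc P.map shift = Measure.infinitePi fun x : ℤ => P.map fun ω : Env => ω (x + 1) := h2
    _ = P := by rw [h3, ← h1]

/-- The `σ`-algebra generated by the coordinates in `U`. -/
abbrev envSigma (U : Set ℤ) : MeasurableSpace Env :=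
  ⨆ x ∈ U, MeasurableSpace.comap (fun ω : Env => ω x) inferInstance

lemma comap_le_envSigma {β : Type*} [mβ : MeasurableSpace β] {f : Env → β} (hf : Measurable f)
    {U : Set ℤ} (hU : DependsOn f U) : MeasurableSpace.comap f mβ ≤ envSigma U := by
  classical
  -- Resetting the coordinates off `U` does not change `f`, and the reset map is measurable for the
  -- coordinates in `U`.
  set e : Env → Env := fun ω x => if x ∈ U then ω x else 1 with he
  have hfe : f = f ∘ e := by
    ext1 ω
    refine hU fun x hx => ?_
    simp [he, hx]
  have hem : @Measurable Env Env (envSigma U) _ e := by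
    refine @measurable_pi_iff _ _ _ (_) _ _ |>.2 fun x => ?_
    by_cases hx : x ∈ U
    · simp only [he, hx, if_true]
      exact Measurable.of_comap_le (le_iSup₂_of_le x hx le_rfl)
    · simp only [he, hx, if_false]
      exact @measurable_const _ _ _ (_) _
  rw [hfe]
  exact (hf.comp hem).comap_le

/-- Functions of disjoint sets of coordinates are independent. -/
lemma IsIID.indepFun_of_dependsOn (h : IsIID P) {β γ : Type*} [MeasurableSpace β]
    [MeasurableSpace γ] {f : Env → β} {g : Env → γ} (hf : Measurable f) (hg : Measurable g)
    {S T : Set ℤ} (hfS : DependsOn f S) (hgT : DependsOn g T) (hST : Disjoint S T) :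
    IndepFun f g P := by
  have hind := indep_iSup_of_disjoint (m := fun x : ℤ =>
    MeasurableSpace.comap (fun ω : Env => ω x) inferInstance)
    (fun x => (measurable_pi_apply x).comap_le) h.1 hST
  exact indep_of_indep_of_le_left (indep_of_indep_of_le_right hind (comap_le_envSigma hg hgT))
    (comap_le_envSigma hf hfS)

lemma measurable_rho (x : ℤ) : Measurable fun ω : Env => rho ω x :=
  ((measurable_env x).const_sub 1).ennreal_ofReal.div (measurable_env x).ennreal_ofReal

lemma IsIID.lintegral_comp_env (h : IsIID P) {φ : unitInterval → ℝ≥0∞} (hφ : Measurable φ)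
    (x : ℤ) : ∫⁻ ω, φ (ω x) ∂P = ∫⁻ ω, φ (ω 0) ∂P :=
  ((h.2 x).comp hφ).lintegral_eq

lemma IsIID.lintegral_rho (h : IsIID P) (s : ℝ) (x : ℤ) :
    ∫⁻ ω, rho ω x ^ s ∂P = ∫⁻ ω, rho ω 0 ^ s ∂P := by
  refine h.lintegral_comp_env (φ := fun t => (ENNReal.ofReal (1 - (t : ℝ)) /
    ENNReal.ofReal (t : ℝ)) ^ s) ?_ x
  have : Measurable fun t : unitInterval => (t : ℝ) := measurable_subtype_coe
  exact ((this.const_sub 1).ennreal_ofReal.div this.ennreal_ofReal).pow_const s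

end IID

/-! ### Moment bounds from stationarity -/

/-- Choose `δ` with `(1 + δ) ^ q = 1 + ε` and compare `y` with `δ x`. Keeping the coefficient of `x
^ q` close to one preserves the contraction `E[ρ ^ q] < 1`, for exponents on either side of one. -/
lemma ENNReal_add_rpow_le {q : ℝ} (hq : 0 < q) {ε : ℝ≥0∞} (hε : ε ≠ 0) (hε' : ε ≠ ⊤) :
    ∃ C : ℝ≥0∞, C ≠ ⊤ ∧ ∀ x y : ℝ≥0∞, (x + y) ^ q ≤ (1 + ε) * x ^ q + C * y ^ q := by
  set t : ℝ≥0∞ := (1 + ε) ^ q⁻¹ with ht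
  have ht1 : 1 < t := ENNReal.one_lt_rpow (by simpa using ENNReal.lt_add_right ENNReal.one_ne_top hε)
    (inv_pos.2 hq)
  have htop : t ≠ ⊤ := ENNReal.rpow_ne_top_of_nonneg (inv_nonneg.2 hq.le)
    (ENNReal.add_ne_top.2 ⟨ENNReal.one_ne_top, hε'⟩)
  have htq : t ^ q = 1 + ε := ENNReal.rpow_inv_rpow hq.ne' _
  set δ : ℝ≥0∞ := t - 1 with hδ
  have hδ0 : δ ≠ 0 := (tsub_pos_of_lt ht1).ne'
  have hδtop : δ ≠ ⊤ := ENNReal.sub_ne_top htop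
  have hδt : 1 + δ = t := add_tsub_cancel_of_le ht1.le
  refine ⟨(δ⁻¹ + 1) ^ q, ENNReal.rpow_ne_top_of_nonneg hq.le
    (ENNReal.add_ne_top.2 ⟨ENNReal.inv_ne_top.2 hδ0, ENNReal.one_ne_top⟩), fun x y => ?_⟩
  rcases le_total y (δ * x) with h | h
  · refine le_trans ?_ le_self_add
    rw [← htq, ← ENNReal.mul_rpow_of_nonneg _ _ hq.le, ← hδt]
    refine ENNReal.rpow_le_rpow ?_ hq.le
    rw [add_mul, one_mul]
    gcongr
  · refine le_trans ?_ le_add_self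
    rw [← ENNReal.mul_rpow_of_nonneg _ _ hq.le]
    refine ENNReal.rpow_le_rpow ?_ hq.le
    rw [add_mul, one_mul]
    gcongr
    calc x = δ⁻¹ * (δ * x) := by rw [← mul_assoc, ENNReal.inv_mul_cancel hδ0 hδtop, one_mul]
      _ ≤ δ⁻¹ * y := by gcongr

/-- Moments of stationary solutions of the recursive inequality `X ≤ ρ Y + R`. -/
lemma lintegral_rpow_le_of_recursion {Ω : Type*} {mΩ : MeasurableSpace Ω} {μ : Measure Ω}
    {q : ℝ} (hq : 0 < q) {ρ : Ω → ℝ≥0∞} (hρ : Measurable ρ) (hρq : ∫⁻ ω, ρ ω ^ q ∂μ < 1) :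
    ∃ C : ℝ≥0∞, C ≠ ⊤ ∧ ∀ X Y R : Ω → ℝ≥0∞, Measurable Y → Measurable R →
      IndepFun ρ Y μ → (∀ᵐ ω ∂μ, X ω ≤ ρ ω * Y ω + R ω) →
      ∫⁻ ω, Y ω ^ q ∂μ = ∫⁻ ω, X ω ^ q ∂μ → ∫⁻ ω, X ω ^ q ∂μ ≠ ⊤ →
      ∫⁻ ω, X ω ^ q ∂μ ≤ C * ∫⁻ ω, R ω ^ q ∂μ := by
  obtain ⟨t, ht0, ht⟩ : ∃ t : ℝ, 0 ≤ t ∧ ∫⁻ ω, ρ ω ^ q ∂μ = ENNReal.ofReal t :=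
    ⟨_, ENNReal.toReal_nonneg, (ENNReal.ofReal_toReal hρq.ne_top).symm⟩
  have ht1 : t < 1 := by
    rw [ht, ENNReal.ofReal_lt_one] at hρq
    exact hρq
  obtain ⟨C, hC, hadd⟩ := ENNReal_add_rpow_le hq (ε := ENNReal.ofReal ((1 - t) / 2))
    (by simpa using ht1) ENNReal.ofReal_ne_top
  -- The slack `(1 - t)/2` keeps the contraction factor below one.
  set a : ℝ≥0∞ := (1 + ENNReal.ofReal ((1 - t) / 2)) * ENNReal.ofReal t with ha
  have ha1 : a < 1 := by
    rw [ha, ← ENNReal.ofReal_one, ← ENNReal.ofReal_add zero_le_one (by linarith),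
      ← ENNReal.ofReal_mul (by linarith), ENNReal.ofReal_lt_ofReal_iff zero_lt_one]
    nlinarith
  have hsub : 1 - a ≠ 0 := (tsub_pos_of_lt ha1).ne'
  refine ⟨(1 - a)⁻¹ * C, ENNReal.mul_ne_top (ENNReal.inv_ne_top.2 hsub) hC, ?_⟩
  intro X Y R hY hR hind hle hYX hfin
  have hm : Measurable fun ω => ρ ω ^ q * Y ω ^ q := (hρ.pow_const q).mul (hY.pow_const q)
  have hprod : ∫⁻ ω, ρ ω ^ q * Y ω ^ q ∂μ = (∫⁻ ω, ρ ω ^ q ∂μ) * ∫⁻ ω, Y ω ^ q ∂μ :=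
    lintegral_mul_eq_lintegral_mul_lintegral_of_indepFun'' (hρ.pow_const q).aemeasurable
      (hY.pow_const q).aemeasurable
      (hind.comp (φ := fun x : ℝ≥0∞ => x ^ q) (ψ := fun x : ℝ≥0∞ => x ^ q)
        (measurable_id.pow_const q) (measurable_id.pow_const q))
  have hmain : ∫⁻ ω, X ω ^ q ∂μ ≤ a * ∫⁻ ω, X ω ^ q ∂μ + C * ∫⁻ ω, R ω ^ q ∂μ := by
    calc ∫⁻ ω, X ω ^ q ∂μ
        ≤ ∫⁻ ω, ((1 + ENNReal.ofReal ((1 - t) / 2)) * (ρ ω ^ q * Y ω ^ q) + C * R ω ^ q) ∂μ := by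
          refine lintegral_mono_ae ?_
          filter_upwards [hle] with ω hω
          rw [← ENNReal.mul_rpow_of_nonneg _ _ hq.le]
          exact (ENNReal.rpow_le_rpow hω hq.le).trans (hadd _ _)
      _ = _ := by
          rw [lintegral_add_right _ ((hR.pow_const q).const_mul C),
            lintegral_const_mul _ hm,
            lintegral_const_mul _ (hR.pow_const q),
            hprod, ht, hYX, ← mul_assoc]
  -- Absorbing the term on the right needs the integral to be finite, which is why the moments are
  -- truncated beforehand.
  have h2 : (1 - a) * ∫⁻ ω, X ω ^ q ∂μ ≤ C * ∫⁻ ω, R ω ^ q ∂μ := by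
    rw [ENNReal.sub_mul fun _ _ => hfin, one_mul]
    exact tsub_le_iff_left.2 hmain
  calc ∫⁻ ω, X ω ^ q ∂μ = (1 - a)⁻¹ * ((1 - a) * ∫⁻ ω, X ω ^ q ∂μ) := by
        rw [← mul_assoc, ENNReal.inv_mul_cancel hsub (ENNReal.sub_ne_top ENNReal.one_ne_top), one_mul]
    _ ≤ (1 - a)⁻¹ * (C * ∫⁻ ω, R ω ^ q ∂μ) := by gcongr
    _ = _ := (mul_assoc _ _ _).symm

section Moments

variable {P : Measure Env}

lemma exists_lintegral_rho_lt_one {p : ℝ} (hp : ENNReal.ofReal p < kappa P) :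
    ∃ p', p < p' ∧ 0 < p' ∧ ∫⁻ ω, rho ω 0 ^ p' ∂P < 1 := by
  simp only [kappa, lt_iSup_iff] at hp
  obtain ⟨p', h0, h1, h2⟩ := hp
  exact ⟨p', (ENNReal.ofReal_lt_ofReal_iff h0).1 h2, h0, h1⟩

/-- By definition of `κ` some exponent beyond `p` has moment below one, and on a probability space
`L^s` norms increase with `s`. -/
lemma IsIID.lintegral_rho_lt_one [IsProbabilityMeasure P] (h : IsIID P) {p : ℝ}
    (hp : ENNReal.ofReal p < kappa P) {s : ℝ}
    (hs0 : 0 < s) (hsp : s ≤ p) (x : ℤ) : ∫⁻ ω, rho ω x ^ s ∂P < 1 := by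
  rw [h.lintegral_rho]
  obtain ⟨p', h1, h2, h3⟩ := exists_lintegral_rho_lt_one hp
  have hle := eLpNorm'_le_eLpNorm'_of_exponent_le (f := fun ω => rho ω 0) (μ := P) hs0
    (hsp.trans h1.le) (measurable_rho 0).aestronglyMeasurable
  simp only [eLpNorm'_eq_lintegral_enorm, enorm_eq_self] at hle
  have hlt : (∫⁻ ω, rho ω 0 ^ p' ∂P) ^ (1 / p') < 1 :=
    ENNReal.rpow_lt_one h3 (by positivity)
  have hlt' := hle.trans_lt hlt
  by_contra hcon
  exact absurd hlt' (not_lt.2 (ENNReal.one_le_rpow (not_lt.1 hcon) (by positivity)))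

/-- A zero of `ω_x` makes `ρ_x` infinite, while some positive moment of `ρ_x` is finite. -/
lemma IsIID.ae_pos (h : IsIID P) (hκ : 0 < kappa P) : ∀ᵐ ω ∂P, ∀ x : ℤ, 0 < (ω x : ℝ) := by
  rw [ae_all_iff]
  intro x
  obtain ⟨p', -, h0, h1⟩ := exists_lintegral_rho_lt_one (P := P) (p := 0) (by simpa using hκ)
  rw [← h.lintegral_rho p' x] at h1
  filter_upwards [ae_lt_top ((measurable_rho x).pow_const p') (h1.trans ENNReal.one_lt_top).ne]
    with ω hω
  refine (ω x).2.1.lt_of_ne fun h0' => ?_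
  have : rho ω x = ⊤ := by
    rw [rho, ← h0']
    simp
  rw [this, ENNReal.top_rpow_of_pos h0] at hω
  exact lt_irrefl _ hω

/-- `truncMoment` with values in `ℝ≥0∞`. -/
noncomputable def eMoment (K r : ℕ) (i : ℤ) (ω : Env) : ℝ≥0∞ := ENNReal.ofReal (truncMoment ω K r i)

lemma measurable_eMoment (K r : ℕ) (i : ℤ) : Measurable (eMoment K r i) :=
  (measurable_truncMoment K r i).ennreal_ofReal

lemma lintegral_eMoment_rpow_ne_top [IsProbabilityMeasure P] (K r : ℕ) (i : ℤ) {q : ℝ} (hq : 0 ≤ q) :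
    ∫⁻ ω, eMoment K r i ω ^ q ∂P ≠ ⊤ := by
  refine ne_top_of_le_ne_top (b := ENNReal.ofReal ((K : ℝ) ^ r) ^ q)
    (ENNReal.rpow_ne_top_of_nonneg hq ENNReal.ofReal_ne_top) ?_
  calc ∫⁻ ω, eMoment K r i ω ^ q ∂P ≤ ∫⁻ _, ENNReal.ofReal ((K : ℝ) ^ r) ^ q ∂P := by
        refine lintegral_mono fun ω => ENNReal.rpow_le_rpow ?_ hq
        exact ENNReal.ofReal_le_ofReal (truncMoment_le ω K r i)
    _ = _ := by simp

lemma IsIID.lintegral_eMoment_succ (h : IsIID P) (K r : ℕ) (i : ℤ) (q : ℝ) :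
    ∫⁻ ω, eMoment K r (i + 1) ω ^ q ∂P = ∫⁻ ω, eMoment K r i ω ^ q ∂P := by
  rw [← h.measurePreserving_shift.lintegral_comp ((measurable_eMoment K r i).pow_const q)]
  simp only [eMoment, truncMoment_shift]

lemma dependsOn_rho (x : ℤ) : DependsOn (fun ω : Env => rho ω x) {x} := by
  intro ω ω' h
  simp only [rho, h x rfl]

lemma dependsOn_eMoment (K r : ℕ) (i : ℤ) : DependsOn (eMoment K r i) (Set.Ioc (i - K) i) := by
  intro ω ω' h
  simp only [eMoment]
  rw [truncMoment_congr K r i fun j h1 h2 => h j ⟨h1, h2⟩]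

lemma eMoment_recursion {ω : Env} (hω : 0 < (ω 0 : ℝ)) (K : ℕ) :
    eMoment K 1 0 ω ≤ rho ω 0 * eMoment K 1 (-1) ω + (1 + rho ω 0) ∧
    eMoment K 2 0 ω ≤ rho ω 0 * eMoment K 2 (-1) ω +
      5 * (1 + rho ω 0) ^ 2 * (1 + eMoment K 1 (-1) ω) ^ 2 ∧
    eMoment K 3 0 ω ≤ rho ω 0 * eMoment K 3 (-1) ω +
      (1 + rho ω 0) ^ 3 * (25 * (1 + eMoment K 1 (-1) ω) ^ 3 +
        9 * ((1 + eMoment K 1 (-1) ω) * (1 + eMoment K 2 (-1) ω))) := by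
  obtain ⟨h1, h2, h3⟩ := truncMoment_recursion hω K
  rw [zero_sub] at h1 h2 h3
  rw [rho_eq_ofReal_odds hω]
  simp only [eMoment]
  have hr := odds_nonneg ω 0
  have n1 := truncMoment_nonneg ω K 1 (-1)
  have n2 := truncMoment_nonneg ω K 2 (-1)
  have n3 := truncMoment_nonneg ω K 3 (-1)
  generalize odds ω 0 = r at *
  generalize truncMoment ω K 1 (-1) = a1 at *
  generalize truncMoment ω K 2 (-1) = a2 at *
  generalize truncMoment ω K 3 (-1) = a3 at *
  have hone : ∀ {t : ℝ}, 0 ≤ t → (1 : ℝ≥0∞) + ENNReal.ofReal t = ENNReal.ofReal (1 + t) :=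
    fun ht => by rw [ENNReal.ofReal_add zero_le_one ht, ENNReal.ofReal_one]
  have e5 : (5 : ℝ≥0∞) = ENNReal.ofReal 5 := by simp
  have e9 : (9 : ℝ≥0∞) = ENNReal.ofReal 9 := by simp
  have e25 : (25 : ℝ≥0∞) = ENNReal.ofReal 25 := by simp
  rw [hone hr, hone n1, hone n2, e5, e9, e25]
  refine ⟨?_, ?_, ?_⟩
  · rw [← ENNReal.ofReal_mul hr, ← ENNReal.ofReal_add (by positivity) (by positivity)]
    exact ENNReal.ofReal_le_ofReal h1
  · rw [← ENNReal.ofReal_mul hr, ← ENNReal.ofReal_pow (by positivity),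
      ← ENNReal.ofReal_pow (by positivity), ← ENNReal.ofReal_mul (by positivity),
      ← ENNReal.ofReal_mul (by positivity), ← ENNReal.ofReal_add (by positivity) (by positivity)]
    exact ENNReal.ofReal_le_ofReal h2
  · rw [← ENNReal.ofReal_mul hr, ← ENNReal.ofReal_pow (by positivity),
      ← ENNReal.ofReal_pow (by positivity), ← ENNReal.ofReal_mul (by positivity),
      ← ENNReal.ofReal_mul (by positivity), ← ENNReal.ofReal_mul (by positivity),
      ← ENNReal.ofReal_add (by positivity) (by positivity),
      ← ENNReal.ofReal_mul (by positivity), ← ENNReal.ofReal_add (by positivity) (by positivity)]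
    exact ENNReal.ofReal_le_ofReal h3

lemma lintegral_one_add_rpow_le [IsProbabilityMeasure P] {q : ℝ} (hq : 0 < q) :
    ∃ C : ℝ≥0∞, C ≠ ⊤ ∧ ∀ f : Env → ℝ≥0∞,
      ∫⁻ ω, (1 + f ω) ^ q ∂P ≤ 2 + C * ∫⁻ ω, f ω ^ q ∂P := by
  obtain ⟨C, hC, h⟩ := ENNReal_add_rpow_le hq one_ne_zero ENNReal.one_ne_top
  refine ⟨C, hC, fun f => ?_⟩
  calc ∫⁻ ω, (1 + f ω) ^ q ∂P ≤ ∫⁻ ω, (2 + C * f ω ^ q) ∂P := by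
        refine lintegral_mono fun ω => (h 1 (f ω)).trans (le_of_eq ?_)
        rw [ENNReal.one_rpow, mul_one, one_add_one_eq_two]
    _ = 2 + C * ∫⁻ ω, f ω ^ q ∂P := by
        rw [lintegral_add_left measurable_const, lintegral_const_mul' _ _ hC]
        simp

/-- The product of a power of `1 + ρ_0` and a function of the environment to the left of `0`. -/
lemma IsIID.lintegral_rho_mul (h : IsIID P) (q : ℝ) {F : Env → ℝ≥0∞} (hF : Measurable F) {S : Set ℤ}
    (hS : DependsOn F S) (h0 : (0 : ℤ) ∉ S) :
    ∫⁻ ω, (1 + rho ω 0) ^ q * F ω ∂P = (∫⁻ ω, (1 + rho ω 0) ^ q ∂P) * ∫⁻ ω, F ω ∂P := by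
  have hm : Measurable fun ω : Env => (1 + rho ω 0) ^ q :=
    ((measurable_rho 0).const_add 1).pow_const q
  refine lintegral_mul_eq_lintegral_mul_lintegral_of_indepFun'' hm.aemeasurable hF.aemeasurable
    (h.indepFun_of_dependsOn hm hF (S := {0}) (T := S) ?_ hS (by simpa using h0))
  intro ω ω' hω
  simp only [rho, hω 0 rfl]

lemma IsIID.indepFun_rho_eMoment (h : IsIID P) (K r : ℕ) :
    IndepFun (fun ω => rho ω 0) (eMoment K r (-1)) P :=
  h.indepFun_of_dependsOn (measurable_rho 0) (measurable_eMoment K r (-1)) (dependsOn_rho 0)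
    (dependsOn_eMoment K r (-1)) (by simp)

lemma dependsOn_eMoment_neg_one (K r : ℕ) :
    DependsOn (eMoment K r (-1)) (Set.Iio (0 : ℤ)) := by
  intro ω ω' h
  refine dependsOn_eMoment K r (-1) fun j hj => h j ?_
  have := hj.2
  simp only [Set.mem_Iio]
  omega

/-- Young's inequality with these exponents, raised to the power `p/3`, leaves `u ^ p` and `w ^
(p/2)`: exactly the orders available for the first and second quenched moments. -/
lemma mul_le_rpow_add_rpow (u w : ℝ≥0∞) : u * w ≤ u ^ (3 : ℝ) + w ^ (3 / 2 : ℝ) := by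
  have hconj : (3 : ℝ).HolderConjugate (3 / 2) := by
    rw [Real.holderConjugate_iff]
    norm_num
  refine (ENNReal.young_inequality u w hconj).trans ?_
  gcongr
  · exact ENNReal.div_le_of_le_mul (le_mul_of_one_le_right zero_le (by simp))
  · refine ENNReal.div_le_of_le_mul (le_mul_of_one_le_right zero_le ?_)
    rw [ENNReal.one_le_ofReal]
    norm_num

/-- Uniform bounds for the annealed moments of the truncated quenched moments. -/
lemma IsIID.eMoment_bound [IsProbabilityMeasure P] (h : IsIID P) {p : ℝ} (hp0 : 0 < p) (hp3 : p ≤ 3)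
    (hp : ENNReal.ofReal p < kappa P) :
    ∃ C : ℝ≥0∞, C ≠ ⊤ ∧ ∀ K, ∫⁻ ω, eMoment K 3 0 ω ^ (p / 3) ∂P ≤ C := by
  have hpos := h.ae_pos (bot_lt_of_lt hp)
  have hstat : ∀ (K r : ℕ) (q : ℝ),
      ∫⁻ ω, eMoment K r (-1) ω ^ q ∂P = ∫⁻ ω, eMoment K r 0 ω ^ q ∂P := fun K r q => by
    have := h.lintegral_eMoment_succ K r (-1) q
    rw [neg_add_cancel] at this
    exact this.symm
  obtain ⟨Cp, hCp, hadd⟩ := lintegral_one_add_rpow_le (P := P) hp0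
  have hρp : ∫⁻ ω, rho ω 0 ^ p ∂P < 1 := h.lintegral_rho_lt_one hp hp0 le_rfl 0
  set V : ℝ≥0∞ := ∫⁻ ω, (1 + rho ω 0) ^ p ∂P with hV
  have hVtop : V ≠ ⊤ := ne_top_of_le_ne_top (ENNReal.add_ne_top.2 ⟨ENNReal.ofNat_ne_top,
    ENNReal.mul_ne_top hCp (hρp.trans ENNReal.one_lt_top).ne⟩) (hadd _)
  -- first moments
  obtain ⟨c1, hc1, hrec1⟩ := lintegral_rpow_le_of_recursion hp0 (measurable_rho 0) hρp
  have hm1 : ∀ K, Measurable fun ω => 1 + eMoment K 1 (-1) ω := fun K =>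
    (measurable_eMoment K 1 (-1)).const_add 1
  have hm2 : ∀ K, Measurable fun ω => 1 + eMoment K 2 (-1) ω := fun K =>
    (measurable_eMoment K 2 (-1)).const_add 1
  have hmr : Measurable fun ω => 1 + rho ω 0 := (measurable_rho 0).const_add 1
  -- The constant `c1` is chosen before the random variables, so the bound is uniform in the
  -- truncation level; likewise for `c2` and `c3`.
  have B1 : ∀ K, ∫⁻ ω, eMoment K 1 0 ω ^ p ∂P ≤ c1 * V := fun K =>
    hrec1 _ _ _ (measurable_eMoment K 1 (-1)) hmr (h.indepFun_rho_eMoment K 1)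
      (by filter_upwards [hpos] with ω hω using (eMoment_recursion (hω 0) K).1)
      (hstat K 1 p) (lintegral_eMoment_rpow_ne_top K 1 0 hp0.le)
  set U1 : ℝ≥0∞ := 2 + Cp * (c1 * V) with hU1
  have hU1top : U1 ≠ ⊤ := ENNReal.add_ne_top.2 ⟨ENNReal.ofNat_ne_top,
    ENNReal.mul_ne_top hCp (ENNReal.mul_ne_top hc1 hVtop)⟩
  have hu : ∀ K, ∫⁻ ω, (1 + eMoment K 1 (-1) ω) ^ p ∂P ≤ U1 := fun K =>
    (hadd _).trans (by rw [hstat, hU1]; gcongr; exact B1 K)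
  -- second moments
  have hp2 : 0 < p / 2 := by positivity
  obtain ⟨c2, hc2, hrec2⟩ := lintegral_rpow_le_of_recursion hp2 (measurable_rho 0)
    (h.lintegral_rho_lt_one hp hp2 (by linarith) 0)
  have hsq : ∀ x : ℝ≥0∞, (x ^ 2) ^ (p / 2) = x ^ p := fun x => by
    rw [← ENNReal.rpow_natCast, ← ENNReal.rpow_mul]
    congr 1
    push_cast
    ring
  have hcb : ∀ x : ℝ≥0∞, (x ^ 3) ^ (p / 3) = x ^ p := fun x => by
    rw [← ENNReal.rpow_natCast, ← ENNReal.rpow_mul]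
    congr 1
    push_cast
    ring
  have hdep1 : ∀ K, DependsOn (fun ω => (1 + eMoment K 1 (-1) ω) ^ p) (Set.Iio (0 : ℤ)) := by
    intro K ω ω' hω
    simp only
    rw [dependsOn_eMoment_neg_one K 1 hω]
  have B2 : ∀ K, ∫⁻ ω, eMoment K 2 0 ω ^ (p / 2) ∂P ≤ c2 * (5 ^ (p / 2) * (V * U1)) := by
    intro K
    refine (hrec2 _ _ (fun ω => 5 * (1 + rho ω 0) ^ 2 * (1 + eMoment K 1 (-1) ω) ^ 2)
      (measurable_eMoment K 2 (-1)) (((hmr.pow_const 2).const_mul 5).mul ((hm1 K).pow_const 2))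
      (h.indepFun_rho_eMoment K 2)
      (by filter_upwards [hpos] with ω hω using (eMoment_recursion (hω 0) K).2.1)
      (hstat K 2 _) (lintegral_eMoment_rpow_ne_top K 2 0 hp2.le)).trans ?_
    gcongr
    simp_rw [ENNReal.mul_rpow_of_nonneg _ _ hp2.le, hsq, mul_assoc]
    rw [lintegral_const_mul' _ _ (ENNReal.rpow_ne_top_of_nonneg hp2.le ENNReal.ofNat_ne_top),
      h.lintegral_rho_mul p ((hm1 K).pow_const p) (hdep1 K) (by simp)]
    gcongr
    exact hu K
  obtain ⟨Cp2, hCp2, hadd2⟩ := lintegral_one_add_rpow_le (P := P) hp2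
  set U2 : ℝ≥0∞ := 2 + Cp2 * (c2 * (5 ^ (p / 2) * (V * U1))) with hU2
  have hU2top : U2 ≠ ⊤ := ENNReal.add_ne_top.2 ⟨ENNReal.ofNat_ne_top, ENNReal.mul_ne_top hCp2
    (ENNReal.mul_ne_top hc2 (ENNReal.mul_ne_top (ENNReal.rpow_ne_top_of_nonneg hp2.le
      ENNReal.ofNat_ne_top) (ENNReal.mul_ne_top hVtop hU1top)))⟩
  have hw : ∀ K, ∫⁻ ω, (1 + eMoment K 2 (-1) ω) ^ (p / 2) ∂P ≤ U2 := fun K =>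
    (hadd2 _).trans (by rw [hstat, hU2]; gcongr; exact B2 K)
  -- third moments
  have hp3' : 0 < p / 3 := by positivity
  obtain ⟨c3, hc3, hrec3⟩ := lintegral_rpow_le_of_recursion hp3' (measurable_rho 0)
    (h.lintegral_rho_lt_one hp hp3' (by linarith) 0)
  refine ⟨c3 * (V * (34 ^ (p / 3) * U1 + 9 ^ (p / 3) * U2)), ?_, fun K => ?_⟩
  · refine ENNReal.mul_ne_top hc3 (ENNReal.mul_ne_top hVtop (ENNReal.add_ne_top.2 ⟨?_, ?_⟩))
    · exact ENNReal.mul_ne_top (ENNReal.rpow_ne_top_of_nonneg hp3'.le ENNReal.ofNat_ne_top) hU1top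
    · exact ENNReal.mul_ne_top (ENNReal.rpow_ne_top_of_nonneg hp3'.le ENNReal.ofNat_ne_top) hU2top
  · refine (hrec3 _ _ (fun ω => (1 + rho ω 0) ^ 3 * (25 * (1 + eMoment K 1 (-1) ω) ^ 3 +
        9 * ((1 + eMoment K 1 (-1) ω) * (1 + eMoment K 2 (-1) ω))))
      (measurable_eMoment K 3 (-1)) ((hmr.pow_const 3).mul
        ((((hm1 K).pow_const 3).const_mul 25).add (((hm1 K).mul (hm2 K)).const_mul 9)))
      (h.indepFun_rho_eMoment K 3)
      (by filter_upwards [hpos] with ω hω using (eMoment_recursion (hω 0) K).2.2)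
      (hstat K 3 _) (lintegral_eMoment_rpow_ne_top K 3 0 hp3'.le)).trans ?_
    gcongr
    -- Here `34 = 25 + 9`, and `p ≤ 3` makes the power `p/3` subadditive. The factor in `v` depends
    -- on the site 0 alone, so it later splits off by independence.
    have hpt : ∀ v u w : ℝ≥0∞, (v ^ 3 * (25 * u ^ 3 + 9 * (u * w))) ^ (p / 3) ≤
        v ^ p * (34 ^ (p / 3) * u ^ p + 9 ^ (p / 3) * w ^ (p / 2)) := by
      intro v u w
      rw [ENNReal.mul_rpow_of_nonneg _ _ hp3'.le, hcb]
      gcongr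
      have h1 : 25 * u ^ 3 + 9 * (u * w) ≤ 34 * u ^ 3 + 9 * w ^ (3 / 2 : ℝ) := by
        have := mul_le_rpow_add_rpow u w
        rw [show (3 : ℝ) = ((3 : ℕ) : ℝ) by norm_num, ENNReal.rpow_natCast] at this
        push_cast at this
        calc 25 * u ^ 3 + 9 * (u * w) ≤ 25 * u ^ 3 + 9 * (u ^ 3 + w ^ (3 / 2 : ℝ)) := by gcongr
          _ = _ := by ring
      refine (ENNReal.rpow_le_rpow h1 hp3'.le).trans
        ((ENNReal.rpow_add_le_add_rpow _ _ hp3'.le (by linarith)).trans (le_of_eq ?_))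
      rw [ENNReal.mul_rpow_of_nonneg _ _ hp3'.le, ENNReal.mul_rpow_of_nonneg _ _ hp3'.le, hcb,
        ← ENNReal.rpow_mul]
      congr 3
      ring
    refine (lintegral_mono fun ω => hpt _ _ _).trans ?_
    have hdep : DependsOn (fun ω => 34 ^ (p / 3) * (1 + eMoment K 1 (-1) ω) ^ p +
        9 ^ (p / 3) * (1 + eMoment K 2 (-1) ω) ^ (p / 2)) (Set.Iio (0 : ℤ)) := by
      intro ω ω' hω
      simp only
      rw [dependsOn_eMoment_neg_one K 1 hω, dependsOn_eMoment_neg_one K 2 hω]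
    have hmeas := (((hm1 K).pow_const p).const_mul (34 ^ (p / 3)))
    have hmeas' : Measurable fun ω => 34 ^ (p / 3) * (1 + eMoment K 1 (-1) ω) ^ p +
        9 ^ (p / 3) * (1 + eMoment K 2 (-1) ω) ^ (p / 2) :=
      hmeas.add (((hm2 K).pow_const (p / 2)).const_mul (9 ^ (p / 3)))
    rw [h.lintegral_rho_mul p hmeas' hdep (by simp), lintegral_add_left hmeas,
      lintegral_const_mul' _ _ (ENNReal.rpow_ne_top_of_nonneg hp3'.le ENNReal.ofNat_ne_top),
      lintegral_const_mul' _ _ (ENNReal.rpow_ne_top_of_nonneg hp3'.le ENNReal.ofNat_ne_top)]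
    gcongr
    · exact hu K
    · exact hw K

end Moments

/-! ### The crossing times are almost surely finite -/

lemma natLaw_antidiagonal_univ {f g : ℕ → ℝ} (hf : ∀ k, 0 ≤ f k) (hg : ∀ k, 0 ≤ g k) :
    natLaw (fun k => ∑ p ∈ Finset.HasAntidiagonal.antidiagonal k, f p.1 * g p.2) Set.univ =
      natLaw f Set.univ * natLaw g Set.univ := by
  rw [← natLaw_conv hf hg, ← lintegral_one, Measure.lintegral_conv measurable_const]
  simp [mul_comm]

lemma crossLaw_univ (ω : Env) (i : ℤ) :
    crossLaw ω i Set.univ = ∑' k, ENNReal.ofReal (hit ω (i + 1) k i) := natLaw_univ _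

lemma crossLaw_univ_le_one (ω : Env) (i : ℤ) : crossLaw ω i Set.univ ≤ 1 := by
  rw [crossLaw_univ, ENNReal.tsum_eq_iSup_nat]
  refine iSup_le fun K => ?_
  rw [← ENNReal.ofReal_sum_of_nonneg fun k _ => hit_nonneg .., ← ENNReal.ofReal_one]
  exact ENNReal.ofReal_le_ofReal (sum_hit_le_one ..)

lemma crossLaw_univ_eq (ω : Env) (i : ℤ) : crossLaw ω i Set.univ = ENNReal.ofReal (ω i) +
    ENNReal.ofReal (1 - ω i) * (crossLaw ω (i - 1) Set.univ * crossLaw ω i Set.univ) := by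
  have h0 := (ω i).2.1
  have h1 : 0 ≤ 1 - (ω i : ℝ) := sub_nonneg.2 (ω i).2.2
  have hprod := natLaw_antidiagonal_univ (f := fun k => hit ω (i - 1 + 1) k (i - 1))
    (g := fun k => hit ω (i + 1) k i) (fun k => hit_nonneg ..) fun k => hit_nonneg ..
  rw [natLaw_univ] at hprod
  calc crossLaw ω i Set.univ = ∑' k, ENNReal.ofReal (hit ω (i + 1) (k + 1) i) := by
        rw [crossLaw_univ, tsum_eq_zero_add' ENNReal.summable, hit_zero, if_neg (by omega),
          ENNReal.ofReal_zero, zero_add]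
    _ = ∑' k, (ENNReal.ofReal (ω i) * ENNReal.ofReal (hit ω (i + 1) k (i + 1)) +
          ENNReal.ofReal (1 - ω i) * ENNReal.ofReal (∑ p ∈ Finset.HasAntidiagonal.antidiagonal k,
            hit ω (i - 1 + 1) p.1 (i - 1) * hit ω (i + 1) p.2 i)) := by
        refine tsum_congr fun k => ?_
        have hs : 0 ≤ ∑ p ∈ Finset.HasAntidiagonal.antidiagonal k,
            hit ω (i - 1 + 1) p.1 (i - 1) * hit ω (i + 1) p.2 i :=
          Finset.sum_nonneg fun p _ => mul_nonneg (hit_nonneg ..) (hit_nonneg ..)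
        rw [hit_cross_succ, ENNReal.ofReal_add (mul_nonneg h0 (hit_nonneg ..)) (mul_nonneg h1 hs),
          ENNReal.ofReal_mul h0, ENNReal.ofReal_mul h1]
    _ = _ := by
        rw [ENNReal.tsum_add, ENNReal.tsum_mul_left, ENNReal.tsum_mul_left, hprod,
          tsum_eq_single 0]
        · simp [hit_zero, crossLaw]
        · intro k hk
          obtain ⟨k, rfl⟩ := Nat.exists_eq_succ_of_ne_zero hk
          simp [hit_succ_self]

/-- The probability that the walk started at `i` never reaches `i + 1`. -/
noncomputable def defect (i : ℤ) (ω : Env) : ℝ≥0∞ := 1 - crossLaw ω i Set.univ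

/-- With `s`, `t` the crossing probabilities at `i` and `i - 1`, the identity `s = ω + (1 - ω) t s`
gives `ω (1 - s) = (1 - ω)(1 - t) - (1 - ω)(1 - s)(1 - t)`; drop the last term. -/
lemma defect_le {ω : Env} {i : ℤ} (hω : 0 < (ω i : ℝ)) :
    defect i ω ≤ rho ω i * defect (i - 1) ω := by
  have key : ∀ j, ∃ s : ℝ, 0 ≤ s ∧ s ≤ 1 ∧ crossLaw ω j Set.univ = ENNReal.ofReal s := fun j =>
    ⟨_, ENNReal.toReal_nonneg, ENNReal.toReal_le_of_le_ofReal zero_le_one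
      (by simpa using crossLaw_univ_le_one ω j),
      (ENNReal.ofReal_toReal (ne_top_of_le_ne_top ENNReal.one_ne_top
        (crossLaw_univ_le_one ω j))).symm⟩
  obtain ⟨s, hs0, hs1, hs⟩ := key i
  obtain ⟨t, ht0, ht1, ht⟩ := key (i - 1)
  have h0 := (ω i).2.1
  have h1 : 0 ≤ 1 - (ω i : ℝ) := sub_nonneg.2 (ω i).2.2
  have heq := crossLaw_univ_eq ω i
  rw [hs, ht, ← ENNReal.ofReal_mul ht0, ← ENNReal.ofReal_mul h1,
    ← ENNReal.ofReal_add h0 (by positivity),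
    ENNReal.ofReal_eq_ofReal_iff hs0 (by positivity)] at heq
  rw [defect, defect, hs, ht, rho_eq_ofReal_odds hω, ← ENNReal.ofReal_one,
    ← ENNReal.ofReal_sub _ hs0, ← ENNReal.ofReal_sub _ ht0, ← ENNReal.ofReal_mul (odds_nonneg ω i)]
  refine ENNReal.ofReal_le_ofReal ?_
  rw [odds, div_mul_eq_mul_div, le_div_iff₀ hω]
  have : 0 ≤ (1 - (ω i : ℝ)) * ((1 - s) * (1 - t)) :=
    mul_nonneg h1 (mul_nonneg (by linarith) (by linarith))
  nlinarith

lemma measurable_defect (i : ℤ) : Measurable (defect i) := by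
  have : Measurable fun ω => crossLaw ω i Set.univ := by
    simp only [crossLaw_univ]
    exact Measurable.tsum fun k => (measurable_hit (i + 1) k i).ennreal_ofReal
  exact this.const_sub 1

lemma defect_shift (ω : Env) (i : ℤ) : defect i (shift ω) = defect (i + 1) ω := by
  simp only [defect, crossLaw_univ, hit_shift]

lemma dependsOn_defect (i : ℤ) : DependsOn (defect i) (Set.Iic i) := by
  intro ω ω' h
  simp only [defect, crossLaw_univ]
  congr 1
  refine tsum_congr fun k => ?_
  rw [hit_congr k (by omega) fun j _ h2 => h j (by simp only [Set.mem_Iic]; omega)]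

section

variable {P : Measure Env}

lemma ae_iterate_shift (h : IsIID P) {p : Env → Prop} (hp : ∀ᵐ ω ∂P, p ω) :
    ∀ᵐ ω ∂P, ∀ n : ℕ, p (shift^[n] ω) := by
  rw [ae_all_iff]
  exact fun n => (h.measurePreserving_shift.iterate n).quasiMeasurePreserving.ae hp

lemma IsIID.ae_isProbabilityMeasure_crossLaw [IsProbabilityMeasure P] (h : IsIID P)
    (hκ : 1 < kappa P) : ∀ᵐ ω ∂P, ∀ i : ℕ, IsProbabilityMeasure (crossLaw ω i) := by
  have hrho : ∫⁻ ω, rho ω 0 ^ (1 : ℝ) ∂P < 1 :=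
    h.lintegral_rho_lt_one (p := 1) (by simpa using hκ) zero_lt_one le_rfl 0
  obtain ⟨C, hC, hrec⟩ := lintegral_rpow_le_of_recursion zero_lt_one (measurable_rho 0) hrho
  have hstat : ∫⁻ ω, defect (-1) ω ^ (1 : ℝ) ∂P = ∫⁻ ω, defect 0 ω ^ (1 : ℝ) ∂P := by
    rw [← h.measurePreserving_shift.lintegral_comp ((measurable_defect (-1)).pow_const 1)]
    simp only [defect_shift, neg_add_cancel]
  have hind : IndepFun (fun ω => rho ω 0) (defect (-1)) P :=
    h.indepFun_of_dependsOn (measurable_rho 0) (measurable_defect (-1)) (dependsOn_rho 0)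
      (dependsOn_defect (-1)) (by simp)
  have hle : ∀ ω, defect 0 ω ≤ 1 := fun ω => tsub_le_self
  -- The moment recursion with zero inhomogeneity forces the bounded stationary defect to have
  -- expectation zero.
  have hzero := hrec (defect 0) (defect (-1)) 0 (measurable_defect (-1)) measurable_const hind
    (by
      filter_upwards [h.ae_pos (zero_lt_one.trans hκ)] with ω hω
      simpa using defect_le (hω 0)) hstat
    (by
      refine ne_top_of_le_ne_top ENNReal.one_ne_top ?_
      calc ∫⁻ ω, defect 0 ω ^ (1 : ℝ) ∂P ≤ ∫⁻ _, 1 ∂P :=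
            lintegral_mono fun ω => by rw [ENNReal.rpow_one]; exact hle ω
        _ = 1 := by simp)
  simp only [Pi.zero_apply, ENNReal.rpow_one, lintegral_zero, mul_zero, nonpos_iff_eq_zero]
    at hzero
  rw [lintegral_eq_zero_iff (measurable_defect 0)] at hzero
  filter_upwards [ae_iterate_shift h hzero] with ω hω i
  have h1 : crossLaw (shift^[i] ω) 0 Set.univ = crossLaw ω i Set.univ := by
    have : ∀ n : ℕ, ∀ j, crossLaw (shift^[n] ω) j Set.univ = crossLaw ω (j + n) Set.univ := by
      intro n
      induction n with
      | zero => simp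
      | succ n ih =>
        intro j
        have e : crossLaw (shift (shift^[n] ω)) j Set.univ =
            crossLaw (shift^[n] ω) (j + 1) Set.univ := by
          simp only [crossLaw_univ, hit_shift]
        rw [Function.iterate_succ_apply', e, ih]
        congr 2
        push_cast
        ring
    simpa using this i 0
  have h2 : defect 0 (shift^[i] ω) = 0 := hω i
  rw [defect, tsub_eq_zero_iff_le, h1] at h2
  exact ⟨le_antisymm (crossLaw_univ_le_one ω i) h2⟩

end

/-! ### Third moments and variances of the crossing times -/

/-- The quenched third moment of the crossing time from `i` to `i + 1`. -/
noncomputable def crossThird (i : ℤ) (ω : Env) : ℝ≥0∞ :=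
  ∑' k : ℕ, ENNReal.ofReal ((k : ℝ) ^ 3 * hit ω (i + 1) k i)

lemma tendsto_eMoment_crossThird (i : ℤ) (ω : Env) :
    Tendsto (fun K => eMoment K 3 i ω) atTop (𝓝 (crossThird i ω)) := by
  have h := ENNReal.tendsto_nat_tsum fun k : ℕ => ENNReal.ofReal ((k : ℝ) ^ 3 * hit ω (i + 1) k i)
  refine h.congr fun K => ?_
  rw [eMoment, truncMoment, ENNReal.ofReal_sum_of_nonneg fun k _ =>
    mul_nonneg (by positivity) (hit_nonneg ..)]

lemma measurable_crossThird (i : ℤ) : Measurable (crossThird i) :=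
  Measurable.tsum fun k => ((measurable_hit (i + 1) k i).const_mul _).ennreal_ofReal

lemma crossThird_shift (ω : Env) (i : ℤ) : crossThird i (shift ω) = crossThird (i + 1) ω := by
  simp only [crossThird, hit_shift]

lemma crossThird_iterate_shift (ω : Env) (n : ℕ) (i : ℤ) :
    crossThird i (shift^[n] ω) = crossThird (i + n) ω := by
  induction n generalizing i with
  | zero => simp
  | succ n ih =>
    rw [Function.iterate_succ_apply', crossThird_shift, ih]
    congr 1
    push_cast
    ring

/-- Fatou's lemma removes the truncation from the uniform bounds. -/
lemma IsIID.crossThird_bound {P : Measure Env} [IsProbabilityMeasure P] (h : IsIID P) {p : ℝ}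
    (hp0 : 0 < p) (hp3 : p ≤ 3) (hp : ENNReal.ofReal p < kappa P) :
    ∫⁻ ω, crossThird 0 ω ^ (p / 3) ∂P ≠ ⊤ := by
  obtain ⟨C, hC, hbd⟩ := h.eMoment_bound hp0 hp3 hp
  refine ne_top_of_le_ne_top hC ?_
  calc ∫⁻ ω, crossThird 0 ω ^ (p / 3) ∂P
      = ∫⁻ ω, liminf (fun K => eMoment K 3 0 ω ^ (p / 3)) atTop ∂P := by
        refine lintegral_congr fun ω => ?_
        exact (((tendsto_eMoment_crossThird 0 ω).ennrpow_const (p / 3)).liminf_eq).symm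
    _ ≤ liminf (fun K => ∫⁻ ω, eMoment K 3 0 ω ^ (p / 3) ∂P) atTop :=
        lintegral_liminf_le fun K => (measurable_eMoment K 3 0).pow_const _
    _ ≤ C := by
        refine liminf_le_of_frequently_le' (Frequently.of_forall hbd)

lemma lintegral_crossLaw_cube (ω : Env) (i : ℤ) :
    ∫⁻ x, ‖x‖ₑ ^ (3 : ℝ) ∂(crossLaw ω i) = crossThird i ω := by
  rw [crossLaw, lintegral_natLaw]
  refine tsum_congr fun k => ?_
  rw [mul_comm, ENNReal.ofReal_mul (by positivity), Real.enorm_eq_ofReal (Nat.cast_nonneg k),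
    ENNReal.ofReal_rpow_of_nonneg (Nat.cast_nonneg k) (by norm_num)]
  norm_cast

lemma memLp_crossLaw {ω : Env} {i : ℤ} (h : crossThird i ω ≠ ⊤) : MemLp id 3 (crossLaw ω i) := by
  refine ⟨aestronglyMeasurable_id, ?_⟩
  rw [eLpNorm_lt_top_iff_lintegral_rpow_enorm_lt_top (by norm_num) (by norm_num)]
  simp only [ENNReal.toReal_ofNat, id]
  rw [lintegral_crossLaw_cube]
  exact h.lt_top

lemma ae_natLaw {f : ℕ → ℝ} {p : ℝ → Prop} (hp : MeasurableSet {x | p x})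
    (h : ∀ k : ℕ, f k ≠ 0 → p k) : ∀ᵐ x ∂(natLaw f), p x := by
  rw [ae_iff]
  have hm : MeasurableSet {x | ¬ p x} := hp.compl
  rw [← lintegral_indicator_one hm, lintegral_natLaw, ENNReal.tsum_eq_zero]
  intro k
  by_cases hk : f k = 0
  · simp [hk]
  · rw [Set.indicator_of_notMem (s := {x | ¬ p x}) (fun hn => hn (h k hk)), mul_zero]

/-- A crossing takes at least one step. The gap between 1 and 2 is what the variance bound exploits.
-/
lemma ae_crossLaw_one_le (ω : Env) (i : ℤ) :
    ∀ᵐ x ∂(crossLaw ω i), x = 1 ∨ 2 ≤ x := by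
  refine ae_natLaw ((measurableSet_singleton (1 : ℝ)).union measurableSet_Ici) fun k hk => ?_
  rcases k with _ | _ | k
  · exact absurd (by rw [hit_zero, if_neg (by omega)]) hk
  · left
    simp
  · right
    push_cast
    linarith [(Nat.cast_nonneg k : (0 : ℝ) ≤ k)]

/-- For a nonnegative variable with mean `m`, `|x - m|³ ≤ x³ + m³`, and `m³` is at most the third
moment. -/
lemma integral_abs_sub_mean_cube_le {ω : Env} {i : ℤ} [IsProbabilityMeasure (crossLaw ω i)]
    (h : crossThird i ω ≠ ⊤) :
    ∫ x, |x - ∫ y, y ∂(crossLaw ω i)| ^ 3 ∂(crossLaw ω i) ≤ 2 * (crossThird i ω).toReal := by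
  have h3 := memLp_crossLaw h
  have h2 : MemLp id 2 (crossLaw ω i) := h3.mono_exponent (by norm_num)
  set m := ∫ y, y ∂(crossLaw ω i) with hm
  have hpos : ∀ᵐ x ∂(crossLaw ω i), 0 ≤ x := by
    filter_upwards [ae_crossLaw_one_le ω i] with x hx
    rcases hx with rfl | hx <;> linarith
  have hm0 : 0 ≤ m := integral_nonneg_of_ae hpos
  have i3 : Integrable (fun x : ℝ => |x| ^ 3) (crossLaw ω i) := integrable_abs_pow h3 le_rfl
  have hthird : ∫ x, |x| ^ 3 ∂(crossLaw ω i) = (crossThird i ω).toReal := by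
    rw [← lintegral_crossLaw_cube, integral_eq_lintegral_of_nonneg_ae
      (ae_of_all _ fun x => by positivity) i3.aestronglyMeasurable]
    congr 1
    refine lintegral_congr fun x => ?_
    rw [Real.enorm_eq_ofReal_abs, ENNReal.ofReal_rpow_of_nonneg (abs_nonneg x) (by norm_num)]
    norm_cast
  have hm3 : m ^ 3 ≤ ∫ x, |x| ^ 3 ∂(crossLaw ω i) := by
    have h1 := integral_abs_mul_integral_sq_le h3
    simp only [id] at h1
    have habs : ∫ x, |x| ∂(crossLaw ω i) = m := by
      refine integral_congr_ae ?_
      filter_upwards [hpos] with x hx using abs_of_nonneg hx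
    have hv := variance_nonneg id (crossLaw ω i)
    rw [variance_eq_sub h2] at hv
    simp only [Pi.pow_apply, id, ← hm] at hv
    rw [habs] at h1
    calc m ^ 3 = m * m ^ 2 := by ring
      _ ≤ m * ∫ x, x ^ 2 ∂(crossLaw ω i) := by gcongr; linarith
      _ ≤ _ := h1
  calc ∫ x, |x - m| ^ 3 ∂(crossLaw ω i) ≤ ∫ x, (|x| ^ 3 + m ^ 3) ∂(crossLaw ω i) := by
        refine integral_mono_of_nonneg (ae_of_all _ fun x => by positivity)
          (i3.add (integrable_const _)) ?_
        filter_upwards [hpos] with x hx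
        rw [abs_of_nonneg hx]
        rcases le_total x m with hxm | hxm
        · rw [abs_of_nonpos (by linarith)]
          have : (-(x - m)) ^ 3 ≤ m ^ 3 := pow_le_pow_left₀ (by linarith) (by linarith) 3
          linarith [pow_nonneg hx 3]
        · rw [abs_of_nonneg (by linarith)]
          have : (x - m) ^ 3 ≤ x ^ 3 := pow_le_pow_left₀ (by linarith) (by linarith) 3
          linarith [pow_nonneg hm0 3]
    _ = ∫ x, |x| ^ 3 ∂(crossLaw ω i) + m ^ 3 := by
        rw [integral_add i3 (integrable_const _)]
        simp
    _ ≤ _ := by linarith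

lemma crossLaw_real_one (ω : Env) (i : ℤ) : (crossLaw ω i).real {1} = ω i := by
  have h : crossLaw ω i {1} = ENNReal.ofReal (ω i) := by
    rw [← lintegral_indicator_one (measurableSet_singleton _), crossLaw, lintegral_natLaw,
      tsum_eq_single 1]
    · rw [hit_succ ω (by omega), hit_zero, hit_zero, if_pos rfl, if_neg (by omega)]
      simp
    · intro k hk
      rw [Set.indicator_of_notMem, mul_zero]
      simpa using hk
  rw [Measure.real, h, ENNReal.toReal_ofReal (ω i).2.1]

/-- Let `g` be the indicator of crossing in one step, of mean `w`. Since `x + g x ≥ 2`, the mean `m`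
of the crossing time is at least `2 - w`, so the covariance `(1 - m) w` is at most `-w (1 - w)`.
Nonnegativity of the variance of `x + g x` then gives the bound. -/
lemma mul_one_sub_le_variance {ω : Env} {i : ℤ} [IsProbabilityMeasure (crossLaw ω i)]
    (h2 : MemLp id 2 (crossLaw ω i)) :
    (ω i : ℝ) * (1 - ω i) ≤ Var[id; crossLaw ω i] := by
  set μ := crossLaw ω i with hμ
  set w : ℝ := (ω i : ℝ) with hw
  set g : ℝ → ℝ := Set.indicator {1} 1 with hg
  have hgm : Measurable g := measurable_one.indicator (measurableSet_singleton _)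
  have hg1 : ∀ x, |g x| ≤ 1 := fun x => by
    simp only [hg, Set.indicator_apply]
    split_ifs <;> simp
  have hgi : Integrable g μ := (integrable_const (1 : ℝ)).indicator (measurableSet_singleton _)
  have hgint : ∫ x, g x ∂μ = w := by
    rw [integral_indicator_one (measurableSet_singleton _), crossLaw_real_one]
  have hi : Integrable (fun x : ℝ => x) μ := h2.integrable (by norm_num)
  set m := ∫ x, x ∂μ with hm
  have hmw : 2 ≤ m + w := by
    rw [← hgint, hm, ← integral_add hi hgi]
    have : ∫ _, (2 : ℝ) ∂μ ≤ ∫ x, (x + g x) ∂μ := by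
      refine integral_mono_ae (integrable_const _) (hi.add hgi) ?_
      filter_upwards [ae_crossLaw_one_le ω i] with x hx
      simp only [hg, Set.indicator_apply, Set.mem_singleton_iff, Pi.one_apply]
      rcases hx with rfl | hx
      · norm_num
      · split_ifs <;> linarith
    simpa using this
  have hxm : MemLp (fun x : ℝ => x - m) 2 μ := h2.sub (memLp_const m)
  have hgw : MemLp (fun x : ℝ => g x - w) 2 μ :=
    (MemLp.of_bound hgm.aestronglyMeasurable 1 (ae_of_all _ hg1)).sub (memLp_const w)
  have hvar : Var[id; μ] = ∫ x, (x - m) ^ 2 ∂μ := by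
    rw [variance_eq_integral aemeasurable_id]
    rfl
  have ia : Integrable (fun x : ℝ => (x - m) ^ 2) μ := hxm.integrable_sq
  have ib : Integrable (fun x : ℝ => (x - m) * g x) μ :=
    (hxm.integrable (by norm_num)).mul_bdd hgm.aestronglyMeasurable (ae_of_all _ hg1)
  have eb : ∫ x, (x - m) * g x ∂μ = (1 - m) * w := by
    rw [← hgint, ← integral_const_mul]
    congr 1
    ext x
    simp only [hg, Set.indicator_apply, Set.mem_singleton_iff]
    split_ifs with hx
    · rw [hx]
    · simp
  have hsq : ∀ x, ((x - m) + (g x - w)) ^ 2 =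
      (x - m) ^ 2 + 2 * ((x - m) * g x) + ((1 - 2 * w) * g x + w ^ 2 - 2 * w * (x - m)) := by
    intro x
    have : g x ^ 2 = g x := by
      simp only [hg, Set.indicator_apply]
      split_ifs <;> simp
    linear_combination this
  have h0 : 0 ≤ ∫ x, ((x - m) + (g x - w)) ^ 2 ∂μ := integral_nonneg fun x => sq_nonneg _
  simp_rw [hsq] at h0
  have ic : Integrable (fun x : ℝ => (1 - 2 * w) * g x + w ^ 2) μ :=
    (hgi.const_mul _).add (integrable_const _)
  have id' : Integrable (fun x : ℝ => 2 * w * (x - m)) μ :=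
    (hxm.integrable (by norm_num)).const_mul _
  have iab : Integrable (fun x : ℝ => (x - m) ^ 2 + 2 * ((x - m) * g x)) μ :=
    ia.add (ib.const_mul 2)
  have icd : Integrable (fun x : ℝ => (1 - 2 * w) * g x + w ^ 2 - 2 * w * (x - m)) μ := ic.sub id'
  have hz : ∫ x, (x - m) ∂μ = 0 := by
    rw [integral_sub hi (integrable_const _), ← hm]
    simp
  rw [integral_add iab icd, integral_add ia (ib.const_mul 2), integral_const_mul, eb,
    integral_sub ic id', integral_add (hgi.const_mul _) (integrable_const _), integral_const_mul,
    integral_const_mul, hgint, hz, ← hvar] at h0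
  simp only [integral_const, probReal_univ, smul_eq_mul, one_mul, mul_zero, sub_zero] at h0
  have hw0 : 0 ≤ w := (ω i).2.1
  nlinarith

/-! ### The maximal ergodic inequality -/

section Maximal

variable {Ω : Type*} {mΩ : MeasurableSpace Ω} {μ : Measure Ω}

/-- The maximum of `0` and of the first `N` Birkhoff sums of `f`. -/
noncomputable def birkhoffMax (T : Ω → Ω) (f : Ω → ℝ) : ℕ → Ω → ℝ
  | 0, _ => 0
  | N + 1, ω => max 0 (f ω + birkhoffMax T f N (T ω))

lemma birkhoffMax_nonneg (T : Ω → Ω) (f : Ω → ℝ) (N : ℕ) (ω : Ω) : 0 ≤ birkhoffMax T f N ω := by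
  cases N with
  | zero => exact le_rfl
  | succ N => exact le_max_left _ _

lemma birkhoffMax_le_succ (T : Ω → Ω) (f : Ω → ℝ) (N : ℕ) (ω : Ω) :
    birkhoffMax T f N ω ≤ birkhoffMax T f (N + 1) ω := by
  induction N generalizing ω with
  | zero => exact birkhoffMax_nonneg ..
  | succ N ih => exact max_le_max le_rfl (by linarith [ih (T ω)])

lemma birkhoffMax_mono (T : Ω → Ω) (f : Ω → ℝ) (ω : Ω) : Monotone fun N => birkhoffMax T f N ω :=
  monotone_nat_of_le_succ fun N => birkhoffMax_le_succ T f N ω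

lemma birkhoffSum_le_birkhoffMax (T : Ω → Ω) (f : Ω → ℝ) (n : ℕ) (ω : Ω) :
    birkhoffSum T f n ω ≤ birkhoffMax T f n ω := by
  induction n generalizing ω with
  | zero => simp [birkhoffMax]
  | succ n ih =>
    rw [birkhoffSum_succ']
    exact (add_le_add le_rfl (ih (T ω))).trans (le_max_right _ _)

lemma measurable_birkhoffMax {T : Ω → Ω} (hT : Measurable T) {f : Ω → ℝ} (hf : Measurable f)
    (N : ℕ) : Measurable (birkhoffMax T f N) := by
  induction N with
  | zero => exact measurable_const
  | succ N ih => exact measurable_const.max (hf.add (ih.comp hT))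

lemma integrable_birkhoffMax {T : Ω → Ω} (hT : MeasurePreserving T μ μ) {f : Ω → ℝ}
    (hf : Integrable f μ) (N : ℕ) : Integrable (birkhoffMax T f N) μ := by
  induction N with
  | zero => exact integrable_zero _ _ _
  | succ N ih => exact (integrable_zero _ _ _).sup (hf.add (hT.integrable_comp_of_integrable ih))

/-- Garsia's maximal ergodic lemma. -/
lemma setIntegral_birkhoffMax_nonneg {T : Ω → Ω} (hT : MeasurePreserving T μ μ) {f : Ω → ℝ}
    (hfm : Measurable f) (hf : Integrable f μ) (N : ℕ) :
    0 ≤ ∫ ω in {ω | 0 < birkhoffMax T f N ω}, f ω ∂μ := by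
  set M := birkhoffMax T f N with hM
  have hMm : Measurable M := measurable_birkhoffMax hT.measurable hfm N
  have hMi : Integrable M μ := integrable_birkhoffMax hT hf N
  have hMT : Integrable (fun ω => M (T ω)) μ := hT.integrable_comp_of_integrable hMi
  have hE : MeasurableSet {ω | 0 < M ω} := measurableSet_lt measurable_const hMm
  -- Where the maximum is positive it equals `f` plus a shorter maximum at `T ω`. Integrating
  -- cancels the left side by invariance.
  have hle : ∀ ω, M ω - M (T ω) ≤ Set.indicator {ω | 0 < M ω} f ω := by
    intro ω
    simp only [Set.indicator_apply, Set.mem_ofPred_eq]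
    split_ifs with h
    · cases N with
      | zero => exact absurd h (lt_irrefl _)
      | succ N =>
        have h1 : M ω = f ω + birkhoffMax T f N (T ω) := by
          have : M ω = max 0 (f ω + birkhoffMax T f N (T ω)) := rfl
          rw [this] at h ⊢
          exact max_eq_right (by
            rcases lt_max_iff.1 h with h' | h'
            · exact absurd h' (lt_irrefl _)
            · exact h'.le)
        have h2 := birkhoffMax_le_succ T f N (T ω)
        linarith
    · have := birkhoffMax_nonneg T f N (T ω)
      linarith
  have hint : ∫ ω, M (T ω) ∂μ = ∫ ω, M ω ∂μ := by
    conv_rhs => rw [← hT.map_eq]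
    rw [integral_map hT.measurable.aemeasurable hMm.aestronglyMeasurable]
  calc (0 : ℝ) = ∫ ω, (M ω - M (T ω)) ∂μ := by rw [integral_sub hMi hMT, hint, sub_self]
    _ ≤ ∫ ω, Set.indicator {ω | 0 < M ω} f ω ∂μ :=
        integral_mono (hMi.sub hMT) (hf.indicator hE) hle
    _ = _ := integral_indicator hE

/-- The maximal ergodic inequality. -/
lemma measure_exists_lt_birkhoffSum_le [IsFiniteMeasure μ] {T : Ω → Ω}
    (hT : MeasurePreserving T μ μ) {g : Ω → ℝ} (hgm : Measurable g) (hg : Integrable g μ) :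
    μ {ω | ∃ n : ℕ, (n : ℝ) < birkhoffSum T g n ω} ≤ ENNReal.ofReal (∫ ω, |g ω| ∂μ) := by
  -- A Birkhoff sum of `g` exceeds `n` exactly when the one of `g - 1` is positive.
  set f : Ω → ℝ := fun ω => g ω - 1 with hf
  have hfm : Measurable f := hgm.sub_const 1
  have hfi : Integrable f μ := hg.sub (integrable_const 1)
  have hsum : ∀ n ω, birkhoffSum T f n ω = birkhoffSum T g n ω - n := by
    intro n ω
    simp [birkhoffSum, hf, Finset.sum_sub_distrib]
  set E : ℕ → Set Ω := fun N => {ω | 0 < birkhoffMax T f N ω} with hE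
  have hEm : ∀ N, MeasurableSet (E N) := fun N =>
    measurableSet_lt measurable_const (measurable_birkhoffMax hT.measurable hfm N)
  have hsub : {ω | ∃ n : ℕ, (n : ℝ) < birkhoffSum T g n ω} ⊆ ⋃ N, E N := by
    rintro ω ⟨n, hn⟩
    refine Set.mem_iUnion.2 ⟨n, ?_⟩
    have := birkhoffSum_le_birkhoffMax T f n ω
    rw [hsum] at this
    change 0 < birkhoffMax T f n ω
    linarith
  have hmono : Monotone E := fun N N' h ω hω =>
    lt_of_lt_of_le (show 0 < birkhoffMax T f N ω from hω) (birkhoffMax_mono T f ω h)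
  refine (measure_mono hsub).trans ?_
  rw [hmono.measure_iUnion]
  refine iSup_le fun N => ?_
  have h0 := setIntegral_birkhoffMax_nonneg hT hfm hfi N
  have h1 : ∫ ω in E N, f ω ∂μ = ∫ ω in E N, g ω ∂μ - μ.real (E N) := by
    rw [integral_sub hg.integrableOn (integrable_const (1 : ℝ)).integrableOn]
    simp
  have h2 : ∫ ω in E N, g ω ∂μ ≤ ∫ ω, |g ω| ∂μ :=
    (setIntegral_mono hg.integrableOn hg.abs.integrableOn fun ω => le_abs_self _).trans
      (setIntegral_le_integral hg.abs (ae_of_all _ fun _ => abs_nonneg _))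
  rw [← ENNReal.ofReal_toReal (measure_ne_top μ (E N))]
  refine ENNReal.ofReal_le_ofReal ?_
  change μ.real (E N) ≤ _
  have h0' : 0 ≤ ∫ ω in E N, f ω ∂μ := h0
  linarith

end Maximal

/-! ### Sums of stationary sequences -/

section Sums

variable {P : Measure Env}

lemma sum_range_mul_eq (x : ℕ → ℝ) (d J : ℕ) :
    ∑ i ∈ Finset.range (d * J), x i =
      ∑ r ∈ Finset.range d, ∑ j ∈ Finset.range J, x (d * j + r) := by
  induction J with
  | zero => simp
  | succ J ih =>
    rw [Nat.mul_succ, Finset.sum_range_add, ih, ← Finset.sum_add_distrib]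
    exact Finset.sum_congr rfl fun r _ => (Finset.sum_range_succ _ _).symm

lemma eventually_sum_le_of_residues {x : ℕ → ℝ} (hx : ∀ i, 0 ≤ x i) {d : ℕ} (hd : 0 < d) {m : ℝ}
    (hm : 0 ≤ m) (h : ∀ r < d, Tendsto (fun J : ℕ => (∑ j ∈ Finset.range J, x (d * j + r)) / J)
      atTop (𝓝 m)) :
    ∀ᶠ n : ℕ in atTop, ∑ i ∈ Finset.range n, x i ≤ (m + 2) * n := by
  have h1 : ∀ᶠ J : ℕ in atTop, ∀ r ∈ Finset.range d,
      ∑ j ∈ Finset.range J, x (d * j + r) ≤ (m + 1) * J := by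
    rw [Filter.eventually_all_finset]
    intro r hr
    filter_upwards [(h r (Finset.mem_range.1 hr)).eventually (gt_mem_nhds (lt_add_one m)),
      eventually_gt_atTop 0] with J hJ hJ0
    rw [div_lt_iff₀ (by exact_mod_cast hJ0)] at hJ
    exact hJ.le
  -- Round `n` up to a multiple of `d`; the excess `(m + 1) d` is eventually at most `n`, which
  -- accounts for the second unit in `m + 2`.
  have ht : Tendsto (fun n : ℕ => n / d + 1) atTop atTop :=
    (tendsto_add_atTop_nat 1).comp (Nat.tendsto_div_const_atTop hd.ne')
  filter_upwards [ht.eventually h1, eventually_ge_atTop ⌈(m + 1) * d⌉₊] with n hn hn'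
  have hn'' : (m + 1) * d ≤ n := Nat.ceil_le.1 hn'
  have hlt : n ≤ d * (n / d + 1) := (Nat.lt_mul_div_succ n hd).le
  calc ∑ i ∈ Finset.range n, x i ≤ ∑ i ∈ Finset.range (d * (n / d + 1)), x i :=
        Finset.sum_le_sum_of_subset_of_nonneg (Finset.range_mono hlt) fun i _ _ => hx i
    _ ≤ ∑ r ∈ Finset.range d, (m + 1) * ((n / d + 1 : ℕ) : ℝ) := by
        rw [sum_range_mul_eq]
        exact Finset.sum_le_sum hn
    _ = (m + 1) * (d * ((n / d : ℕ) : ℝ)) + (m + 1) * d := by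
        rw [Finset.sum_const, Finset.card_range, nsmul_eq_mul]
        push_cast
        ring
    _ ≤ (m + 1) * n + n := by
        have : (d : ℝ) * ((n / d : ℕ) : ℝ) ≤ n := by exact_mod_cast Nat.mul_div_le n d
        gcongr
    _ = (m + 2) * n := by ring

lemma truncMoment_iterate_shift (ω : Env) (K r n : ℕ) (i : ℤ) :
    truncMoment (shift^[n] ω) K r i = truncMoment ω K r (i + n) := by
  induction n generalizing i with
  | zero => simp
  | succ n ih =>
    rw [Function.iterate_succ_apply', truncMoment_shift, ih]
    congr 1
    push_cast
    ring

lemma identDistrib_iterate_shift (h : IsIID P) {f : Env → ℝ} (hf : Measurable f) (n m : ℕ) :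
    IdentDistrib (fun ω => f (shift^[n] ω)) (fun ω => f (shift^[m] ω)) P P := by
  have key : ∀ n : ℕ, P.map (fun ω => f (shift^[n] ω)) = P.map f := fun n => by
    have hmp := h.measurePreserving_shift.iterate n
    rw [← hmp.map_eq, Measure.map_map hf hmp.measurable, hmp.map_eq]
    rfl
  have hm : ∀ n : ℕ, Measurable fun ω => f (shift^[n] ω) := fun n =>
    hf.comp (h.measurePreserving_shift.iterate n).measurable
  exact ⟨(hm n).aemeasurable, (hm m).aemeasurable, by rw [key, key]⟩

lemma truncMoment_le_crossThird {ω : Env} {i : ℤ} (hω : crossThird i ω ≠ ⊤) (K : ℕ) :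
    truncMoment ω K 3 i ≤ (crossThird i ω).toReal := by
  rw [← ENNReal.ofReal_le_iff_le_toReal hω, truncMoment,
    ENNReal.ofReal_sum_of_nonneg fun k _ => mul_nonneg (by positivity) (hit_nonneg ..)]
  exact ENNReal.sum_le_tsum _

lemma IsIID.ae_crossThird_ne_top (h : IsIID P) (hfin : ∀ᵐ ω ∂P, crossThird 0 ω ≠ ⊤) :
    ∀ᵐ ω ∂P, ∀ i : ℕ, crossThird i ω ≠ ⊤ := by
  filter_upwards [ae_iterate_shift h hfin] with ω hω i
  have := hω i
  rwa [crossThird_iterate_shift, zero_add] at this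

/-- Polynomial growth of the sums of third moments. -/
lemma IsIID.exists_sum_crossThird_le (h : IsIID P) {q δ : ℝ} (hq0 : 0 < q) (hq1 : q ≤ 1)
    (hδ : 0 < δ) (hint : ∫⁻ ω, crossThird 0 ω ^ q ∂P ≠ ⊤) :
    ∀ᵐ ω ∂P, ∃ S : ℝ, 0 ≤ S ∧ ∀ n : ℕ, ∑ i ∈ Finset.range n, (crossThird i ω).toReal ≤
      S * (n : ℝ) ^ ((1 + δ) / q) := by
  have hstat : ∀ n : ℕ, ∫⁻ ω, crossThird n ω ^ q ∂P = ∫⁻ ω, crossThird 0 ω ^ q ∂P := by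
    intro n
    rw [← (h.measurePreserving_shift.iterate n).lintegral_comp
      ((measurable_crossThird 0).pow_const q)]
    simp only [crossThird_iterate_shift, zero_add]
  have hfin0 : ∀ᵐ ω ∂P, crossThird 0 ω ≠ ⊤ := by
    filter_upwards [ae_lt_top ((measurable_crossThird 0).pow_const q) hint] with ω hω htop
    rw [htop, ENNReal.top_rpow_of_pos hq0] at hω
    exact lt_irrefl _ hω
  -- Summable weights make the weighted series of `q`-th powers integrable, hence almost surely
  -- finite; its sum gives the random constant.
  set a : ℕ → ℝ := fun n => ((n : ℝ) + 1) ^ (-(1 + δ)) with ha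
  have ha0 : ∀ n, 0 < a n := fun n => Real.rpow_pos_of_pos (by positivity) _
  have hsum : Summable a := by
    have := (summable_nat_add_iff 1).2 (Real.summable_nat_rpow.2 (by linarith : -(1 + δ) < -1))
    refine this.congr fun n => ?_
    simp [ha]
  have hser : ∫⁻ ω, ∑' n : ℕ, ENNReal.ofReal (a n) * crossThird n ω ^ q ∂P ≠ ⊤ := by
    rw [lintegral_tsum fun n : ℕ =>
      (((measurable_crossThird (n : ℤ)).pow_const q).const_mul _).aemeasurable]
    have hterm : ∀ n : ℕ, ∫⁻ ω, ENNReal.ofReal (a n) * crossThird n ω ^ q ∂P =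
        ENNReal.ofReal (a n) * ∫⁻ ω, crossThird 0 ω ^ q ∂P := fun n => by
      rw [lintegral_const_mul _ ((measurable_crossThird (n : ℤ)).pow_const q), hstat]
    rw [tsum_congr hterm, ENNReal.tsum_mul_right]
    exact ENNReal.mul_ne_top hsum.tsum_ofReal_ne_top hint
  have hserm : Measurable fun ω => ∑' n : ℕ, ENNReal.ofReal (a n) * crossThird n ω ^ q :=
    Measurable.tsum fun n : ℕ => ((measurable_crossThird (n : ℤ)).pow_const q).const_mul _
  filter_upwards [ae_lt_top hserm hser, h.ae_crossThird_ne_top hfin0] with ω hω hfin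
  obtain ⟨s, hs⟩ : ∃ s : ℝ, s = (∑' n : ℕ, ENNReal.ofReal (a n) * crossThird n ω ^ q).toReal :=
    ⟨_, rfl⟩
  have hs0 : 0 ≤ s := hs ▸ ENNReal.toReal_nonneg
  refine ⟨s ^ q⁻¹, Real.rpow_nonneg hs0 _, fun n => ?_⟩
  set f : ℕ → ℝ := fun i => (crossThird i ω).toReal with hf
  have hf0 : ∀ i, 0 ≤ f i := fun i => ENNReal.toReal_nonneg
  have hpart : ∑ i ∈ Finset.range n, a i * f i ^ q ≤ s := by
    rw [hs, ← ENNReal.ofReal_le_iff_le_toReal hω.ne,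
      ENNReal.ofReal_sum_of_nonneg fun i _ => mul_nonneg (ha0 i).le (Real.rpow_nonneg (hf0 i) _)]
    refine le_trans (le_of_eq (Finset.sum_congr rfl fun i _ => ?_)) (ENNReal.sum_le_tsum
      (Finset.range n))
    rw [ENNReal.ofReal_mul (ha0 i).le, ← ENNReal.ofReal_rpow_of_nonneg (hf0 i) hq0.le,
      ENNReal.ofReal_toReal (hfin i)]
  -- Subadditivity of `x ^ q`, where `q ≤ 1` is essential.
  have hsub : (∑ i ∈ Finset.range n, f i) ^ q ≤ ∑ i ∈ Finset.range n, f i ^ q := by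
    induction n with
    | zero => simp [Real.zero_rpow hq0.ne']
    | succ n ih =>
      have hpart' : ∑ i ∈ Finset.range n, a i * f i ^ q ≤ s := le_trans
        (Finset.sum_le_sum_of_subset_of_nonneg (Finset.range_mono (Nat.le_succ n))
          fun i _ _ => mul_nonneg (ha0 i).le (Real.rpow_nonneg (hf0 i) _)) hpart
      rw [Finset.sum_range_succ, Finset.sum_range_succ]
      exact (Real.rpow_add_le_add_rpow (Finset.sum_nonneg fun i _ => hf0 i) (hf0 n) hq0.le
        hq1).trans (add_le_add (ih hpart') le_rfl)
  have hbd : ∑ i ∈ Finset.range n, f i ^ q ≤ s * (n : ℝ) ^ (1 + δ) := by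
    have hterm : ∀ i ∈ Finset.range n, f i ^ q ≤ (n : ℝ) ^ (1 + δ) * (a i * f i ^ q) := by
      intro i hi
      have hin : (i : ℝ) + 1 ≤ n := by exact_mod_cast Finset.mem_range.1 hi
      have : 1 ≤ (n : ℝ) ^ (1 + δ) * a i := by
        simp only [ha]
        rw [Real.rpow_neg (by positivity), ← div_eq_mul_inv, one_le_div (by positivity)]
        exact Real.rpow_le_rpow (by positivity) hin (by linarith)
      rw [← mul_assoc]
      exact le_mul_of_one_le_left (Real.rpow_nonneg (hf0 i) _) this
    refine (Finset.sum_le_sum hterm).trans ?_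
    rw [← Finset.mul_sum, mul_comm]
    gcongr
  have hS0 : 0 ≤ ∑ i ∈ Finset.range n, f i := Finset.sum_nonneg fun i _ => hf0 i
  calc ∑ i ∈ Finset.range n, f i = ((∑ i ∈ Finset.range n, f i) ^ q) ^ q⁻¹ :=
        (Real.rpow_rpow_inv hS0 hq0.ne').symm
    _ ≤ (s * (n : ℝ) ^ (1 + δ)) ^ q⁻¹ :=
        Real.rpow_le_rpow (Real.rpow_nonneg hS0 _) (hsub.trans hbd) (inv_nonneg.2 hq0.le)
    _ = s ^ q⁻¹ * (n : ℝ) ^ ((1 + δ) / q) := by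
        rw [Real.mul_rpow hs0 (by positivity), ← Real.rpow_mul (by positivity), div_eq_mul_inv]

variable [IsProbabilityMeasure P]

lemma integrable_truncMoment (K r : ℕ) (i : ℤ) : Integrable (fun ω => truncMoment ω K r i) P :=
  Integrable.of_bound (measurable_truncMoment K r i).aestronglyMeasurable ((K : ℝ) ^ r)
    (ae_of_all _ fun ω => by
      rw [Real.norm_of_nonneg (truncMoment_nonneg ..)]
      exact truncMoment_le ..)

/-- A moment truncated at `K` depends on a window of `K` sites, so along a progression of step `K +
1` the terms are independent and the strong law applies. The step stays positive even for `K = 0`.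
-/
lemma IsIID.eventually_sum_truncMoment_le (h : IsIID P) (K r : ℕ) :
    ∀ᵐ ω ∂P, ∀ᶠ n : ℕ in atTop, ∑ i ∈ Finset.range n, truncMoment ω K r i ≤
      (∫ ω, truncMoment ω K r 0 ∂P + 2) * n := by
  set d := K + 1 with hd
  have hX : ∀ n : ℕ, (fun ω => truncMoment (shift^[n] ω) K r 0) = fun ω => truncMoment ω K r n := by
    intro n
    ext ω
    rw [truncMoment_iterate_shift, zero_add]
  have hres : ∀ s : ℕ, ∀ᵐ ω ∂P, Tendsto (fun J : ℕ => (∑ j ∈ Finset.range J,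
      truncMoment ω K r ((d * j + s : ℕ) : ℤ)) / J) atTop (𝓝 (∫ ω, truncMoment ω K r 0 ∂P)) := by
    intro s
    have hid : ∀ n m : ℕ, IdentDistrib (fun ω => truncMoment ω K r n)
        (fun ω => truncMoment ω K r m) P P := fun n m => by
      have := identDistrib_iterate_shift h (measurable_truncMoment K r 0) n m
      rwa [hX, hX] at this
    have hlaw := strong_law_ae_real (μ := P)
      (fun (j : ℕ) ω => truncMoment ω K r ((d * j + s : ℕ) : ℤ)) (integrable_truncMoment K r _) ?_
      fun j => hid _ _
    · filter_upwards [hlaw] with ω hω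
      have e := (hid (d * 0 + s) 0).integral_eq
      simp only [Nat.cast_zero] at e
      rwa [e] at hω
    · have hdep : ∀ j : ℕ, DependsOn (fun ω => truncMoment ω K r j)
          (Set.Ioc ((j : ℤ) - K) j) := fun j ω ω' hω =>
        truncMoment_congr K r j fun i h1 h2 => hω i ⟨h1, h2⟩
      have hdisj : ∀ i j : ℕ, i + d ≤ j → Disjoint (Set.Ioc ((i : ℤ) - K) i)
          (Set.Ioc ((j : ℤ) - K) j) := by
        intro i j hij
        refine Set.disjoint_left.2 fun x hx hx' => ?_
        have h1 := hx.2
        have h2 := hx'.1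
        omega
      intro i j hij
      rcases lt_or_gt_of_ne hij with hlt | hlt
      · exact h.indepFun_of_dependsOn (measurable_truncMoment ..) (measurable_truncMoment ..)
          (hdep _) (hdep _) (hdisj _ _ (by nlinarith))
      · exact (h.indepFun_of_dependsOn (measurable_truncMoment ..) (measurable_truncMoment ..)
          (hdep _) (hdep _) (hdisj _ _ (by nlinarith))).symm
  filter_upwards [ae_all_iff.2 hres] with ω hω
  exact eventually_sum_le_of_residues (fun i => truncMoment_nonneg ω K r i) (Nat.succ_pos K)
    (integral_nonneg fun ω => truncMoment_nonneg ..) fun s _ => hω s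

/-- Linear growth of the sums of third moments. -/
lemma IsIID.eventually_sum_crossThird_le (h : IsIID P) (hint : ∫⁻ ω, crossThird 0 ω ∂P ≠ ⊤) :
    ∃ C : ℝ, 0 < C ∧ ∀ᵐ ω ∂P, ∀ᶠ n : ℕ in atTop,
      ∑ i ∈ Finset.range n, (crossThird i ω).toReal ≤ C * n := by
  set F : Env → ℝ := fun ω => (crossThird 0 ω).toReal with hF
  have hFm : Measurable F := (measurable_crossThird 0).ennreal_toReal
  have hFi : Integrable F P :=
    integrable_toReal_of_lintegral_ne_top (measurable_crossThird 0).aemeasurable hint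
  have hfin : ∀ᵐ ω ∂P, crossThird 0 ω ≠ ⊤ :=
    (ae_lt_top (measurable_crossThird 0) hint).mono fun ω hω => hω.ne
  set m := ∫ ω, F ω ∂P with hm
  have hm0 : 0 ≤ m := integral_nonneg fun ω => ENNReal.toReal_nonneg
  -- The truncated part contributes `m + 2` per site and the maximal inequality, at level one, the
  -- last unit.
  refine ⟨m + 3, by linarith, ?_⟩
  set G : ℕ → Env → ℝ := fun K ω => F ω - truncMoment ω K 3 0 with hG
  have hGm : ∀ K, Measurable (G K) := fun K => hFm.sub (measurable_truncMoment K 3 0)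
  have hGi : ∀ K, Integrable (G K) P := fun K => hFi.sub (integrable_truncMoment K 3 0)
  have hlim : Tendsto (fun K => ∫ ω, |G K ω| ∂P) atTop (𝓝 0) := by
    have : Tendsto (fun K => ∫ ω, |G K ω| ∂P) atTop (𝓝 (∫ _, (0 : ℝ) ∂P)) := by
      refine tendsto_integral_of_dominated_convergence F
        (fun K => (hGm K).abs.aestronglyMeasurable) hFi (fun K => ?_) ?_
      · filter_upwards [hfin] with ω hω
        have h1 := truncMoment_le_crossThird hω K
        have h2 := truncMoment_nonneg ω K 3 0
        simp only [hG, Real.norm_eq_abs, abs_abs]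
        rw [abs_of_nonneg (by simpa [hF] using h1)]
        linarith
      · filter_upwards [hfin] with ω hω
        have h1 := (ENNReal.tendsto_toReal hω).comp (tendsto_eMoment_crossThird 0 ω)
        have h2 : Tendsto (fun K => truncMoment ω K 3 0) atTop (𝓝 (F ω)) := by
          refine h1.congr fun K => ?_
          simp only [Function.comp, eMoment]
          exact ENNReal.toReal_ofReal (truncMoment_nonneg ..)
        have h3 := (h2.const_sub (F ω)).abs
        simpa using h3
    simpa using this
  set B : Set Env := {ω | ¬ ∀ᶠ n : ℕ in atTop,
      ∑ i ∈ Finset.range n, (crossThird i ω).toReal ≤ (m + 3) * n} with hB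
  -- The exceptional set does not depend on `K`: up to a null set, failure of the bound makes some
  -- Birkhoff sum of the remainder exceed its length. Letting `K` tend to infinity makes the set
  -- null.
  have hBle : ∀ K, P B ≤ ENNReal.ofReal (∫ ω, |G K ω| ∂P) := by
    intro K
    refine le_trans (measure_mono_ae ?_)
      (measure_exists_lt_birkhoffSum_le h.measurePreserving_shift (hGm K) (hGi K))
    filter_upwards [h.eventually_sum_truncMoment_le K 3, hfin] with ω hω hω0 hωB
    change ∃ n : ℕ, (n : ℝ) < birkhoffSum shift (G K) n ω
    by_contra! hcon
    refine hωB ?_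
    have hmK : ∫ ω, truncMoment ω K 3 0 ∂P ≤ m := by
      refine integral_mono_ae (integrable_truncMoment K 3 0) hFi ?_
      filter_upwards [hfin] with ω hω using truncMoment_le_crossThird hω K
    filter_upwards [hω] with n hn
    have e : birkhoffSum shift (G K) n ω = ∑ i ∈ Finset.range n, (crossThird i ω).toReal -
        ∑ i ∈ Finset.range n, truncMoment ω K 3 i := by
      rw [birkhoffSum, ← Finset.sum_sub_distrib]
      refine Finset.sum_congr rfl fun i _ => ?_
      simp only [hG, hF, crossThird_iterate_shift, truncMoment_iterate_shift, zero_add]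
    have h1 := hcon n
    rw [e] at h1
    have h2 : (∫ ω, truncMoment ω K 3 0 ∂P + 2) * (n : ℝ) ≤ (m + 2) * n := by gcongr
    linarith
  have hB0 : P B = 0 := by
    have hlim' := ENNReal.tendsto_ofReal hlim
    rw [ENNReal.ofReal_zero] at hlim'
    exact le_antisymm (ge_of_tendsto' hlim' hBle) zero_le
  exact hB0

/-- Linear growth of the variances. -/
lemma IsIID.eventually_le_sum_variance (h : IsIID P) (hκ : 0 < kappa P)
    (hnd : ¬ ∀ᵐ ω ∂P, ω 0 = 1) :
    ∃ c : ℝ, 0 < c ∧ ∀ᵐ ω ∂P, ∀ᶠ n : ℕ in atTop,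
      c * n ≤ ∑ i ∈ Finset.range n, (ω (i : ℤ) : ℝ) * (1 - ω (i : ℤ)) := by
  set φ : unitInterval → ℝ := fun t => (t : ℝ) * (1 - t) with hφ
  have hφm : Measurable φ := by
    have : Measurable fun t : unitInterval => (t : ℝ) := measurable_subtype_coe
    exact this.mul (this.const_sub 1)
  have hφ0 : ∀ t, 0 ≤ φ t := fun t => mul_nonneg t.2.1 (sub_nonneg.2 t.2.2)
  have hφ1 : ∀ t, φ t ≤ 1 := fun t => mul_le_one₀ t.2.2 (sub_nonneg.2 t.2.2) (by linarith [t.2.1])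
  have hmeas : ∀ x : ℤ, Measurable fun ω : Env => φ (ω x) := fun x =>
    hφm.comp (measurable_pi_apply x)
  have hint : ∀ x : ℤ, Integrable (fun ω : Env => φ (ω x)) P := fun x =>
    Integrable.of_bound (hmeas x).aestronglyMeasurable 1 (ae_of_all _ fun ω => by
      rw [Real.norm_of_nonneg (hφ0 _)]
      exact hφ1 _)
  set v := ∫ ω, φ (ω 0) ∂P with hv
  -- A zero mean would force `ω_0` to be 0 or 1 almost surely; 0 is excluded by `ae_pos`, leaving
  -- the degenerate case.
  have hvpos : 0 < v := by
    refine (integral_nonneg fun ω => hφ0 _).lt_of_ne fun h0 => hnd ?_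
    have hz := (integral_eq_zero_iff_of_nonneg (fun ω => hφ0 _) (hint 0)).1 h0.symm
    filter_upwards [hz, h.ae_pos hκ] with ω hω hpos
    have h1 : (ω 0 : ℝ) * (1 - ω 0) = 0 := hω
    rcases mul_eq_zero.1 h1 with h2 | h2
    · exact absurd h2 (hpos 0).ne'
    · exact Subtype.ext (by simpa using (sub_eq_zero.1 h2).symm)
  refine ⟨v / 2, by positivity, ?_⟩
  have hlaw := strong_law_ae_real (μ := P) (fun (i : ℕ) ω => φ (ω (i : ℤ))) (hint _)
    (fun i j hij => (h.1.indepFun (by exact_mod_cast hij)).comp hφm hφm)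
    fun i => ((h.2 i).trans (h.2 (0 : ℕ)).symm).comp hφm
  filter_upwards [hlaw] with ω hω
  filter_upwards [hω.eventually (lt_mem_nhds (half_lt_self hvpos)), eventually_gt_atTop 0]
    with n hn hn0
  rw [lt_div_iff₀ (by exact_mod_cast hn0)] at hn
  exact hn.le

end Sums

/-! ### Almost sure convergence rates -/

variable {P : Measure Env} [IsProbabilityMeasure P]

lemma supDist_nonneg (ω : Env) (n : ℤ) : 0 ≤ supDist ω n :=
  Real.iSup_nonneg fun _ => abs_nonneg _

/-- A real exponent in `(a, 3]` below `κ`. -/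
lemma exists_exponent {κ : ℝ≥0∞} {a : ℝ} (ha0 : 0 ≤ a) (ha : a < 3) (h : ENNReal.ofReal a < κ) :
    ∃ p : ℝ, a < p ∧ p ≤ 3 ∧ ENNReal.ofReal p < κ := by
  obtain ⟨b, hab, hb⟩ := exists_between h
  have hbt : b ≠ ⊤ := ne_top_of_lt hb
  refine ⟨min b.toReal 3, lt_min ?_ ha, min_le_right _ _, lt_of_le_of_lt ?_ hb⟩
  · exact (ENNReal.ofReal_lt_iff_lt_toReal ha0 hbt).1 hab
  · exact (ENNReal.ofReal_le_ofReal (min_le_left _ _)).trans (ENNReal.ofReal_toReal hbt).le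

lemma IsIID.ae_crossThird_ne_top_of_two_lt (h : IsIID P) (hκ : 2 < kappa P) :
    ∀ᵐ ω ∂P, ∀ i : ℕ, crossThird i ω ≠ ⊤ := by
  obtain ⟨p, hp2, hp3, hp⟩ := exists_exponent (a := 2) (by norm_num) (by norm_num)
    (by simpa using hκ)
  refine h.ae_crossThird_ne_top ?_
  filter_upwards [ae_lt_top ((measurable_crossThird 0).pow_const (p / 3))
    (h.crossThird_bound (by linarith) hp3 hp)] with ω hω htop
  rw [htop, ENNReal.top_rpow_of_pos (by linarith)] at hω
  exact lt_irrefl _ hω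

/-- Quenched Berry–Esseen bound in terms of the third moments of the crossing times. -/
lemma IsIID.exists_supDist_le (h : IsIID P) (hκ : 2 < kappa P) (hnd : ¬ ∀ᵐ ω ∂P, ω 0 = 1) :
    ∃ c : ℝ, 0 < c ∧ ∀ᵐ ω ∂P,
      (∀ n : ℕ, (∀ᵐ X ∂(quenched ω), hittingTime n X ≠ ⊤) ∧
        MemLp (hittingTimeReal n) 2 (quenched ω)) ∧
      ∀ᶠ n : ℕ in atTop, 0 < quenchedVar ω n ∧
        supDist ω n ≤ 80 * (∑ i ∈ Finset.range n, (crossThird i ω).toReal) / √(c * n) ^ 3 := by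
  obtain ⟨c, hc, hcv⟩ := h.eventually_le_sum_variance ((by norm_num : (0 : ℝ≥0∞) < 2).trans hκ) hnd
  refine ⟨c, hc, ?_⟩
  filter_upwards [hcv, h.ae_isProbabilityMeasure_crossLaw ((by norm_num : (1 : ℝ≥0∞) < 2).trans hκ),
    h.ae_crossThird_ne_top_of_two_lt hκ] with ω hvar hprob hfin
  have hL3 : ∀ i : ℕ, MemLp id 3 (crossLaw ω i) := fun i => memLp_crossLaw (hfin i)
  have hBE := quenched_berryEsseen ω hprob hL3
  refine ⟨fun n => ⟨(hBE n).1, (hBE n).2.1⟩, ?_⟩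
  filter_upwards [hvar, eventually_gt_atTop 0] with n hn hn0
  have hn0' : (0 : ℝ) < n := by exact_mod_cast hn0
  have hle : c * n ≤ quenchedVar ω n := by
    rw [(hBE n).2.2.1]
    refine hn.trans (Finset.sum_le_sum fun i _ => ?_)
    have := hprob i
    exact mul_one_sub_le_variance ((hL3 i).mono_exponent (by norm_num))
  have hcn : 0 < c * n := by positivity
  have hpos := hcn.trans_le hle
  refine ⟨hpos, ((hBE n).2.2.2 hpos).trans ?_⟩
  have hsum : ∑ i ∈ Finset.range n, ∫ x, |x - ∫ y, y ∂(crossLaw ω i)| ^ 3 ∂(crossLaw ω i) ≤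
      2 * ∑ i ∈ Finset.range n, (crossThird i ω).toReal := by
    rw [Finset.mul_sum]
    refine Finset.sum_le_sum fun i _ => ?_
    have := hprob i
    exact integral_abs_sub_mean_cube_le (hfin i)
  have hS0 : 0 ≤ ∑ i ∈ Finset.range n, (crossThird i ω).toReal :=
    Finset.sum_nonneg fun i _ => ENNReal.toReal_nonneg
  have hsq : 0 < √(c * n) := Real.sqrt_pos.2 hcn
  -- The 80 is the Berry–Esseen constant 40 times the 2 lost in centring the third moments.
  exact div_le_div₀ (by positivity) (by linarith) (by positivity)
    (pow_le_pow_left₀ hsq.le (Real.sqrt_le_sqrt hle) 3)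

lemma sqrt_mul_cube {c x : ℝ} (hc : 0 ≤ c) : √(c * x) ^ 3 = √c ^ 3 * √x ^ 3 := by
  rw [Real.sqrt_mul hc, mul_pow]

/-- The order `n ^ (-1/2)` if `κ > 3`. -/
lemma IsIID.limsup_supDist_le (h : IsIID P) (hκ : 3 < kappa P) (hnd : ¬ ∀ᵐ ω ∂P, ω 0 = 1) :
    ∃ C : ℝ, 0 < C ∧ ∀ᵐ ω ∂P,
      limsup (fun n : ℕ => ((√(n : ℝ) * supDist ω n : ℝ) : EReal)) atTop ≤ (C : EReal) := by
  obtain ⟨c, hc, hsup⟩ := h.exists_supDist_le ((by norm_num : (2 : ℝ≥0∞) < 3).trans hκ) hnd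
  have hint : ∫⁻ ω, crossThird 0 ω ∂P ≠ ⊤ := by
    have := h.crossThird_bound (p := 3) (by norm_num) le_rfl (by simpa using hκ)
    simpa using this
  obtain ⟨D, hD, hsum⟩ := h.eventually_sum_crossThird_le hint
  refine ⟨80 * D / √c ^ 3, by positivity, ?_⟩
  filter_upwards [hsup, hsum] with ω hω hωD
  refine limsup_le_of_le (by isBoundedDefault) ?_
  filter_upwards [hω.2, hωD, eventually_gt_atTop 0] with n hn hnD hn0
  have hn0' : (0 : ℝ) < n := by exact_mod_cast hn0
  rw [EReal.coe_le_coe_iff]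
  have hsn : 0 < √(n : ℝ) := Real.sqrt_pos.2 hn0'
  have hsc : 0 < √c := Real.sqrt_pos.2 hc
  have hnn : √(n : ℝ) * √n = n := Real.mul_self_sqrt hn0'.le
  calc √(n : ℝ) * supDist ω n
      ≤ √n * (80 * (D * n) / √(c * n) ^ 3) := by
        refine mul_le_mul_of_nonneg_left (hn.2.trans ?_) hsn.le
        gcongr
    _ = 80 * D / √c ^ 3 := by
        rw [sqrt_mul_cube hc.le, show √(n : ℝ) ^ 3 = n * √n by rw [pow_succ, sq, hnn]]
        field_simp

/-- The order `n ^ (3/κ - 3/2 + ε)` if `2 < κ ≤ 3`. -/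
lemma IsIID.tendsto_rpow_mul_supDist (h : IsIID P) (hκ : 2 < kappa P) (hκ3 : kappa P ≤ 3)
    (hnd : ¬ ∀ᵐ ω ∂P, ω 0 = 1) {ε : ℝ} (hε : 0 < ε) :
    ∀ᵐ ω ∂P, Tendsto
      (fun n : ℕ => (n : ℝ) ^ (3 / 2 - 3 / (kappa P).toReal - ε) * supDist ω n) atTop (𝓝 0) := by
  obtain ⟨c, hc, hsup⟩ := h.exists_supDist_le hκ hnd
  have hκt : kappa P ≠ ⊤ := ne_top_of_le_ne_top (by norm_num) hκ3
  set k := (kappa P).toReal with hk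
  have hkP : kappa P = ENNReal.ofReal k := (ENNReal.ofReal_toReal hκt).symm
  have hk2 : 2 < k := by
    have := (ENNReal.toReal_lt_toReal (by norm_num) hκt).2 hκ
    simpa using this
  have hk3 : k ≤ 3 := by
    have := (ENNReal.toReal_le_toReal hκt (by norm_num)).2 hκ3
    simpa using this
  -- Replacing `κ` by a smaller exponent spends half of `ε`; the choice of `δ` below spends another
  -- quarter, and the remaining quarter gives the decay `n ^ (-ε/4)`.
  obtain ⟨p, hp0, hpk, hpε⟩ : ∃ p : ℝ, 0 < p ∧ p < k ∧ 3 / p < 3 / k + ε / 2 := by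
    have hr : 0 < 3 / k + ε / 2 := by positivity
    have hlt : 3 / (3 / k + ε / 2) < k := by
      rw [div_lt_iff₀ hr, mul_add, mul_div_cancel₀ _ (by linarith : k ≠ 0)]
      nlinarith
    obtain ⟨p, hp1, hp2⟩ := exists_between hlt
    have hp0 : 0 < p := lt_trans (by positivity) hp1
    refine ⟨p, hp0, hp2, ?_⟩
    rw [div_lt_iff₀ hr] at hp1
    rw [div_lt_iff₀ hp0]
    linarith
  set δ := p * ε / 12 with hδ
  have hδ0 : 0 < δ := by positivity
  have hexp : (1 + δ) / (p / 3) = 3 / p + ε / 4 := by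
    rw [hδ]; field_simp; ring
  have hpκ : ENNReal.ofReal p < kappa P := by
    rw [hkP]; exact (ENNReal.ofReal_lt_ofReal_iff (by linarith)).2 hpk
  filter_upwards [hsup, h.exists_sum_crossThird_le (q := p / 3) (by positivity) (by linarith) hδ0
    (h.crossThird_bound hp0 (by linarith) hpκ)] with ω hω hωS
  obtain ⟨S, hS0, hS⟩ := hωS
  have hsc : 0 < √c := Real.sqrt_pos.2 hc
  have hlim : Tendsto (fun n : ℕ => 80 * S / √c ^ 3 * (n : ℝ) ^ (-(ε / 4))) atTop (𝓝 0) := by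
    have := (tendsto_rpow_neg_atTop (by positivity : 0 < ε / 4)).comp
      (tendsto_natCast_atTop_atTop (R := ℝ))
    simpa [Function.comp_def] using this.const_mul (80 * S / √c ^ 3)
  refine squeeze_zero' (Eventually.of_forall fun n =>
    mul_nonneg (Real.rpow_nonneg (Nat.cast_nonneg _) _) (supDist_nonneg _ _)) ?_ hlim
  filter_upwards [hω.2, eventually_gt_atTop 0] with n hn hn0
  have hn1 : (1 : ℝ) ≤ n := by exact_mod_cast hn0
  have hn0' : (0 : ℝ) < n := by linarith
  have hcube : √(n : ℝ) ^ 3 = (n : ℝ) ^ (3 / 2 : ℝ) := by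
    rw [Real.sqrt_eq_rpow, ← Real.rpow_natCast, ← Real.rpow_mul hn0'.le]
    norm_num
  calc (n : ℝ) ^ (3 / 2 - 3 / k - ε) * supDist ω n
      ≤ (n : ℝ) ^ (3 / 2 - 3 / k - ε) *
          (80 * (S * (n : ℝ) ^ (3 / p + ε / 4)) / √(c * n) ^ 3) := by
        refine mul_le_mul_of_nonneg_left (hn.2.trans ?_) (by positivity)
        have := hS n
        rw [hexp] at this
        gcongr
    _ = 80 * S / √c ^ 3 * ((n : ℝ) ^ (3 / 2 - 3 / k - ε) * (n : ℝ) ^ (3 / p + ε / 4) /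
          (n : ℝ) ^ (3 / 2 : ℝ)) := by
        rw [sqrt_mul_cube hc.le, hcube]
        have := Real.rpow_pos_of_pos hn0' (3 / 2)
        field_simp
    _ = 80 * S / √c ^ 3 * (n : ℝ) ^ (3 / p - 3 / k - 3 * ε / 4) := by
        rw [← Real.rpow_add hn0', ← Real.rpow_sub hn0']
        congr 2
        ring
    _ ≤ 80 * S / √c ^ 3 * (n : ℝ) ^ (-(ε / 4)) := by
        refine mul_le_mul_of_nonneg_left (Real.rpow_le_rpow_of_exponent_le hn1 ?_) (by positivity)
        linarith

end RWRE

theorem mainTheorem1 (P : Measure RWRE.Env) [IsProbabilityMeasure P]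
    (hiid : RWRE.IsIID P) (hκ : 2 < RWRE.kappa P)
    (hnd : ¬ ∀ᵐ ω ∂P, ω 0 = 1) :
    (∀ᵐ ω ∂P,
      (∀ n : ℕ, (∀ᵐ X ∂(RWRE.quenched ω), RWRE.hittingTime n X ≠ ⊤) ∧
        MemLp (RWRE.hittingTimeReal n) 2 (RWRE.quenched ω)) ∧
      ∀ᶠ n : ℕ in atTop, 0 < RWRE.quenchedVar ω n) ∧
    (3 < RWRE.kappa P →
      ∃ C : ℝ, 0 < C ∧ ∀ᵐ ω ∂P,
        limsup (fun n : ℕ => ((√(n : ℝ) * RWRE.supDist ω n : ℝ) : EReal)) atTop ≤ (C : EReal)) ∧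
    (RWRE.kappa P ≤ 3 →
      ∀ ε : ℝ, 0 < ε → ∀ᵐ ω ∂P,
        Tendsto
          (fun n : ℕ => (n : ℝ) ^ (3 / 2 - 3 / (RWRE.kappa P).toReal - ε) * RWRE.supDist ω n)
          atTop (𝓝 0)) := by
  obtain ⟨c, -, hsup⟩ := hiid.exists_supDist_le hκ hnd
  refine ⟨?_, fun h3 => hiid.limsup_supDist_le h3 hnd,
    fun h3 ε hε => hiid.tendsto_rpow_mul_supDist hκ h3 hnd hε⟩
  filter_upwards [hsup] with ω hω
  exact ⟨hω.1, hω.2.mono fun n hn => hn.1⟩
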